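/- Let $n\in\{2,3\}$, $\sigma\in(\sqrt n,2)$, $\lambda>0$, $\Lambda\ge(1+\sigma)\lambda$, and put $p_0=\frac{n(\sigma+1)}{n+\sigma}$, $\tau=\frac{\sigma+1}{\sigma+n}$. For $0<s<2$ let $\mathcal A(n,-s)=\frac{2^s\Gamma((n+s)/2)}{\pi^{n/2}|\Gamma(-s/2)|}$, let $\delta(u,x,y)=u(x+y)+u(x-y)-2u(x)$, and let $$D^\sigma u(x)=\frac{\mathcal A(n,-\sigma)}2\int_{\mathbb R^n}\delta(u,x,y)\frac{y\otimes y}{|y|^{n+2+\sigma}}\,dy,\qquad \mathcal M^-u(x)=\inf_{A\in S_{\lambda,\Lambda}}\mathrm{Tr}(AD^\sigma u(x)),$$ where $S_{\lambda,\Lambda}$ is the set of real symmetric $n\times n$ matrices $A\ge O$ with $\lambda\,\mathrm{Id}\le\frac1{n+\sigma}\{\sigma A+\mathrm{Tr}(A)\mathrm{Id}\}\le\Lambda\,\mathrm{Id}$. Let $B_r$ be the open ball of radius $r$ about $0$, and let $\mathcal C$ be the class of bounded $u\in C^{1}(\mathbb R^n)$ with bounded and globally $(\sigma-1)$-Hölder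 continuous gradient such that $\int_{\mathbb R^n}|\delta(u,x,y)||y|^{-n-\sigma}dy<\infty$ for a.e. $x\in\mathbb R^n$, and $D^\sigma u,\mathcal M^-u\in L^{p_0}(B_1)$. For $N\in\mathbb N$ with $(1-\tau)N>1$ put $L_N=\log((1-\tau)N)$ and $$\varphi_N(r)=\begin{cases}0,& r\ge1,\\[2pt] -\dfrac{(1-r)^2L_N}{2\tau^2(1-\tau)^{(1-\tau)/\tau}},&1-\tau\le r<1,\\[6pt] -\dfrac1{2\tau-1}\Bigl\{\tfrac12(1-\tau)^{-(1-\tau)/\tau}L_N-r^{(2\tau-1)/\tau}\log (rN)-\dfrac{\tau}{2\tau-1}\bigl((1-\tau)^{(2\tau-1)/\tau}-r^{(2\tau-1)/\tau}\bigr)\Bigr\},&\tfrac1N\le r<1-\tau,\\[6pt] \varphi_N(1/N),&0\le r<\tfrac1N,\end{cases}$$ $P_N(x)=\varphi_N(|x|)$, and $$u_N(x)=(-\Delta)^{(2-\sigma)/2}P_N(x)=\mathcal A(n,-(2-\sigma))\int_{\mathbb R^n}\frac{P_N(x)-P_N(x+y)}{|y|^{n+(2-\sigma)}}\,dy .$$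 Then the following hold. 1. $p_0>n/\sigma$. 2. For every $N$ with $(1-\tau)N>1$: $\varphi_N$ is non-decreasing on $[0,\infty)$, $P_N\in C^{1,1}(\mathbb R^n)$ and $P_N=0$ outside $B_1$; the integral defining $u_N(x)$ converges absolutely for every $x$; $u_N$ is radial, $u_N\ge0$ in $\mathbb R^n\setminus B_1$, and $u_N\in\mathcal C$. 3. There is $c=c(n,\sigma,\lambda,\Lambda)>0$ such that for all large $N$ $$\frac{-\inf_{B_1}u_N+\inf_{\mathbb R^n\setminus B_1}u_N}{\|(\mathcal M^-u_N)^+\|_{L^{p_0}(B_1)}}\ge c\,L_N^{1-1/p_0},$$ and this quotient tends to $\infty$ as $N\to\infty$. 4. There is $c=c(n,\sigma,\lambda,\Lambda)>0$ such that for all large $N$ $$\frac{\|D^\sigma u_N\|_{L^{p_0}(B_{1/2})}}{\|\mathcal M^-u_N\|_{L^{p_0}(B_1)}+\|u_N\|_{L^\infty(\mathbb R^n)}}\ge c\,L_N^{1/p_0},$$ and this quotient tends to $\infty$ as $N\to\infty$. 5. Consequently the ABP estimate and the $W^{\sigma,p}$ estimate fail at $p_0$, although $p_0>n/\sigma$: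 there is no constant $C$ with $-\inf_{B_1}u\le-\inf_{\mathbb R^n\setminus B_1}u+C\|(\mathcal M^-u)^+\|_{L^{p_0}(B_1)}$ for all $u\in\mathcal C$, and there is no constant $C$ with $\|D^\sigma u\|_{L^{p_0}(B_{1/2})}\le C(\|\mathcal M^-u\|_{L^{p_0}(B_1)}+\|u\|_{L^\infty(\mathbb R^n)})$ for all $u\in\mathcal C$. -/

import Mathlib

open MeasureTheory Filter Topology

namespace NonlocalABP

noncomputable section

/-- Euclidean space `ℝⁿ`. -/
abbrev E (n : ℕ) : Type := EuclideanSpace ℝ (Fin n)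

/-- The normalizing constant `𝒜(n,-s) = 2^s Γ((n+s)/2) / (π^{n/2} |Γ(-s/2)|)`, for `0 < s < 2`. -/
def normConst (n : ℕ) (s : ℝ) : ℝ :=
  (2 : ℝ) ^ s * Real.Gamma (((n : ℝ) + s) / 2) /
    (Real.pi ^ ((n : ℝ) / 2) * |Real.Gamma (-s / 2)|)

/-- The second difference `δ(u,x,y) = u(x+y) + u(x-y) - 2u(x)`. -/
def secondDiff {n : ℕ} (u : E n → ℝ) (x y : E n) : ℝ :=
  u (x + y) + u (x - y) - 2 * u x

/-- The fractional Hessian of order `s`,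
`D^s u(x) = (𝒜(n,-s)/2) ∫ δ(u,x,y) (y ⊗ y) / |y|^{n+2+s} dy`. -/
def fracHessian {n : ℕ} (s : ℝ) (u : E n → ℝ) (x : E n) : Matrix (Fin n) (Fin n) ℝ :=
  Matrix.of fun i j =>
    normConst n s / 2 *
      ∫ y : E n, secondDiff u x y * (y i * y j) / ‖y‖ ^ ((n : ℝ) + 2 + s)

/-- The Euclidean (Frobenius) norm of a matrix. -/
def matNorm {n : ℕ} (M : Matrix (Fin n) (Fin n) ℝ) : ℝ :=
  Real.sqrt (∑ i, ∑ j, M i j ^ 2)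

/-- `A_s = (s A + tr(A) Id) / (n + s)`. -/
def weighted {n : ℕ} (s : ℝ) (A : Matrix (Fin n) (Fin n) ℝ) : Matrix (Fin n) (Fin n) ℝ :=
  (1 / ((n : ℝ) + s)) • (s • A + A.trace • (1 : Matrix (Fin n) (Fin n) ℝ))

/-- The set `S_{λ,Λ}` of real symmetric matrices `A ≥ O` with `λ Id ≤ A_s ≤ Λ Id`. -/
def ellipticSet (n : ℕ) (s lam Lam : ℝ) : Set (Matrix (Fin n) (Fin n) ℝ) :=
  {A | A.PosSemidef ∧
    (weighted s A - lam • (1 : Matrix (Fin n) (Fin n) ℝ)).PosSemidef ∧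
    (Lam • (1 : Matrix (Fin n) (Fin n) ℝ) - weighted s A).PosSemidef}

/-- The fractional Pucci minimal operator `M⁻u(x) = inf_{A ∈ S_{λ,Λ}} tr(A D^s u(x))`. -/
def pucciMinus {n : ℕ} (s lam Lam : ℝ) (u : E n → ℝ) (x : E n) : ℝ :=
  sInf ((fun A => (A * fracHessian s u x).trace) '' ellipticSet n s lam Lam)

/-- The real number `‖f‖_{L^p(Ω)}` (meaningful when it is finite). -/
def lpNormOn {n : ℕ} (p : ℝ) (Ω : Set (E n)) (f : E n → ℝ) : ℝ :=
  (eLpNorm f (ENNReal.ofReal p) (volume.restrict Ω)).toReal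

/-- The real number `‖f‖_{L^∞(ℝⁿ)}` (meaningful when it is finite). -/
def linftyNorm {n : ℕ} (f : E n → ℝ) : ℝ :=
  (eLpNorm f ⊤ volume).toReal

/-- `u ∈ C^s(ℝⁿ) = C^{1,s-1}(ℝⁿ)`, for `1 < s < 2`. -/
def IsCHolder {n : ℕ} (s : ℝ) (u : E n → ℝ) : Prop :=
  ContDiff ℝ 1 u ∧ ∃ K : ℝ, (∀ x, |u x| ≤ K) ∧ (∀ x, ‖fderiv ℝ u x‖ ≤ K) ∧
    ∀ x y, ‖fderiv ℝ u x - fderiv ℝ u y‖ ≤ K * ‖x - y‖ ^ (s - 1)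

/-- The functions on which the estimates are tested: `u ∈ C^s(ℝⁿ)` (in particular bounded), the
integral defining `D^s u(x)` converges absolutely for a.e. `x`, and `D^s u`, `M⁻u` belong to
`L^p(B_1)`. -/
def Admissible {n : ℕ} (s lam Lam p : ℝ) (u : E n → ℝ) : Prop :=
  IsCHolder s u ∧
  (∀ᵐ x : E n, Integrable fun y : E n => secondDiff u x y / ‖y‖ ^ ((n : ℝ) + s)) ∧
  (∀ i j, MemLp (fun x => fracHessian s u x i j) (ENNReal.ofReal p)
    (volume.restrict (Metric.ball (0 : E n) 1))) ∧
  MemLp (pucciMinus s lam Lam u) (ENNReal.ofReal p) (volume.restrict (Metric.ball (0 : E n) 1))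

/-- `-inf_{B_1} u + inf_{ℝⁿ ∖ B_1} u`. -/
def infDrop {n : ℕ} (u : E n → ℝ) : ℝ :=
  -sInf (u '' Metric.ball (0 : E n) 1) + sInf (u '' (Metric.ball (0 : E n) 1)ᶜ)

/-- `p₀ = n(σ+1)/(n+σ)`. -/
def pZero (n : ℕ) (s : ℝ) : ℝ := (n : ℝ) * (s + 1) / ((n : ℝ) + s)

/-- `τ = (σ+1)/(σ+n)`. -/
def tau (n : ℕ) (s : ℝ) : ℝ := (s + 1) / (s + (n : ℝ))

/-- `L_N = log((1-τ)N)`. -/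
def logN (t : ℝ) (N : ℕ) : ℝ := Real.log ((1 - t) * (N : ℝ))

/-- The formula for the profile on `1/N ≤ r < 1-τ`. -/
def profileMiddle (t : ℝ) (N : ℕ) (r : ℝ) : ℝ :=
  -(1 / (2 * t - 1)) *
    ((1 / 2 * (1 - t) ^ (-(1 - t) / t) * logN t N
        - r ^ ((2 * t - 1) / t) * Real.log (r * (N : ℝ)))
      - t / (2 * t - 1) * ((1 - t) ^ ((2 * t - 1) / t) - r ^ ((2 * t - 1) / t)))

/-- The radial profile `φ_N`, used for `(1-τ)N > 1`. -/
def profile (t : ℝ) (N : ℕ) (r : ℝ) : ℝ :=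
  if 1 ≤ r then 0
  else if 1 - t ≤ r then
    -((1 - r) ^ 2 * logN t N / (2 * t ^ 2 * (1 - t) ^ ((1 - t) / t)))
  else if 1 / (N : ℝ) ≤ r then profileMiddle t N r
  else profileMiddle t N (1 / (N : ℝ))

/-- `P_N(x) = φ_N(|x|)`. -/
def potential (n : ℕ) (s : ℝ) (N : ℕ) (x : E n) : ℝ := profile (tau n s) N ‖x‖

/-- The integrand in the fractional Laplacian of order `s` (`0 < s < 1`). -/
def fracLapIntegrand {n : ℕ} (s : ℝ) (P : E n → ℝ) (x y : E n) : ℝ :=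
  (P x - P (x + y)) / ‖y‖ ^ ((n : ℝ) + s)

/-- The fractional Laplacian `(-Δ)^{s/2} P` of order `0 < s < 1` of a bounded Lipschitz function,
given by an absolutely convergent integral. -/
def fracLap {n : ℕ} (s : ℝ) (P : E n → ℝ) (x : E n) : ℝ :=
  normConst n s * ∫ y : E n, fracLapIntegrand s P x y

/-- `u_N = (-Δ)^{(2-σ)/2} P_N`. -/
def exampleFn (n : ℕ) (s : ℝ) (N : ℕ) : E n → ℝ := fracLap (2 - s) (potential n s N)

end

end NonlocalABP

namespace NonlocalABP

/-! ### Power kernels on `ℝⁿ` -/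

/-! Composing `D^σ` with `(-Δ)^{(2-σ)/2}` gives a local operator. The symbol of `D^σ` is a negative
multiple of `|ξ|^σ Id + σ|ξ|^{σ-2} ξ⊗ξ`, and that of `(-Δ)^{(2-σ)/2}` is a multiple of `|ξ|^{2-σ}`.
The fractional powers cancel, so `D^σ u_N = κ(ΔP_N Id + σ D²P_N)` almost everywhere with `κ > 0`
(`exists_fracHessian_fracLap_eq`). The problem then concerns an ordinary Pucci-type operator acting
on the Hessian of a radial function.

Put `G = φ'(r)/r`. On `1/N ≤ r < 1-τ` the profile has `G = r^{-1/τ} log(rN)/τ`. For `A` in the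
elliptic class with trace `T` and radial value `q`, the relation `(n+σ)τ = σ+1` turns `tr(A D^σ
u_N)` into `κ` times `(σ/τ) G (T-q) + r^{-1/τ}(T+σq)/τ`. The logarithm is multiplied by `T-q ≥ 0`,
which vanishes when `A` is a multiple of the radial projection, and that matrix is admissible
because `Λ ≥ (1+σ)λ`. Hence `M⁻u_N` is comparable to `r^{-1/τ}` there
(`pucciMatrix_hessMatrix_middle`), while `D^σ u_N` keeps the factor `log(rN)`
(`exists_le_matNorm_hessMatrix`). On the outer annulus `M⁻u_N` is nonpositive and `O(L_N)`
(`pucciMatrix_hessMatrix_outer`).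

Since `p₀ = nτ`, the function `r^{-1/τ}` is critical in `L^{p₀}`: its norm on the annulus is of
order `L_N^{1/p₀}`. So `(M⁻u_N)⁺` has norm of order `L_N^{1/p₀}`, `M⁻u_N` has norm `O(L_N)`, and
`D^σ u_N` has norm at least of order `L_N^{1+1/p₀}`. Moreover `P_N ≤ 0` is minimal at the origin
with `P_N(0) ≤ -cL_N` and vanishes outside the unit ball, so `u_N(0) ≤ -cL_N` while `u_N ≥ 0`
outside. Finally `P_N` is Hölder of exponent `2 - 1/τ` with constant `O(L_N)`, and `2 - 1/τ > 2-σ`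
because `σ² > n`, whence `‖u_N‖_∞ = O(L_N)`. Dividing gives both rates.

The local identity is justified for the merely `C^{1,1}` potential by uniqueness of Fourier
transforms in `L¹`. The required absolute convergence rests on
`IsC11Bump.exists_integral_abs_mixedDiff_le`, where the failure of smoothness across three spheres
is paid for by the small volume of the shells around them. -/

theorem integrable_min_one_rpow_div {n : ℕ} [NeZero n] {s a : ℝ} (hs : 0 < s) (hsa : s < a) :
    Integrable (fun y : E n => min 1 (‖y‖ ^ a) / ‖y‖ ^ ((n : ℝ) + s)) := by
  have hn : 1 ≤ n := NeZero.one_le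
  rw [integrable_fun_norm_addHaar (volume : Measure (E n))
    (f := fun r : ℝ => min 1 (r ^ a) / r ^ ((n : ℝ) + s))]
  have hpow : ∀ r : ℝ, 0 < r → r ^ (n - 1) / r ^ ((n : ℝ) + s) = r ^ (-1 - s) := by
    intro r hr
    rw [← Real.rpow_natCast, ← Real.rpow_sub hr, Nat.cast_sub hn]
    congr 1
    push_cast
    ring
  rw [finrank_euclideanSpace_fin, ← Set.Ioc_union_Ioi_eq_Ioi (zero_le_one (α := ℝ))]
  refine IntegrableOn.union ?_ ?_
  · have h1 : IntegrableOn (fun r : ℝ => r ^ (a - 1 - s)) (Set.Ioc 0 1) := by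
      rw [← intervalIntegrable_iff_integrableOn_Ioc_of_le zero_le_one]
      exact intervalIntegral.intervalIntegrable_rpow' (by linarith)
    refine h1.congr_fun ?_ measurableSet_Ioc
    intro r hr
    have h2 : r ^ a ≤ 1 := Real.rpow_le_one hr.1.le hr.2 (by linarith)
    simp only [smul_eq_mul, min_eq_right h2]
    rw [mul_div_left_comm, hpow r hr.1, ← Real.rpow_add hr.1]
    congr 1
    ring
  · have h1 : IntegrableOn (fun r : ℝ => r ^ (-1 - s)) (Set.Ioi 1) :=
      integrableOn_Ioi_rpow_of_lt (by linarith) one_pos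
    refine h1.congr_fun ?_ measurableSet_Ioi
    intro r hr
    have hr' : (1 : ℝ) < r := hr
    have h2 : 1 ≤ r ^ a := Real.one_le_rpow hr'.le (by linarith)
    simp only [smul_eq_mul, min_eq_left h2]
    rw [mul_one_div, hpow r (by linarith)]

/-- Dilation by `h`. The power `1 - s` becomes the Hölder exponent of the gradient of `fracLap s P`.
No integrability is assumed: when the integral diverges both sides are `0`. -/
theorem integral_min_div_rpow {n : ℕ} {s h : ℝ} (hh : 0 < h) :
    ∫ z : E n, min h ‖z‖ / ‖z‖ ^ ((n : ℝ) + s) =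
      h ^ (1 - s) * ∫ z : E n, min 1 ‖z‖ / ‖z‖ ^ ((n : ℝ) + s) := by
  have h1 := Measure.integral_comp_smul (volume : Measure (E n))
    (fun z : E n => min h ‖z‖ / ‖z‖ ^ ((n : ℝ) + s)) h
  have h2 : ∀ z : E n, min h ‖h • z‖ / ‖h • z‖ ^ ((n : ℝ) + s) =
      h ^ (1 - n - s) * (min 1 ‖z‖ / ‖z‖ ^ ((n : ℝ) + s)) := by
    intro z
    rw [norm_smul, Real.norm_of_nonneg hh.le, Real.mul_rpow hh.le (norm_nonneg z)]
    have h3 : min h (h * ‖z‖) = h * min 1 ‖z‖ := by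
      rw [mul_min_of_nonneg _ _ hh.le, mul_one]
    rw [h3, show (1 : ℝ) - n - s = 1 - (n + s) by ring, Real.rpow_sub hh, Real.rpow_one]
    ring
  simp only [h2] at h1
  rw [integral_const_mul, finrank_euclideanSpace_fin, abs_of_pos (by positivity), smul_eq_mul] at h1
  have h4 : h ^ (1 - s) = h ^ n * h ^ (1 - n - s) := by
    rw [← Real.rpow_natCast, ← Real.rpow_add hh]; congr 1; ring
  rw [h4, mul_assoc, h1, ← mul_assoc, mul_inv_cancel₀ (by positivity), one_mul]

theorem integrable_of_norm_le_min {n : ℕ} [NeZero n] {s a C : ℝ} (hs : 0 < s) (hsa : s < a)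
    {f : E n → ℝ} (hf : AEStronglyMeasurable f) (hb : ∀ y, |f y| ≤ C * min 1 (‖y‖ ^ a)) :
    Integrable (fun y : E n => f y / ‖y‖ ^ ((n : ℝ) + s)) := by
  refine Integrable.mono' ((integrable_min_one_rpow_div hs hsa).const_mul C) ?_ ?_
  · exact hf.div₀ (measurable_norm.pow_const _).aestronglyMeasurable
  · refine ae_of_all _ fun y => ?_
    rw [norm_div, Real.norm_eq_abs, Real.norm_of_nonneg (by positivity), ← mul_div_assoc]
    gcongr
    exact hb y

/-- Two vectors of the same norm are exchanged by a linear isometry. -/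
theorem exists_linearIsometryEquiv_of_norm_eq {n : ℕ} {x y : E n} (h : ‖x‖ = ‖y‖) :
    ∃ T : E n ≃ₗᵢ[ℝ] E n, T x = y :=
  ⟨(ℝ ∙ (x - y))ᗮ.reflection, Submodule.reflection_sub h⟩

end NonlocalABP
namespace NonlocalABP

/-! ### The symbols of the fractional Laplacian and of the fractional Hessian -/

open scoped RealInnerProductSpace

theorem integral_comp_linearMap_eq {n : ℕ} {A : E n →ₗ[ℝ] E n} (hA : 0 < LinearMap.det A)
    (g : E n → ℝ) :
    ∫ y, g (A y) = (LinearMap.det A)⁻¹ * ∫ y, g y := by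
  let B : E n ≃L[ℝ] E n := (A.equivOfDetNeZero hA.ne').toContinuousLinearEquiv
  have hAe : (A : E n → E n) = B := rfl
  have hemb : MeasurableEmbedding (A : E n → E n) := by
    rw [hAe]
    exact B.toHomeomorph.measurableEmbedding
  rw [← hemb.integral_map, Measure.map_linearMap_addHaar_eq_smul_addHaar _ hA.ne',
    integral_smul_measure, abs_of_pos (inv_pos.2 hA),
    ENNReal.toReal_ofReal (inv_pos.2 hA).le, smul_eq_mul]

theorem one_sub_cos_nonneg (t : ℝ) : 0 ≤ 1 - Real.cos t := by linarith [Real.cos_le_one t]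

theorem one_sub_cos_inner_le {n : ℕ} (ξ y : E n) :
    1 - Real.cos ⟪ξ, y⟫ ≤ (2 + ‖ξ‖ ^ 2) * min 1 (‖y‖ ^ (2 : ℝ)) := by
  rw [Real.rpow_two, mul_min_of_nonneg _ _ (by positivity), mul_one]
  refine le_min ?_ ?_
  · have := Real.neg_one_le_cos ⟪ξ, y⟫
    nlinarith [sq_nonneg ‖ξ‖]
  · have h1 := Real.one_sub_sq_div_two_le_cos (x := ⟪ξ, y⟫)
    have h2 : ⟪ξ, y⟫ ^ 2 ≤ (‖ξ‖ * ‖y‖) ^ 2 := by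
      rw [← sq_abs]
      exact pow_le_pow_left₀ (abs_nonneg _) (abs_real_inner_le_norm ξ y) 2
    nlinarith [sq_nonneg ‖y‖, sq_nonneg (‖ξ‖ * ‖y‖)]

theorem integrable_one_sub_cos {n : ℕ} [NeZero n] {s : ℝ} (hs : 0 < s) (hs2 : s < 2) (ξ : E n) :
    Integrable (fun y : E n => (1 - Real.cos ⟪ξ, y⟫) / ‖y‖ ^ ((n : ℝ) + s)) := by
  refine integrable_of_norm_le_min (C := 2 + ‖ξ‖ ^ 2) hs hs2
    (Continuous.aestronglyMeasurable (by fun_prop)) fun y => ?_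
  rw [abs_of_nonneg (one_sub_cos_nonneg _)]
  exact one_sub_cos_inner_le ξ y

/-- The symbol of the fractional Laplacian of order `s` is a multiple of `|ξ|^s`. -/
theorem exists_integral_one_sub_cos_eq {n : ℕ} [NeZero n] {s : ℝ} (hs : 0 < s) (hs2 : s < 2) :
    ∃ κ : ℝ, 0 < κ ∧ ∀ ξ : E n,
      ∫ y : E n, (1 - Real.cos ⟪ξ, y⟫) / ‖y‖ ^ ((n : ℝ) + s) = κ * ‖ξ‖ ^ s := by
  obtain ⟨e, he⟩ : ∃ e : E n, ‖e‖ = 1 := exists_norm_eq (E n) zero_le_one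
  set F : E n → ℝ := fun ξ => ∫ y : E n, (1 - Real.cos ⟪ξ, y⟫) / ‖y‖ ^ ((n : ℝ) + s) with hF
  -- Kernel and measure are invariant under isometries, so only the length of `ξ` matters; dilation
  -- by `‖ξ‖` will then produce the power `s`.
  have hrot : ∀ ξ : E n, ‖ξ‖ = 1 → F ξ = F e := by
    intro ξ hξ
    obtain ⟨T, hT⟩ := exists_linearIsometryEquiv_of_norm_eq (hξ.trans he.symm)
    have h := T.measurePreserving.integral_comp T.toHomeomorph.measurableEmbedding
      (fun y : E n => (1 - Real.cos ⟪e, y⟫) / ‖y‖ ^ ((n : ℝ) + s))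
    simp only [hF]
    rw [← h]
    refine integral_congr_ae (ae_of_all _ fun y => ?_)
    simp only [T.norm_map, ← hT, T.inner_map_map]
  have hpos : 0 < F e := by
    refine (integral_pos_iff_support_of_nonneg (fun y => ?_) (integrable_one_sub_cos hs hs2 e)).2 ?_
    · have := one_sub_cos_nonneg ⟪e, y⟫
      positivity
    · have hU : IsOpen {y : E n | Real.cos ⟪e, y⟫ < 1} :=
        isOpen_lt (by fun_prop) continuous_const
      -- At `π e` the cosine is `-1`; openness turns this one point into a set of positive measure.
      have hne : {y : E n | Real.cos ⟪e, y⟫ < 1}.Nonempty := by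
        refine ⟨Real.pi • e, ?_⟩
        simp [inner_smul_right, he]
      refine (hU.measure_pos volume hne).trans_le (measure_mono fun y hy => ?_)
      have hy0 : y ≠ 0 := by
        rintro rfl
        simp at hy
      have h1 : 0 < ‖y‖ := norm_pos_iff.2 hy0
      have h2 : 0 < 1 - Real.cos ⟪e, y⟫ := sub_pos.2 hy
      exact (by positivity : (0 : ℝ) < (1 - Real.cos ⟪e, y⟫) / ‖y‖ ^ ((n : ℝ) + s)).ne'
  refine ⟨F e, hpos, fun ξ => ?_⟩
  rcases eq_or_ne ξ 0 with rfl | hξ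
  · simp [Real.zero_rpow hs.ne']
  have hr : 0 < ‖ξ‖ := norm_pos_iff.2 hξ
  have hu : ‖(‖ξ‖⁻¹ • ξ)‖ = 1 := by
    rw [norm_smul, norm_inv, norm_norm, inv_mul_cancel₀ hr.ne']
  have h1 := Measure.integral_comp_smul (volume : Measure (E n))
    (fun y : E n => (1 - Real.cos ⟪‖ξ‖⁻¹ • ξ, y⟫) / ‖y‖ ^ ((n : ℝ) + s)) ‖ξ‖
  have h2 : ∀ y : E n, (1 - Real.cos ⟪‖ξ‖⁻¹ • ξ, ‖ξ‖ • y⟫) / ‖‖ξ‖ • y‖ ^ ((n : ℝ) + s) =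
      ‖ξ‖ ^ (-((n : ℝ) + s)) * ((1 - Real.cos ⟪ξ, y⟫) / ‖y‖ ^ ((n : ℝ) + s)) := by
    intro y
    rw [norm_smul, norm_norm, Real.mul_rpow hr.le (norm_nonneg y), inner_smul_left,
      inner_smul_right, Real.rpow_neg hr.le]
    simp only [map_inv₀, conj_trivial]
    rw [inv_mul_cancel_left₀ hr.ne', ← div_div, div_eq_inv_mul _ (‖ξ‖ ^ _)]
    ring
  simp only [h2] at h1
  rw [integral_const_mul, finrank_euclideanSpace_fin, abs_of_pos (by positivity), smul_eq_mul] at h1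
  change ‖ξ‖ ^ (-((n : ℝ) + s)) * F ξ = (‖ξ‖ ^ n)⁻¹ * F (‖ξ‖⁻¹ • ξ) at h1
  rw [hrot _ hu] at h1
  have h3 : ‖ξ‖ ^ ((n : ℝ) + s) = ‖ξ‖ ^ n * ‖ξ‖ ^ s := by
    rw [← Real.rpow_natCast, ← Real.rpow_add hr]
  rw [Real.rpow_neg hr.le, h3] at h1
  change F ξ = _
  have h4 : 0 < ‖ξ‖ ^ n := by positivity
  have h5 : 0 < ‖ξ‖ ^ s := by positivity
  field_simp at h1
  linarith

/-- The linear map `I + c v⊗v` pulls the Euclidean form back to `|y|² + t⟨v,y⟩²` with `t = 2c +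
c²|v|²`, so perturbed kernels can be treated by a change of variables. -/
theorem norm_transvection_sq {n : ℕ} (v y : E n) (c : ℝ) :
    ‖y + (c * ⟪v, y⟫) • v‖ ^ 2 = ‖y‖ ^ 2 + (2 * c + c ^ 2 * ‖v‖ ^ 2) * ⟪v, y⟫ ^ 2 := by
  rw [norm_add_sq_real, inner_smul_right, norm_smul, mul_pow, Real.norm_eq_abs, sq_abs,
    real_inner_comm y v]
  ring

theorem sq_rpow_half {x : ℝ} (hx : 0 ≤ x) (a : ℝ) : (x ^ 2) ^ (a / 2) = x ^ a := by
  rw [← Real.rpow_natCast, ← Real.rpow_mul hx]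
  congr 1
  push_cast
  ring

/-- The effect on the symbol of a rank-one perturbation of the metric. -/
theorem integral_one_sub_cos_perturbed {n : ℕ} {s κ : ℝ}
    (hκ : ∀ ξ : E n, ∫ y : E n, (1 - Real.cos ⟪ξ, y⟫) / ‖y‖ ^ ((n : ℝ) + s) = κ * ‖ξ‖ ^ s)
    (ξ v : E n) {c : ℝ} (hc : 0 < 1 + c * ‖v‖ ^ 2) :
    ∫ y : E n, (1 - Real.cos ⟪ξ, y⟫) /
        (‖y‖ ^ 2 + (2 * c + c ^ 2 * ‖v‖ ^ 2) * ⟪v, y⟫ ^ 2) ^ (((n : ℝ) + s) / 2) =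
      (1 + c * ‖v‖ ^ 2)⁻¹ * (κ * (‖ξ‖ ^ 2 + (2 * (-c / (1 + c * ‖v‖ ^ 2)) +
        (-c / (1 + c * ‖v‖ ^ 2)) ^ 2 * ‖v‖ ^ 2) * ⟪v, ξ⟫ ^ 2) ^ (s / 2)) := by
  -- Substitute `w = Ay` with `A = I + c v⊗v`. Then `⟨ξ,y⟩ = ⟨A⁻¹ξ, Ay⟩`, and `A⁻¹ = I -
  -- (c/(1+c|v|²)) v⊗v`, which explains the coefficient `-c/(1+c|v|²)`.
  set A : E n →ₗ[ℝ] E n := LinearMap.transvection (c • (innerₗ (E n) v)) v with hA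
  have hAy : ∀ y, A y = y + (c * ⟪v, y⟫) • v := by
    intro y
    simp [hA, LinearMap.transvection.apply]
  have hdet : LinearMap.det A = 1 + c * ‖v‖ ^ 2 := by
    rw [hA, LinearMap.transvection.det]
    simp
  have h1 := integral_comp_linearMap_eq (A := A) (by rw [hdet]; exact hc)
    (fun w => (1 - Real.cos ⟪ξ + (-c / (1 + c * ‖v‖ ^ 2) * ⟪v, ξ⟫) • v, w⟫) / ‖w‖ ^ ((n : ℝ) + s))
  rw [hκ, hdet] at h1
  rw [← norm_transvection_sq, sq_rpow_half (norm_nonneg _), ← h1]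
  refine integral_congr_ae (ae_of_all _ fun y => ?_)
  simp only
  rw [← norm_transvection_sq, sq_rpow_half (norm_nonneg _), hAy]
  congr 3
  rw [inner_add_left, inner_add_right, inner_add_right, inner_smul_right, inner_smul_right,
    inner_smul_left, inner_smul_left, real_inner_self_eq_norm_sq, real_inner_comm v ξ]
  simp only [conj_trivial]
  field_simp
  ring

/-- For small `t` the perturbed form stays comparable with `|y|²`, which supplies the domination
needed to differentiate in `t` under the integral. -/
theorem half_sq_le_perturbed {n : ℕ} (v y : E n) {t : ℝ} (ht : |t| * (2 * ‖v‖ ^ 2 + 1) ≤ 1) :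
    ‖y‖ ^ 2 / 2 ≤ ‖y‖ ^ 2 + t * ⟪v, y⟫ ^ 2 := by
  have h2 : ⟪v, y⟫ ^ 2 ≤ (‖v‖ * ‖y‖) ^ 2 := by
    rw [← sq_abs]
    exact pow_le_pow_left₀ (abs_nonneg _) (abs_real_inner_le_norm v y) 2
  have h3 : -(|t| * ⟪v, y⟫ ^ 2) ≤ t * ⟪v, y⟫ ^ 2 := by
    nlinarith [neg_abs_le t, sq_nonneg ⟪v, y⟫]
  have h4 : |t| * ⟪v, y⟫ ^ 2 ≤ |t| * (‖v‖ * ‖y‖) ^ 2 := by gcongr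
  nlinarith [sq_nonneg ‖y‖, abs_nonneg t]

/-- The quadratic form of the symbol of the fractional Hessian. -/
theorem integral_one_sub_cos_mul_inner_sq {n : ℕ} [NeZero n] {s κ : ℝ} (hs : 0 < s) (hs2 : s < 2)
    (hκ : ∀ ξ : E n, ∫ y : E n, (1 - Real.cos ⟪ξ, y⟫) / ‖y‖ ^ ((n : ℝ) + s) = κ * ‖ξ‖ ^ s)
    {ξ : E n} (hξ : ξ ≠ 0) (v : E n) :
    ∫ y : E n, (1 - Real.cos ⟪ξ, y⟫) * ⟪v, y⟫ ^ 2 / ‖y‖ ^ ((n : ℝ) + 2 + s) =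
      κ / (n + s) * (‖v‖ ^ 2 * ‖ξ‖ ^ s + s * ‖ξ‖ ^ (s - 2) * ⟪v, ξ⟫ ^ 2) := by
  have hn : (0 : ℝ) < n := by exact_mod_cast Nat.pos_of_ne_zero (NeZero.ne n)
  have hr : 0 < ‖ξ‖ := norm_pos_iff.2 hξ
  set p : ℝ := ((n : ℝ) + s) / 2 with hp
  have hp0 : 0 < p := by positivity
  -- The sought integral is, up to the factor `-p`, the derivative at `t = 0` of `∫ F t`, where
  -- `|y|²` is replaced by `|y|² + t⟨v,y⟩²`. Along `t = 2c + c²|v|²` the same integral is known in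
  -- closed form from `integral_one_sub_cos_perturbed`. Comparing the two derivatives at `c = 0`
  -- gives the formula.
  set q : ℝ → E n → ℝ := fun t y => ‖y‖ ^ 2 + t * ⟪v, y⟫ ^ 2 with hq
  set F : ℝ → E n → ℝ := fun t y => (1 - Real.cos ⟪ξ, y⟫) * q t y ^ (-p) with hFdef
  set F' : ℝ → E n → ℝ := fun t y =>
    (1 - Real.cos ⟪ξ, y⟫) * (⟪v, y⟫ ^ 2 * (-p) * q t y ^ (-p - 1)) with hF'def
  set ε : ℝ := (2 * ‖v‖ ^ 2 + 1)⁻¹ with hε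
  have hε0 : 0 < ε := by positivity
  have hqt : ∀ t ∈ Metric.ball (0 : ℝ) ε, ∀ y, ‖y‖ ^ 2 / 2 ≤ q t y := by
    intro t ht y
    refine half_sq_le_perturbed v y ?_
    rw [mem_ball_zero_iff, Real.norm_eq_abs] at ht
    calc |t| * (2 * ‖v‖ ^ 2 + 1) ≤ (2 * ‖v‖ ^ 2 + 1)⁻¹ * (2 * ‖v‖ ^ 2 + 1) := by gcongr
      _ = 1 := inv_mul_cancel₀ (by positivity)
  have hy0 : ∀ᵐ y : E n, y ≠ 0 := by
    rw [ae_iff]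
    simp
  have hcos := integrable_one_sub_cos hs hs2 ξ
  have hsq : ∀ y : E n, (‖y‖ ^ 2) ^ (-p) = (‖y‖ ^ ((n : ℝ) + s))⁻¹ := by
    intro y
    rw [Real.rpow_neg (by positivity), hp, sq_rpow_half (norm_nonneg _)]
  have hF0 : F 0 = fun y : E n => (1 - Real.cos ⟪ξ, y⟫) / ‖y‖ ^ ((n : ℝ) + s) := by
    ext y
    simp only [hFdef, hq, zero_mul, add_zero, hsq, div_eq_mul_inv]
  have hqm : ∀ t, Measurable (q t) := fun t => Continuous.measurable (by fun_prop)
  have hcm : Measurable fun y : E n => 1 - Real.cos ⟪ξ, y⟫ := Continuous.measurable (by fun_prop)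
  have him : Measurable fun y : E n => ⟪v, y⟫ ^ 2 * (-p) := Continuous.measurable (by fun_prop)
  have hderiv := (hasDerivAt_integral_of_dominated_loc_of_deriv_le (μ := (volume : Measure (E n)))
    (F := F) (F' := F') (x₀ := 0) (s := Metric.ball 0 ε)
    (bound := fun y => ‖v‖ ^ 2 * p * 2 ^ (p + 1) *
      ((1 - Real.cos ⟪ξ, y⟫) / ‖y‖ ^ ((n : ℝ) + s)))
    (Metric.ball_mem_nhds _ hε0)
    (Eventually.of_forall fun t => (hcm.mul ((hqm t).pow_const _)).aestronglyMeasurable)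
    (by rw [hF0]; exact hcos)
    (hcm.mul (him.mul ((hqm 0).pow_const _))).aestronglyMeasurable
    (by
      filter_upwards [hy0] with y hy t ht
      have hyp : 0 < ‖y‖ := norm_pos_iff.2 hy
      have h1 := hqt t ht y
      have h2 : q t y ^ (-p - 1) ≤ (‖y‖ ^ 2 / 2) ^ (-p - 1) :=
        Real.rpow_le_rpow_of_nonpos (by positivity) h1 (by linarith)
      have h3 : (‖y‖ ^ 2 / 2) ^ (-p - 1) =
          2 ^ (p + 1) * ((‖y‖ ^ ((n : ℝ) + s))⁻¹ * (‖y‖ ^ 2)⁻¹) := by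
        rw [Real.div_rpow (by positivity) (by positivity), div_eq_mul_inv, ← Real.rpow_neg
          (by positivity), Real.rpow_sub (by positivity), Real.rpow_one, hsq,
          show -(-p - 1) = p + 1 by ring]
        ring
      have h4 : ⟪v, y⟫ ^ 2 ≤ (‖v‖ * ‖y‖) ^ 2 := by
        rw [← sq_abs]
        exact pow_le_pow_left₀ (abs_nonneg _) (abs_real_inner_le_norm v y) 2
      have h5 : 0 ≤ q t y ^ (-p - 1) :=
        Real.rpow_nonneg (le_trans (by positivity) h1) _
      have h6 := one_sub_cos_nonneg ⟪ξ, y⟫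
      rw [Real.norm_eq_abs, abs_mul, abs_mul, abs_mul, abs_of_nonneg h6, abs_of_nonneg h5, abs_neg,
        abs_of_pos hp0, abs_of_nonneg (sq_nonneg ⟪v, y⟫)]
      calc (1 - Real.cos ⟪ξ, y⟫) * (⟪v, y⟫ ^ 2 * p * q t y ^ (-p - 1))
          ≤ (1 - Real.cos ⟪ξ, y⟫) * ((‖v‖ * ‖y‖) ^ 2 * p *
            (2 ^ (p + 1) * ((‖y‖ ^ ((n : ℝ) + s))⁻¹ * (‖y‖ ^ 2)⁻¹))) := by
            rw [← h3]
            gcongr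
        _ = _ := by field_simp)
    (hcos.const_mul _)
    (by
      filter_upwards [hy0] with y hy t ht
      have hyp : 0 < ‖y‖ := norm_pos_iff.2 hy
      have h1 : 0 < q t y := lt_of_lt_of_le (by positivity) (hqt t ht y)
      have h2 : HasDerivAt (fun t => q t y) (⟪v, y⟫ ^ 2) t := by
        exact (((hasDerivAt_id t).mul_const (⟪v, y⟫ ^ 2)).const_add (‖y‖ ^ 2)).congr_deriv
          (one_mul _)
      exact (h2.rpow_const (Or.inl h1.ne')).const_mul _)).2
  set V : ℝ := ‖v‖ ^ 2 with hV
  set P : ℝ := ⟪v, ξ⟫ ^ 2 with hP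
  have hcomp : HasDerivAt (fun c : ℝ => ∫ y, F (2 * c + c ^ 2 * V) y) ((∫ y, F' 0 y) * 2) 0 := by
    have h1 : HasDerivAt (fun c : ℝ => 2 * c + c ^ 2 * V) 2 0 := by
      refine (((hasDerivAt_id (0 : ℝ)).const_mul 2).fun_add
        (((hasDerivAt_id (0 : ℝ)).fun_pow 2).mul_const V)).congr_deriv ?_
      simp
    exact HasDerivAt.comp (0 : ℝ) (h₂ := fun t => ∫ y, F t y) (by simpa using hderiv) h1
  have hd : HasDerivAt (fun c : ℝ => 1 + c * V) V 0 := by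
    simpa using ((hasDerivAt_id (0 : ℝ)).mul_const V).const_add 1
  have hw : HasDerivAt (fun c : ℝ => -c / (1 + c * V)) (-1) 0 := by
    refine ((hasDerivAt_id (0 : ℝ)).fun_neg.fun_div hd (by simp)).congr_deriv ?_
    simp
  have hk : HasDerivAt (fun c : ℝ => ‖ξ‖ ^ 2 + (2 * (-c / (1 + c * V)) +
      (-c / (1 + c * V)) ^ 2 * V) * P) (-2 * P) 0 := by
    refine ((((hw.const_mul 2).fun_add
      ((hw.fun_pow 2).mul_const V)).mul_const P).const_add (‖ξ‖ ^ 2)).congr_deriv ?_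
    simp
  have hR : HasDerivAt (fun c : ℝ => (1 + c * V)⁻¹ * (κ * (‖ξ‖ ^ 2 + (2 * (-c / (1 + c * V)) +
      (-c / (1 + c * V)) ^ 2 * V) * P) ^ (s / 2)))
      (-κ * (V * ‖ξ‖ ^ s + s * ‖ξ‖ ^ (s - 2) * P)) 0 := by
    have h1 := (hd.fun_inv (by simp)).fun_mul ((hk.rpow_const (p := s / 2)
      (Or.inl (by simpa using hξ))).const_mul κ)
    refine h1.congr_deriv ?_
    have h2 : (‖ξ‖ ^ 2) ^ (s / 2 - 1) = ‖ξ‖ ^ (s - 2) := by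
      rw [show s / 2 - 1 = (s - 2) / 2 by ring, sq_rpow_half hr.le]
    simp [h2, sq_rpow_half hr.le]
    ring
  have hev : (fun c : ℝ => ∫ y, F (2 * c + c ^ 2 * V) y) =ᶠ[𝓝 0]
      (fun c : ℝ => (1 + c * V)⁻¹ * (κ * (‖ξ‖ ^ 2 + (2 * (-c / (1 + c * V)) +
      (-c / (1 + c * V)) ^ 2 * V) * P) ^ (s / 2))) := by
    have h1 : ∀ᶠ c : ℝ in 𝓝 0, 0 < 1 + c * V :=
      hd.continuousAt.eventually (lt_mem_nhds (by simp))
    filter_upwards [h1] with c hc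
    rw [← integral_one_sub_cos_perturbed hκ ξ v hc]
    refine integral_congr_ae ?_
    filter_upwards [hy0] with y hy
    simp only [hFdef, hq, div_eq_mul_inv]
    rw [Real.rpow_neg]
    · rw [hp, div_eq_mul_inv]
    · exact le_of_le_of_eq (by positivity) (norm_transvection_sq v y c)
  have hmain := (hcomp.congr_of_eventuallyEq hev.symm).unique hR
  have hF'0 : ∫ y, F' 0 y =
      -p * ∫ y : E n, (1 - Real.cos ⟪ξ, y⟫) * ⟪v, y⟫ ^ 2 / ‖y‖ ^ ((n : ℝ) + 2 + s) := by
    rw [← integral_const_mul]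
    refine integral_congr_ae (ae_of_all _ fun y => ?_)
    simp only [hF'def, hq, zero_mul, add_zero]
    rw [show -p - 1 = -(((n : ℝ) + 2 + s) / 2) by rw [hp]; ring, Real.rpow_neg (by positivity),
      sq_rpow_half (norm_nonneg _)]
    ring
  rw [hF'0] at hmain
  have hns : (0 : ℝ) < n + s := by positivity
  rw [div_mul_eq_mul_div, eq_div_iff hns.ne']
  rw [hp] at hmain
  linarith

theorem integrable_one_sub_cos_mul_coord {n : ℕ} [NeZero n] {s : ℝ} (hs : 0 < s) (hs2 : s < 2)
    (ξ : E n) (i j : Fin n) :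
    Integrable fun y : E n =>
      (1 - Real.cos ⟪ξ, y⟫) * (y i * y j) / ‖y‖ ^ ((n : ℝ) + 2 + s) := by
  refine (integrable_one_sub_cos hs hs2 ξ).mono' (Measurable.aestronglyMeasurable
    ((Continuous.measurable (by fun_prop)).div (measurable_norm.pow_const _))) ?_
  refine ae_of_all _ fun y => ?_
  rcases eq_or_ne y 0 with rfl | hy
  · simp
  have hyp : 0 < ‖y‖ := norm_pos_iff.2 hy
  have h1 : |y i * y j| ≤ ‖y‖ ^ 2 := by
    rw [abs_mul, sq]
    exact mul_le_mul (PiLp.norm_apply_le y i) (PiLp.norm_apply_le y j) (abs_nonneg _) hyp.le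
  have h2 : ‖y‖ ^ ((n : ℝ) + 2 + s) = ‖y‖ ^ 2 * ‖y‖ ^ ((n : ℝ) + s) := by
    rw [← Real.rpow_natCast, ← Real.rpow_add hyp]
    congr 1
    push_cast
    ring
  have h6 := one_sub_cos_nonneg ⟪ξ, y⟫
  rw [norm_div, norm_mul, Real.norm_eq_abs, Real.norm_eq_abs, abs_of_nonneg h6,
    Real.norm_of_nonneg (by positivity), h2, div_le_div_iff₀ (by positivity) (by positivity)]
  calc (1 - Real.cos ⟪ξ, y⟫) * |y i * y j| * ‖y‖ ^ ((n : ℝ) + s)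
      ≤ (1 - Real.cos ⟪ξ, y⟫) * ‖y‖ ^ 2 * ‖y‖ ^ ((n : ℝ) + s) := by gcongr
    _ = _ := by ring

/-- The symbol of the fractional Hessian of order `s`. -/
theorem integral_one_sub_cos_mul_coord {n : ℕ} [NeZero n] {s κ : ℝ} (hs : 0 < s) (hs2 : s < 2)
    (hκ : ∀ ξ : E n, ∫ y : E n, (1 - Real.cos ⟪ξ, y⟫) / ‖y‖ ^ ((n : ℝ) + s) = κ * ‖ξ‖ ^ s)
    {ξ : E n} (hξ : ξ ≠ 0) (i j : Fin n) :
    ∫ y : E n, (1 - Real.cos ⟪ξ, y⟫) * (y i * y j) / ‖y‖ ^ ((n : ℝ) + 2 + s) =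
      κ / (n + s) * ((if i = j then ‖ξ‖ ^ s else 0) + s * ‖ξ‖ ^ (s - 2) * (ξ i * ξ j)) := by
  have hQ := fun v => integral_one_sub_cos_mul_inner_sq hs hs2 hκ hξ v
  set e : Fin n → E n := fun i => EuclideanSpace.single i (1 : ℝ) with he
  have hei : ∀ i (y : E n), ⟪e i, y⟫ = y i := fun i y => by
    simp [he, EuclideanSpace.inner_single_left]
  have hI := integrable_one_sub_cos_mul_coord hs hs2 ξ
  -- Polarization: the mixed entry is read off from the quadratic form at `e i + e j`, `e i` and `e
  -- j`. The case `i = j` is covered, since then `‖e i + e j‖² = 4`.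
  have h1 := hQ (e i + e j)
  have h2 := hQ (e i)
  have h3 := hQ (e j)
  simp only [inner_add_left, hei] at h1 h2 h3
  have hnorm : ‖e i + e j‖ ^ 2 = 2 + 2 * (if i = j then 1 else 0) := by
    rw [norm_add_sq_real, hei]
    simp [he]
    ring
  have hei1 : ∀ i, ‖e i‖ = 1 := fun i => by simp [he]
  rw [hnorm] at h1
  rw [hei1] at h2 h3
  have hsum : ∫ y : E n, (1 - Real.cos ⟪ξ, y⟫) * (y i + y j) ^ 2 / ‖y‖ ^ ((n : ℝ) + 2 + s) =
      (∫ y : E n, (1 - Real.cos ⟪ξ, y⟫) * y i ^ 2 / ‖y‖ ^ ((n : ℝ) + 2 + s)) +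
      (∫ y : E n, (1 - Real.cos ⟪ξ, y⟫) * y j ^ 2 / ‖y‖ ^ ((n : ℝ) + 2 + s)) +
      2 * ∫ y : E n, (1 - Real.cos ⟪ξ, y⟫) * (y i * y j) / ‖y‖ ^ ((n : ℝ) + 2 + s) := by
    have hii := hI i i
    have hjj := hI j j
    simp only [← sq] at hii hjj
    rw [← integral_const_mul, ← integral_add hii hjj, ← integral_add (hii.fun_add hjj)
      ((hI i j).const_mul 2)]
    refine integral_congr_ae (ae_of_all _ fun y => ?_)
    ring
  rw [hsum, h2, h3] at h1
  split_ifs at h1 ⊢ <;> linarith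

end NonlocalABP
namespace NonlocalABP

/-! ### Regularity of the fractional Laplacian of a `C^{1,1}` function with compact support -/

/-- The point `-s/2` lies strictly between the poles `-1` and `0` of the Gamma function. Only this
positivity is used later; the value of the constant is absorbed elsewhere. -/
theorem normConst_pos {n : ℕ} {s : ℝ} (hs : 0 < s) (hs2 : s < 2) : 0 < normConst n s := by
  have h1 : 0 < Real.Gamma (((n : ℝ) + s) / 2) := Real.Gamma_pos_of_pos (by positivity)
  have h2 : Real.Gamma (-s / 2) ≠ 0 := by
    refine Real.Gamma_ne_zero fun m hm => ?_
    have h3 : s = 2 * m := by linarith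
    rcases Nat.eq_zero_or_pos m with rfl | hm0
    · simp at h3
      linarith
    · have : (1 : ℝ) ≤ m := by exact_mod_cast hm0
      linarith
  have h4 := abs_pos.2 h2
  have := Real.pi_pos
  unfold normConst
  positivity

/-- `C^{1,1}` functions vanishing outside the unit ball, with a bound for all the norms involved. -/
structure IsC11Bump {n : ℕ} (K : ℝ) (P : E n → ℝ) : Prop where
  differentiable : Differentiable ℝ P
  abs_le : ∀ x, |P x| ≤ K
  norm_fderiv_le : ∀ x, ‖fderiv ℝ P x‖ ≤ K
  norm_fderiv_sub_le : ∀ x y, ‖fderiv ℝ P x - fderiv ℝ P y‖ ≤ K * ‖x - y‖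
  eq_zero : ∀ x, 1 ≤ ‖x‖ → P x = 0

namespace IsC11Bump

variable {n : ℕ} {K : ℝ} {P : E n → ℝ}

theorem nonneg (h : IsC11Bump K P) : 0 ≤ K := (abs_nonneg _).trans (h.abs_le 0)

theorem abs_sub_le (h : IsC11Bump K P) (x y : E n) : |P x - P y| ≤ K * ‖x - y‖ :=
  convex_univ.norm_image_sub_le_of_norm_fderiv_le (fun z _ => h.differentiable z)
    (fun z _ => h.norm_fderiv_le z) (Set.mem_univ y) (Set.mem_univ x)

theorem continuous (h : IsC11Bump K P) : Continuous P := h.differentiable.continuous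

theorem continuous_fderiv (h : IsC11Bump K P) : Continuous (fderiv ℝ P) :=
  (LipschitzWith.of_dist_le_mul (K := K.toNNReal) fun x y => by
    rw [dist_eq_norm, dist_eq_norm, Real.coe_toNNReal _ h.nonneg]
    exact h.norm_fderiv_sub_le x y).continuous

theorem abs_sub_add_le (h : IsC11Bump K P) (x y : E n) :
    |P x - P (x + y)| ≤ 2 * K * min 1 (‖y‖ ^ (1 : ℝ)) := by
  have hK := h.nonneg
  rw [Real.rpow_one, mul_min_of_nonneg _ _ (by linarith)]
  refine le_min ?_ ?_
  · have h1 := abs_sub (P x) (P (x + y))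
    linarith [h.abs_le x, h.abs_le (x + y)]
  · have h1 := h.abs_sub_le x (x + y)
    rw [sub_add_cancel_left, norm_neg] at h1
    nlinarith [norm_nonneg y]

theorem integrable_fracLapIntegrand [NeZero n] (h : IsC11Bump K P) {s : ℝ} (hs : 0 < s)
    (hs1 : s < 1) (x : E n) : Integrable (fracLapIntegrand s P x) :=
  integrable_of_norm_le_min hs hs1
    (continuous_const.sub (h.continuous.comp (continuous_const.add continuous_id))).aestronglyMeasurable
    (h.abs_sub_add_le x)

theorem norm_fderiv_sub_add_le (h : IsC11Bump K P) (x y : E n) :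
    ‖fderiv ℝ P x - fderiv ℝ P (x + y)‖ ≤ 2 * K * min 1 ‖y‖ := by
  have hK := h.nonneg
  rw [mul_min_of_nonneg _ _ (by linarith)]
  refine le_min ?_ ?_
  · have h1 := norm_sub_le (fderiv ℝ P x) (fderiv ℝ P (x + y))
    linarith [h.norm_fderiv_le x, h.norm_fderiv_le (x + y)]
  · have h1 := h.norm_fderiv_sub_le x (x + y)
    rw [sub_add_cancel_left, norm_neg] at h1
    nlinarith [norm_nonneg y]

end IsC11Bump

/-- The exponent `a` is left free for two purposes. The choice `a = 1` gives regularity for fixed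
`N`. The choice `a = (2t-1)/t` gives a bound linear in `logN`, which the Lipschitz constant cannot
do because it grows like a power of `N`. -/
theorem abs_fracLap_le {n : ℕ} [NeZero n] {s a B : ℝ} (hs : 0 < s) (hs1 : s < 1) (hsa : s < a)
    {P : E n → ℝ} {x : E n} (hB : ∀ y, |P x - P (x + y)| ≤ B * min 1 (‖y‖ ^ a)) :
    |fracLap s P x| ≤
      normConst n s * (B * ∫ y : E n, min 1 (‖y‖ ^ a) / ‖y‖ ^ ((n : ℝ) + s)) := by
  have hc := normConst_pos (n := n) hs (by linarith)
  unfold fracLap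
  rw [abs_mul, abs_of_pos hc, ← integral_const_mul]
  refine mul_le_mul_of_nonneg_left ?_ hc.le
  rw [← Real.norm_eq_abs]
  refine norm_integral_le_of_norm_le ((integrable_min_one_rpow_div hs hsa).const_mul B) ?_
  refine ae_of_all _ fun y => ?_
  rw [fracLapIntegrand, norm_div, Real.norm_eq_abs, Real.norm_of_nonneg (by positivity),
    ← mul_div_assoc]
  gcongr
  exact hB y

/-- The integrand of the gradient of the fractional Laplacian. -/
noncomputable def fracLapGradIntegrand {n : ℕ} (s : ℝ) (P : E n → ℝ) (x y : E n) : E n →L[ℝ] ℝ :=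
  (‖y‖ ^ ((n : ℝ) + s))⁻¹ • (fderiv ℝ P x - fderiv ℝ P (x + y))

namespace IsC11Bump

variable {n : ℕ} {K : ℝ} {P : E n → ℝ}

theorem aestronglyMeasurable_fracLapGradIntegrand (h : IsC11Bump K P) (s : ℝ) (x : E n) :
    AEStronglyMeasurable (fracLapGradIntegrand s P x) :=
  (measurable_norm.pow_const _).inv.aestronglyMeasurable.smul
    (continuous_const.sub
      (h.continuous_fderiv.comp (continuous_const.add continuous_id))).aestronglyMeasurable

theorem norm_fracLapGradIntegrand_le (h : IsC11Bump K P) (s : ℝ) (x y : E n) :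
    ‖fracLapGradIntegrand s P x y‖ ≤
      2 * K * (min 1 (‖y‖ ^ (1 : ℝ)) / ‖y‖ ^ ((n : ℝ) + s)) := by
  rw [fracLapGradIntegrand, norm_smul, norm_inv, Real.norm_of_nonneg (by positivity),
    ← mul_div_assoc, div_eq_inv_mul, Real.rpow_one]
  gcongr
  exact h.norm_fderiv_sub_add_le x y

theorem integrable_fracLapGradIntegrand [NeZero n] (h : IsC11Bump K P) {s : ℝ} (hs : 0 < s)
    (hs1 : s < 1) (x : E n) : Integrable (fracLapGradIntegrand s P x) :=
  ((integrable_min_one_rpow_div hs hs1).const_mul (2 * K)).mono'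
    (h.aestronglyMeasurable_fracLapGradIntegrand s x)
    (ae_of_all _ (h.norm_fracLapGradIntegrand_le s x))

theorem hasFDerivAt_fracLap [NeZero n] (h : IsC11Bump K P) {s : ℝ} (hs : 0 < s)
    (hs1 : s < 1) (x : E n) :
    HasFDerivAt (fracLap s P) (normConst n s • ∫ y, fracLapGradIntegrand s P x y) x := by
  refine HasFDerivAt.const_mul ?_ _
  refine hasFDerivAt_integral_of_dominated_of_fderiv_le (s := Set.univ) Filter.univ_mem
    (Eventually.of_forall fun x => (h.integrable_fracLapIntegrand hs hs1 x).aestronglyMeasurable)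
    (h.integrable_fracLapIntegrand hs hs1 x)
    (h.aestronglyMeasurable_fracLapGradIntegrand s x)
    (ae_of_all _ fun y x _ => h.norm_fracLapGradIntegrand_le s x y)
    ((integrable_min_one_rpow_div hs hs1).const_mul (2 * K)) (ae_of_all _ fun y x _ => ?_)
  have h1 : HasFDerivAt (fun x => P (x + y)) (fderiv ℝ P (x + y)) x :=
    (hasFDerivAt_comp_add_right y).2 (h.differentiable (x + y)).hasFDerivAt
  have h2 := ((h.differentiable x).hasFDerivAt.sub h1).const_mul (‖y‖ ^ ((n : ℝ) + s))⁻¹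
  refine h2.congr_of_eventuallyEq (Eventually.of_forall fun x => ?_)
  simp only [fracLapIntegrand, Pi.sub_apply, div_eq_inv_mul]

/-- The fractional Laplacian of order `s` maps `C^{1,1}` bumps to `C^{2-s}`. -/
theorem isCHolder_fracLap [NeZero n] (h : IsC11Bump K P) {s : ℝ} (hs : 0 < s) (hs1 : s < 1) :
    IsCHolder (2 - s) (fracLap s P) := by
  have hc := normConst_pos (n := n) hs (by linarith)
  have hK := h.nonneg
  set J : ℝ := ∫ y : E n, min 1 (‖y‖ ^ (1 : ℝ)) / ‖y‖ ^ ((n : ℝ) + s) with hJ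
  have hJ0 : 0 ≤ J := integral_nonneg fun y => by positivity
  have hfd := fun x => (h.hasFDerivAt_fracLap hs hs1 x).fderiv
  have hint := h.integrable_fracLapGradIntegrand hs hs1
  set C : ℝ := normConst n s * (2 * K * J) with hC
  have hC0 : 0 ≤ C := by positivity
  have hhol : ∀ x y, ‖fderiv ℝ (fracLap s P) x - fderiv ℝ (fracLap s P) y‖ ≤
      C * ‖x - y‖ ^ (2 - s - 1) := by
    intro x y
    rcases eq_or_ne x y with rfl | hxy
    · rw [sub_self, norm_zero]
      positivity
    have hpos : 0 < ‖x - y‖ := norm_pos_iff.2 (sub_ne_zero.2 hxy)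
    rw [hfd, hfd, ← smul_sub, norm_smul, Real.norm_of_nonneg hc.le, hC, mul_assoc,
      ← integral_sub (hint x) (hint y)]
    refine mul_le_mul_of_nonneg_left ?_ hc.le
    -- The double difference of gradients is at most `2K‖x-y‖` when grouped by the shift `z`, and at
    -- most `2K‖z‖` when grouped by the base point. The integral of the smaller of the two scales
    -- like `‖x-y‖^(1-s)`.
    have h1 : 2 * K * J * ‖x - y‖ ^ (2 - s - 1) =
        ∫ z : E n, 2 * K * (min ‖x - y‖ ‖z‖ / ‖z‖ ^ ((n : ℝ) + s)) := by
      rw [integral_const_mul, integral_min_div_rpow hpos, hJ, show 2 - s - 1 = 1 - s by ring]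
      simp only [Real.rpow_one]
      ring
    rw [h1]
    refine norm_integral_le_of_norm_le ?_ (ae_of_all _ fun z => ?_)
    · refine (integrable_of_norm_le_min (C := ‖x - y‖ + 1) (a := 1) hs hs1
        (Continuous.aestronglyMeasurable (by fun_prop)) fun z => ?_).const_mul _
      rw [abs_of_nonneg (by positivity), Real.rpow_one]
      rcases le_total 1 ‖z‖ with h1 | h1
      · rw [min_eq_left h1]
        linarith [min_le_left ‖x - y‖ ‖z‖]
      · rw [min_eq_right h1]
        nlinarith [min_le_right ‖x - y‖ ‖z‖, norm_nonneg z]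
    · have hsub : fracLapGradIntegrand s P x z - fracLapGradIntegrand s P y z =
          (‖z‖ ^ ((n : ℝ) + s))⁻¹ •
            (fderiv ℝ P x - fderiv ℝ P (x + z) - (fderiv ℝ P y - fderiv ℝ P (y + z))) :=
        (smul_sub _ _ _).symm
      rw [hsub, norm_smul, norm_inv,
        Real.norm_of_nonneg (by positivity), ← mul_div_assoc, div_eq_inv_mul]
      gcongr
      rw [mul_min_of_nonneg _ _ (by linarith)]
      refine le_min ?_ ?_
      · calc ‖fderiv ℝ P x - fderiv ℝ P (x + z) - (fderiv ℝ P y - fderiv ℝ P (y + z))‖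
            = ‖(fderiv ℝ P x - fderiv ℝ P y) - (fderiv ℝ P (x + z) - fderiv ℝ P (y + z))‖ := by
              congr 1; abel
          _ ≤ K * ‖x - y‖ + K * ‖x - y‖ := by
              refine (norm_sub_le _ _).trans (add_le_add (h.norm_fderiv_sub_le x y) ?_)
              simpa using h.norm_fderiv_sub_le (x + z) (y + z)
          _ = _ := by ring
      · refine (norm_sub_le _ _).trans ?_
        have h2 := h.norm_fderiv_sub_le x (x + z)
        have h3 := h.norm_fderiv_sub_le y (y + z)
        rw [sub_add_cancel_left, norm_neg] at h2 h3
        linarith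
  refine ⟨contDiff_one_iff_fderiv.2 ⟨fun x => (h.hasFDerivAt_fracLap hs hs1 x).differentiableAt,
    ?_⟩, C, fun x => ?_, fun x => ?_, hhol⟩
  · rw [continuous_iff_continuousAt]
    intro x
    rw [ContinuousAt, tendsto_iff_norm_sub_tendsto_zero]
    have h1 : Tendsto (fun y => C * ‖y - x‖ ^ (2 - s - 1)) (𝓝 x) (𝓝 0) := by
      have : Continuous fun y => C * ‖y - x‖ ^ (2 - s - 1) :=
        continuous_const.mul ((continuous_id.sub continuous_const).norm.rpow_const
          fun _ => Or.inr (by linarith))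
      have h2 := this.tendsto x
      simpa [Real.zero_rpow (show 2 - s - 1 ≠ 0 by linarith)] using h2
    exact squeeze_zero (fun _ => norm_nonneg _) (fun y => hhol y x) h1
  · exact abs_fracLap_le hs hs1 hs1 (h.abs_sub_add_le x)
  · rw [hfd, norm_smul, Real.norm_of_nonneg hc.le]
    refine mul_le_mul_of_nonneg_left ?_ hc.le
    rw [hJ, ← integral_const_mul]
    exact norm_integral_le_of_norm_le ((integrable_min_one_rpow_div hs hs1).const_mul _)
      (ae_of_all _ (h.norm_fracLapGradIntegrand_le s x))

end IsC11Bump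

end NonlocalABP
namespace NonlocalABP

/-! ### Integral bounds for mixed third differences -/

/-- The first difference in `z` of the second difference in `y`. -/
noncomputable def mixedDiff {n : ℕ} (P : E n → ℝ) (x y z : E n) : ℝ :=
  secondDiff P x y - secondDiff P (x + z) y

/-- The derivative of `t ↦ f(x+ty) + f(x-ty)` compares gradients at points `2t‖y‖` apart. The
hypotheses are local because the estimate is also applied where the function is smooth only on part
of the space. -/
theorem abs_secondDiff_le_of_lipschitz {n : ℕ} {f : E n → ℝ} {x y : E n} {L : ℝ}
    (hd : ∀ w ∈ Metric.closedBall x ‖y‖, DifferentiableAt ℝ f w)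
    (hL : ∀ w ∈ Metric.closedBall x ‖y‖, ∀ w' ∈ Metric.closedBall x ‖y‖,
      ‖fderiv ℝ f w - fderiv ℝ f w'‖ ≤ L * ‖w - w'‖) :
    |secondDiff f x y| ≤ 2 * L * ‖y‖ ^ 2 := by
  rcases eq_or_ne y 0 with rfl | hy
  · simp [secondDiff, two_mul]
  have hy0 : 0 < ‖y‖ := norm_pos_iff.2 hy
  have hmem : ∀ t ∈ Set.Icc (0 : ℝ) 1, x + t • y ∈ Metric.closedBall x ‖y‖ ∧
      x - t • y ∈ Metric.closedBall x ‖y‖ := by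
    intro t ht
    have h1 : ‖t • y‖ ≤ ‖y‖ := by
      rw [norm_smul, Real.norm_of_nonneg ht.1]
      nlinarith [ht.2, norm_nonneg y]
    rw [mem_closedBall_iff_norm, mem_closedBall_iff_norm, add_sub_cancel_left, sub_sub_cancel_left,
      norm_neg]
    exact ⟨h1, h1⟩
  have hL0 : 0 ≤ L := by
    have h := hL _ (hmem 1 ⟨zero_le_one, le_rfl⟩).1 x (Metric.mem_closedBall_self hy0.le)
    rw [one_smul, add_sub_cancel_left] at h
    exact nonneg_of_mul_nonneg_left ((norm_nonneg _).trans h) hy0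
  have hder : ∀ t ∈ Set.Icc (0 : ℝ) 1, HasDerivWithinAt (fun t : ℝ => f (x + t • y) + f (x - t • y))
      (fderiv ℝ f (x + t • y) y - fderiv ℝ f (x - t • y) y) (Set.Icc 0 1) t := by
    intro t ht
    have h1 : HasDerivAt (fun t : ℝ => x + t • y) y t := by
      simpa using ((hasDerivAt_id t).smul_const y).const_add x
    have h2 : HasDerivAt (fun t : ℝ => x - t • y) (-y) t := by
      simpa using ((hasDerivAt_id t).smul_const y).const_sub x
    have h3 := (hd _ (hmem t ht).1).hasFDerivAt.comp_hasDerivAt t h1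
    have h4 := (hd _ (hmem t ht).2).hasFDerivAt.comp_hasDerivAt t h2
    refine ((h3.add h4).congr_deriv ?_).hasDerivWithinAt
    rw [map_neg]
    exact (sub_eq_add_neg _ _).symm
  have hbound : ∀ t ∈ Set.Ico (0 : ℝ) 1,
      ‖fderiv ℝ f (x + t • y) y - fderiv ℝ f (x - t • y) y‖ ≤ 2 * L * ‖y‖ ^ 2 := by
    intro t ht
    have ht' : t ∈ Set.Icc (0 : ℝ) 1 := ⟨ht.1, ht.2.le⟩
    rw [← sub_apply]
    refine ((fderiv ℝ f (x + t • y) - fderiv ℝ f (x - t • y)).le_opNorm y).trans ?_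
    have h1 := hL _ (hmem t ht').1 _ (hmem t ht').2
    have h2 : ‖x + t • y - (x - t • y)‖ ≤ 2 * ‖y‖ := by
      rw [show x + t • y - (x - t • y) = (2 * t) • y by rw [mul_smul, two_smul]; abel, norm_smul,
        Real.norm_of_nonneg (by linarith [ht.1])]
      nlinarith [ht.2]
    calc _ ≤ L * (2 * ‖y‖) * ‖y‖ := by
          gcongr
          exact h1.trans (by gcongr)
      _ = _ := by ring
  have h := norm_image_sub_le_of_norm_deriv_le_segment_01' hder hbound
  simp only [one_smul, zero_smul, add_zero, sub_zero] at h
  rw [secondDiff, two_mul]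
  exact h

/-- All radii involved are at most `3`, hence the factor `3^(n-1)`; the thickness is `2ρ`. Linearity
in `ρ` is the gain that makes up for the loss of one derivative near a sphere. -/
theorem integral_indicator_shell_le {n : ℕ} [NeZero n] {r ρ : ℝ} (hr : r ≤ 1) (hρ : 0 ≤ ρ)
    (hρ2 : ρ ≤ 2) :
    ∫ x : E n, (Set.Icc (r - ρ) (r + ρ)).indicator (fun _ => (1 : ℝ)) ‖x‖ ≤
      n * (volume : Measure (E n)).real (Metric.ball 0 1) * 3 ^ (n - 1) * 2 * ρ := by
  rw [integral_fun_norm_addHaar, finrank_euclideanSpace_fin, nsmul_eq_mul, smul_eq_mul, mul_assoc,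
    mul_assoc, mul_assoc]
  gcongr
  have hint : IntegrableOn (fun _ : ℝ => (3 : ℝ) ^ (n - 1)) (Set.Icc (r - ρ) (r + ρ)) :=
    integrableOn_const (by simp)
  have h1 : ∫ y in Set.Ioi (0 : ℝ),
      y ^ (n - 1) • (Set.Icc (r - ρ) (r + ρ)).indicator (fun _ => (1 : ℝ)) y ≤
      ∫ y in Set.Ioi (0 : ℝ), (Set.Icc (r - ρ) (r + ρ)).indicator (fun _ => (3 : ℝ) ^ (n - 1)) y := by
    refine integral_mono_of_nonneg ?_ ?_ ?_
    · filter_upwards [ae_restrict_mem measurableSet_Ioi] with y hy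
      have : (0 : ℝ) < y := hy
      simp only [Pi.zero_apply, smul_eq_mul]
      exact mul_nonneg (by positivity) (Set.indicator_nonneg (fun _ _ => zero_le_one) _)
    · exact ((integrable_indicator_iff measurableSet_Icc).2 hint).integrableOn
    · filter_upwards [ae_restrict_mem measurableSet_Ioi] with y hy
      have hy0 : (0 : ℝ) < y := hy
      by_cases hm : y ∈ Set.Icc (r - ρ) (r + ρ)
      · simp only [Set.indicator_of_mem hm, smul_eq_mul, mul_one]
        exact pow_le_pow_left₀ hy0.le (by linarith [hm.2]) _
      · simp [Set.indicator_of_notMem hm]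
  refine h1.trans ?_
  have h2 : ∫ y in Set.Ioi (0 : ℝ), (Set.Icc (r - ρ) (r + ρ)).indicator
      (fun _ => (3 : ℝ) ^ (n - 1)) y ≤
      ∫ y, (Set.Icc (r - ρ) (r + ρ)).indicator (fun _ => (3 : ℝ) ^ (n - 1)) y :=
    setIntegral_le_integral ((integrable_indicator_iff measurableSet_Icc).2 hint)
      (ae_of_all _ fun y => Set.indicator_nonneg (fun _ _ => by positivity) _)
  refine h2.trans ?_
  rw [integral_indicator measurableSet_Icc, setIntegral_const, smul_eq_mul, Real.volume_real_Icc,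
    show r + ρ - (r - ρ) = 2 * ρ by ring, max_eq_left (by linarith)]
  linarith

namespace IsC11Bump

variable {n : ℕ} {K : ℝ} {P : E n → ℝ}

theorem abs_secondDiff_le (h : IsC11Bump K P) (x y : E n) :
    |secondDiff P x y| ≤ 2 * K * ‖y‖ ^ 2 :=
  abs_secondDiff_le_of_lipschitz (fun w _ => h.differentiable w)
    fun w _ w' _ => h.norm_fderiv_sub_le w w'

theorem abs_mixedDiff_le_sq (h : IsC11Bump K P) (x y z : E n) :
    |mixedDiff P x y z| ≤ 4 * K * ‖y‖ ^ 2 := by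
  have h1 := abs_sub (secondDiff P x y) (secondDiff P (x + z) y)
  have h2 := h.abs_secondDiff_le x y
  have h3 := h.abs_secondDiff_le (x + z) y
  unfold mixedDiff
  linarith

/-- The first difference in `z` is Lipschitz with constant `K‖z‖`, because the gradient is
Lipschitz. This bound beats `abs_mixedDiff_le_sq` when `‖z‖` is much smaller than `‖y‖`. -/
theorem abs_mixedDiff_le_mul (h : IsC11Bump K P) (x y z : E n) :
    |mixedDiff P x y z| ≤ 2 * K * ‖y‖ * ‖z‖ := by
  set q : E n → ℝ := fun x => P x - P (x + z) with hq
  have hd : ∀ x, HasFDerivAt q (fderiv ℝ P x - fderiv ℝ P (x + z)) x := fun x =>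
    (h.differentiable x).hasFDerivAt.sub
      ((hasFDerivAt_comp_add_right z).2 (h.differentiable (x + z)).hasFDerivAt)
  have hb : ∀ x, ‖fderiv ℝ q x‖ ≤ K * ‖z‖ := fun x => by
    rw [(hd x).fderiv]
    simpa using h.norm_fderiv_sub_le x (x + z)
  have hl : ∀ a b, ‖q a - q b‖ ≤ K * ‖z‖ * ‖a - b‖ := fun a b =>
    convex_univ.norm_image_sub_le_of_norm_fderiv_le (fun w _ => (hd w).differentiableAt)
      (fun w _ => hb w) (Set.mem_univ b) (Set.mem_univ a)
  have h1 := hl (x + y) x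
  have h2 := hl (x - y) x
  rw [add_sub_cancel_left] at h1
  rw [sub_sub_cancel_left, norm_neg] at h2
  have h3 : mixedDiff P x y z = (q (x + y) - q x) + (q (x - y) - q x) := by
    simp only [mixedDiff, secondDiff, hq]
    rw [add_right_comm x z y, add_sub_right_comm x z y]
    ring
  rw [h3]
  refine (abs_add_le _ _).trans ?_
  rw [Real.norm_eq_abs] at h1 h2
  linarith

theorem secondDiff_eq_zero (h : IsC11Bump K P) {x y : E n} (hx : 1 + ‖y‖ ≤ ‖x‖) :
    secondDiff P x y = 0 := by
  have h1 : ‖x‖ - ‖y‖ ≤ ‖x + y‖ := by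
    have := norm_sub_norm_le x (-y)
    rwa [norm_neg, sub_neg_eq_add] at this
  have h2 : ‖x‖ - ‖y‖ ≤ ‖x - y‖ := norm_sub_norm_le x y
  rw [secondDiff, h.eq_zero _ (by linarith), h.eq_zero _ (by linarith),
    h.eq_zero x (by linarith [norm_nonneg y])]
  simp

theorem mixedDiff_eq_zero (h : IsC11Bump K P) {x y z : E n} (hx : 1 + ‖y‖ + ‖z‖ ≤ ‖x‖) :
    mixedDiff P x y z = 0 := by
  have h1 : ‖x‖ - ‖z‖ ≤ ‖x + z‖ := by
    have := norm_sub_norm_le x (-z)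
    rwa [norm_neg, sub_neg_eq_add] at this
  rw [mixedDiff, h.secondDiff_eq_zero (by linarith [norm_nonneg z]),
    h.secondDiff_eq_zero (by linarith), sub_zero]

theorem integrable (h : IsC11Bump K P) : Integrable P :=
  h.continuous.integrable_of_hasCompactSupport
    (HasCompactSupport.intro (isCompact_closedBall (0 : E n) 1) fun x hx => h.eq_zero x (by
      rw [mem_closedBall_zero_iff, not_le] at hx
      exact hx.le))

theorem integrable_secondDiff (h : IsC11Bump K P) (y : E n) :
    Integrable fun x => secondDiff P x y :=
  ((h.integrable.comp_add_right y).add (h.integrable.comp_sub_right y)).sub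
    (h.integrable.const_mul 2)

theorem integrable_mixedDiff (h : IsC11Bump K P) (y z : E n) :
    Integrable fun x => mixedDiff P x y z :=
  (h.integrable_secondDiff y).sub ((h.integrable_secondDiff y).comp_add_right z)

theorem integral_abs_le_of_support {n : ℕ} {f : E n → ℝ} {C : ℝ} (hC : ∀ x, |f x| ≤ C)
    (hsupp : ∀ x, 3 ≤ ‖x‖ → f x = 0) :
    ∫ x, |f x| ≤ C * (volume : Measure (E n)).real (Metric.ball 0 3) := by
  have h1 : ∫ x, |f x| = ∫ x in Metric.ball (0 : E n) 3, |f x| := by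
    refine (setIntegral_eq_integral_of_forall_compl_eq_zero fun x hx => ?_).symm
    rw [mem_ball_zero_iff, not_lt] at hx
    rw [hsupp x hx, abs_zero]
  rw [h1]
  have h2 := norm_setIntegral_le_of_norm_le_const (f := fun x => |f x|) (s := Metric.ball 0 3)
    (μ := volume) measure_ball_lt_top fun x _ => by simpa using hC x
  rw [Real.norm_eq_abs] at h2
  exact (le_abs_self _).trans h2

theorem exists_integral_abs_secondDiff_le (h : IsC11Bump K P) :
    ∃ C, 0 ≤ C ∧ ∀ y, ∫ x, |secondDiff P x y| ≤ C * min 1 (‖y‖ ^ (2 : ℝ)) := by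
  have hK := h.nonneg
  set m := (volume : Measure (E n)).real (Metric.ball 0 3)
  have hm : 0 ≤ m := measureReal_nonneg
  refine ⟨2 * K * m + 4 * ∫ x, |P x|, by positivity, fun y => ?_⟩
  have hI : 0 ≤ ∫ x, |P x| := by positivity
  rcases le_total ‖y‖ 1 with hy | hy
  · rw [Real.rpow_two, min_eq_right (by nlinarith [norm_nonneg y])]
    have h1 := integral_abs_le_of_support (fun x => h.abs_secondDiff_le x y) fun x hx =>
      h.secondDiff_eq_zero (by linarith)
    nlinarith [sq_nonneg ‖y‖]
  · rw [Real.rpow_two, min_eq_left (by nlinarith), mul_one]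
    have h1 : ∫ x, |secondDiff P x y| ≤ ∫ x, (|P (x + y)| + |P (x - y)| + 2 * |P x|) := by
      refine integral_mono (h.integrable_secondDiff y).abs
        (((h.integrable.comp_add_right y).abs.add (h.integrable.comp_sub_right y).abs).add
          (h.integrable.abs.const_mul 2)) fun x => ?_
      simp only [secondDiff]
      refine (abs_sub _ _).trans ?_
      rw [abs_mul, abs_two]
      linarith [abs_add_le (P (x + y)) (P (x - y))]
    rw [integral_add ((h.integrable.comp_add_right y).abs.fun_add (h.integrable.comp_sub_right y).abs)
          (h.integrable.abs.const_mul 2), integral_add (h.integrable.comp_add_right y).abs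
          (h.integrable.comp_sub_right y).abs, integral_const_mul,
          integral_add_right_eq_self (fun x => |P x|), integral_sub_right_eq_self (fun x => |P x|)]
      at h1
    nlinarith

/-- For `‖z‖ ≥ 1`, where the difference in `z` gains nothing; translation invariance of the measure
does the rest. -/
theorem integral_abs_mixedDiff_le_two (h : IsC11Bump K P) (y z : E n) :
    ∫ x, |mixedDiff P x y z| ≤ 2 * ∫ x, |secondDiff P x y| := by
  have hi := h.integrable_secondDiff y
  have h1 : ∫ x, |mixedDiff P x y z| ≤ ∫ x, (|secondDiff P x y| + |secondDiff P (x + z) y|) :=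
    integral_mono (h.integrable_mixedDiff y z).abs
      (hi.abs.add (hi.comp_add_right z).abs) fun x => abs_sub _ _
  rw [integral_add hi.abs (hi.comp_add_right z).abs,
    integral_add_right_eq_self (fun x => |secondDiff P x y|)] at h1
  linarith

/-- The counterpart for `‖y‖ ≥ 1`: the mixed difference is regrouped as a second difference in `y`
of the first difference in `z`. -/
theorem integral_abs_mixedDiff_le_four (h : IsC11Bump K P) (y z : E n) :
    ∫ x, |mixedDiff P x y z| ≤ 4 * ∫ x, |P x - P (x + z)| := by
  have hi : Integrable fun x => P x - P (x + z) :=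
    h.integrable.sub (h.integrable.comp_add_right z)
  have h1 : ∫ x, |mixedDiff P x y z| ≤ ∫ x, (|P (x + y) - P (x + y + z)| +
      |P (x - y) - P (x - y + z)| + 2 * |P x - P (x + z)|) := by
    refine integral_mono (h.integrable_mixedDiff y z).abs
      (((hi.comp_add_right y).abs.add (hi.comp_sub_right y).abs).add (hi.abs.const_mul 2))
      fun x => ?_
    have h2 : mixedDiff P x y z = (P (x + y) - P (x + y + z)) + (P (x - y) - P (x - y + z)) -
        2 * (P x - P (x + z)) := by
      simp only [mixedDiff, secondDiff]
      rw [add_right_comm x z y, add_sub_right_comm x z y]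
      ring
    simp only [h2]
    refine (abs_sub _ _).trans ?_
    rw [abs_mul, abs_two]
    linarith [abs_add_le (P (x + y) - P (x + y + z)) (P (x - y) - P (x - y + z))]
  rw [integral_add ((hi.comp_add_right y).abs.fun_add (hi.comp_sub_right y).abs) (hi.abs.const_mul 2),
    integral_add (hi.comp_add_right y).abs (hi.comp_sub_right y).abs, integral_const_mul,
    integral_add_right_eq_self (fun x => |P x - P (x + z)|),
    integral_sub_right_eq_self (fun x => |P x - P (x + z)|)] at h1
  linarith

/-- `P` is smooth away from the spheres of radii in `R`, and there the mixed difference is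
`O(‖y‖²‖z‖)`. Nearer to them only `C^{1,1}` is available, giving `O(‖y‖ min(‖y‖,‖z‖))`, but this is
needed only on shells of width comparable to `‖y‖+‖z‖`, and the product is again `O(‖y‖²‖z‖)`. The
pointwise `C^{1,1}` bound would not suffice: its homogeneity `2` equals the total order `σ + (2-σ)`
of the two kernels, so it leads to a logarithmic divergence. Averaging in `x` removes it. -/
theorem exists_integral_abs_mixedDiff_le [NeZero n] (h : IsC11Bump K P) {M : ℝ} (hM : 0 ≤ M)
    {R : Finset ℝ} (hR : ∀ r ∈ R, r ≤ 1)
    (hshell : ∀ x y z, (∀ r ∈ R, ‖y‖ + ‖z‖ < |‖x‖ - r|) →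
      |mixedDiff P x y z| ≤ M * ‖y‖ ^ 2 * ‖z‖) :
    ∃ C, 0 ≤ C ∧ ∀ y z, ∫ x, |mixedDiff P x y z| ≤
      C * (min 1 (‖y‖ ^ (2 : ℝ)) * min 1 (‖z‖ ^ (1 : ℝ))) := by
  have hK := h.nonneg
  obtain ⟨C1, hC1, h1⟩ := h.exists_integral_abs_secondDiff_le
  set m := (volume : Measure (E n)).real (Metric.ball 0 3)
  have hm : 0 ≤ m := measureReal_nonneg
  set B := (n : ℝ) * (volume : Measure (E n)).real (Metric.ball 0 1) * 3 ^ (n - 1) * 2 with hB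
  have hB0 : 0 ≤ B := by positivity
  refine ⟨2 * C1 + 4 * (K * m) + (M * m + R.card * (4 * K * (2 * B))), by positivity,
    fun y z => ?_⟩
  simp only [Real.rpow_two, Real.rpow_one] at h1 ⊢
  have hX : 0 ≤ M * m + R.card * (4 * K * (2 * B)) := by positivity
  have hKm : 0 ≤ K * m := by positivity
  rcases le_total 1 ‖z‖ with hz | hz
  · have h2 := h.integral_abs_mixedDiff_le_two y z
    have h3 := h1 y
    rw [min_eq_left hz, mul_one]
    have h4 : 0 ≤ min 1 (‖y‖ ^ 2) := by positivity
    nlinarith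
  rcases le_total 1 ‖y‖ with hy | hy
  · have h2 := h.integral_abs_mixedDiff_le_four y z
    have h3 := integral_abs_le_of_support (f := fun x => P x - P (x + z)) (C := K * ‖z‖)
      (fun x => by simpa using h.abs_sub_le x (x + z)) (fun x hx => by
        have h5 : ‖x‖ - ‖z‖ ≤ ‖x + z‖ := by
          have := norm_sub_norm_le x (-z)
          rwa [norm_neg, sub_neg_eq_add] at this
        rw [h.eq_zero x (by linarith), h.eq_zero (x + z) (by linarith), sub_zero])
    rw [min_eq_left (by nlinarith), one_mul, min_eq_right hz]
    change _ ≤ K * ‖z‖ * m at h3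
    nlinarith [norm_nonneg z]
  rw [min_eq_right (by nlinarith [norm_nonneg y]), min_eq_right hz]
  set ρ := ‖y‖ + ‖z‖ with hρ
  have hρ0 : 0 ≤ ρ := by positivity
  set bad : ℝ → E n → ℝ := fun r x =>
    (Set.Icc (r - ρ) (r + ρ)).indicator (fun _ => (1 : ℝ)) ‖x‖ with hbad
  have hbad0 : ∀ r x, 0 ≤ bad r x := fun r x => Set.indicator_nonneg (fun _ _ => zero_le_one) _
  have hbadint : ∀ r, Integrable (bad r) := by
    intro r
    have h2 : bad r = {x : E n | ‖x‖ ∈ Set.Icc (r - ρ) (r + ρ)}.indicator (fun _ => (1 : ℝ)) := by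
      ext x
      simp [hbad, Set.indicator]
    have hms : MeasurableSet {x : E n | ‖x‖ ∈ Set.Icc (r - ρ) (r + ρ)} :=
      measurable_norm measurableSet_Icc
    rw [h2, integrable_indicator_iff hms]
    refine integrableOn_const (ne_of_lt ?_)
    refine (measure_mono fun x hx => ?_).trans_lt (measure_closedBall_lt_top (x := (0 : E n))
      (r := r + ρ))
    rw [mem_closedBall_zero_iff]
    exact hx.2
  have hball : Integrable ((Metric.ball (0 : E n) 3).indicator fun _ => (1 : ℝ)) := by
    rw [integrable_indicator_iff measurableSet_ball]
    exact integrableOn_const measure_ball_lt_top.ne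
  have hsumint : Integrable fun x => ∑ r ∈ R, bad r x := integrable_finsetSum _ fun r _ => hbadint r
  have hpt : ∀ x, |mixedDiff P x y z| ≤
      M * ‖y‖ ^ 2 * ‖z‖ * (Metric.ball (0 : E n) 3).indicator (fun _ => (1 : ℝ)) x +
      4 * K * (‖y‖ * min ‖y‖ ‖z‖) * ∑ r ∈ R, bad r x := by
    intro x
    have hs0 : 0 ≤ ∑ r ∈ R, bad r x := Finset.sum_nonneg fun r _ => hbad0 r x
    by_cases hx : ∀ r ∈ R, ‖y‖ + ‖z‖ < |‖x‖ - r|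
    · by_cases hx3 : x ∈ Metric.ball (0 : E n) 3
      · rw [Set.indicator_of_mem hx3, mul_one]
        have := hshell x y z hx
        have : 0 ≤ 4 * K * (‖y‖ * min ‖y‖ ‖z‖) * ∑ r ∈ R, bad r x := by positivity
        linarith
      · rw [mem_ball_zero_iff, not_lt] at hx3
        rw [h.mixedDiff_eq_zero (by linarith), abs_zero]
        have : 0 ≤ (Metric.ball (0 : E n) 3).indicator (fun _ => (1 : ℝ)) x :=
          Set.indicator_nonneg (fun _ _ => zero_le_one) _
        positivity
    · push Not at hx
      obtain ⟨r, hr, hrx⟩ := hx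
      have h2 : bad r x = 1 := by
        have : ‖x‖ ∈ Set.Icc (r - ρ) (r + ρ) := by
          rw [_root_.abs_le] at hrx
          constructor <;> linarith [hrx.1, hrx.2]
        simp only [hbad, Set.indicator_of_mem this]
      have h3 : 1 ≤ ∑ r ∈ R, bad r x := by
        rw [← h2]
        exact Finset.single_le_sum (f := fun r => bad r x) (fun r _ => hbad0 r x) hr
      have h4 : |mixedDiff P x y z| ≤ 4 * K * (‖y‖ * min ‖y‖ ‖z‖) := by
        rcases min_choice ‖y‖ ‖z‖ with h5 | h5 <;> rw [h5]
        · have := h.abs_mixedDiff_le_sq x y z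
          linarith
        · have := h.abs_mixedDiff_le_mul x y z
          have : 0 ≤ K * (‖y‖ * ‖z‖) := by positivity
          linarith
      have h6 : 0 ≤ (Metric.ball (0 : E n) 3).indicator (fun _ => (1 : ℝ)) x :=
        Set.indicator_nonneg (fun _ _ => zero_le_one) _
      have h7 : 0 ≤ M * ‖y‖ ^ 2 * ‖z‖ * (Metric.ball (0 : E n) 3).indicator (fun _ => (1 : ℝ)) x := by
        positivity
      have h8 : 0 ≤ 4 * K * (‖y‖ * min ‖y‖ ‖z‖) := by positivity
      nlinarith
  have h2 := integral_mono (h.integrable_mixedDiff y z).abs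
    ((hball.const_mul _).fun_add (hsumint.const_mul _)) hpt
  rw [integral_add (hball.const_mul _) (hsumint.const_mul _), integral_const_mul,
    integral_const_mul, integral_indicator measurableSet_ball, setIntegral_const, smul_eq_mul,
    mul_one, integral_finsetSum _ fun r _ => hbadint r] at h2
  have h3 : ∑ r ∈ R, ∫ x, bad r x ≤ R.card * (B * ρ) := by
    rw [← nsmul_eq_mul]
    exact Finset.sum_le_card_nsmul _ _ _ fun r hr =>
      integral_indicator_shell_le (hR r hr) hρ0 (by linarith)
  -- The product of minimum and maximum is `‖y‖‖z‖`, and the sum is at most twice the maximum.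
  have h4 : ‖y‖ * min ‖y‖ ‖z‖ * ρ ≤ 2 * (‖y‖ ^ 2 * ‖z‖) := by
    rw [hρ]
    rcases le_total ‖y‖ ‖z‖ with h5 | h5
    · rw [min_eq_left h5]
      nlinarith [norm_nonneg y, mul_nonneg (norm_nonneg y) (norm_nonneg y)]
    · rw [min_eq_right h5]
      nlinarith [norm_nonneg y, norm_nonneg z, mul_nonneg (norm_nonneg y) (norm_nonneg z)]
  have h5 : 4 * K * (‖y‖ * min ‖y‖ ‖z‖) * ∑ r ∈ R, ∫ x, bad r x ≤
      R.card * (4 * K * (2 * B)) * (‖y‖ ^ 2 * ‖z‖) := by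
    calc _ ≤ 4 * K * (‖y‖ * min ‖y‖ ‖z‖) * (R.card * (B * ρ)) := by gcongr
      _ = 4 * K * R.card * B * (‖y‖ * min ‖y‖ ‖z‖ * ρ) := by ring
      _ ≤ 4 * K * R.card * B * (2 * (‖y‖ ^ 2 * ‖z‖)) := by gcongr
      _ = _ := by ring
  have h6 : 0 ≤ (2 * C1 + 4 * (K * m)) * (‖y‖ ^ 2 * ‖z‖) := by positivity
  change _ ≤ M * ‖y‖ ^ 2 * ‖z‖ * m + _ at h2
  linarith

end IsC11Bump

end NonlocalABP
namespace NonlocalABP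

/-! ### Fourier transforms of integrable functions -/

open scoped RealInnerProductSpace

/-- The plane wave `x ↦ exp(i⟨x,ξ⟩)`. -/
noncomputable def wave {n : ℕ} (ξ x : E n) : ℂ := Complex.exp ((⟪x, ξ⟫ : ℝ) * Complex.I)

/-- The Fourier transform `∫ f(x) exp(i⟨x,ξ⟩) dx` of a real function. -/
noncomputable def waveTransform {n : ℕ} (f : E n → ℝ) (ξ : E n) : ℂ :=
  ∫ x, (f x : ℂ) * wave ξ x

section wave

variable {n : ℕ}

theorem norm_wave (ξ x : E n) : ‖wave ξ x‖ = 1 := Complex.norm_exp_ofReal_mul_I _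

theorem continuous_wave (ξ : E n) : Continuous (wave ξ) := by
  unfold wave
  fun_prop

theorem wave_add (ξ x y : E n) : wave ξ (x + y) = wave ξ x * wave ξ y := by
  rw [wave, wave, wave, ← Complex.exp_add, inner_add_left]
  push_cast
  ring_nf

theorem wave_zero (ξ : E n) : wave ξ 0 = 1 := by simp [wave]

theorem wave_add_wave_neg (ξ y : E n) :
    wave ξ y + wave ξ (-y) = ((2 * Real.cos ⟪ξ, y⟫ : ℝ) : ℂ) := by
  rw [wave, wave, inner_neg_left, real_inner_comm]
  push_cast
  rw [Complex.two_cos, neg_mul]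

theorem integrable_mul_wave {f : E n → ℝ} (hf : Integrable f) (ξ : E n) :
    Integrable fun x => (f x : ℂ) * wave ξ x :=
  hf.ofReal.mul_bdd (c := 1) (continuous_wave ξ).aestronglyMeasurable
    (ae_of_all _ fun x => (norm_wave ξ x).le)

theorem waveTransform_comp_add (f : E n → ℝ) (a ξ : E n) :
    waveTransform (fun x => f (x + a)) ξ = wave ξ (-a) * waveTransform f ξ := by
  rw [waveTransform, waveTransform, ← integral_const_mul,
    ← integral_add_right_eq_self (fun x => wave ξ (-a) * ((f x : ℂ) * wave ξ x)) a]
  refine integral_congr_ae (ae_of_all _ fun x => ?_)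
  have h : wave ξ x = wave ξ (-a) * wave ξ (x + a) := by
    rw [← wave_add]
    congr 1
    abel
  simp only
  rw [h]
  ring

theorem waveTransform_add {f g : E n → ℝ} (hf : Integrable f) (hg : Integrable g) (ξ : E n) :
    waveTransform (fun x => f x + g x) ξ = waveTransform f ξ + waveTransform g ξ := by
  simp only [waveTransform]
  rw [← integral_add (integrable_mul_wave hf ξ) (integrable_mul_wave hg ξ)]
  refine integral_congr_ae (ae_of_all _ fun x => ?_)
  simp only
  push_cast
  ring

theorem waveTransform_const_mul (c : ℝ) (f : E n → ℝ) (ξ : E n) :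
    waveTransform (fun x => c * f x) ξ = c * waveTransform f ξ := by
  simp only [waveTransform]
  rw [← integral_const_mul]
  refine integral_congr_ae (ae_of_all _ fun x => ?_)
  simp only
  push_cast
  ring

theorem waveTransform_finsetSum {ι : Type*} (S : Finset ι) {f : ι → E n → ℝ}
    (hf : ∀ i ∈ S, Integrable (f i)) (ξ : E n) :
    waveTransform (fun x => ∑ i ∈ S, f i x) ξ = ∑ i ∈ S, waveTransform (f i) ξ := by
  simp only [waveTransform]
  rw [← integral_finsetSum _ fun i hi => integrable_mul_wave (hf i hi) ξ]
  refine integral_congr_ae (ae_of_all _ fun x => ?_)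
  simp only
  push_cast
  rw [Finset.sum_mul]

/-- An integrable function with vanishing Fourier transform vanishes almost everywhere. -/
theorem ae_eq_zero_of_waveTransform {f : E n → ℝ} (hf : Integrable f)
    (h : ∀ ξ, waveTransform f ξ = 0) : f =ᵐ[volume] 0 := by
  -- Since `ENNReal.ofReal` truncates at `0`, the densities below are the positive and negative
  -- parts of `f`. They define finite measures, whose characteristic functions agree because `f⁺ = f
  -- + f⁻` and `f` has zero transform.
  have hpos : ∀ g : E n → ℝ, Integrable g → ∀ ξ,
      charFun (volume.withDensity fun x => ENNReal.ofReal (g x)) ξ =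
        waveTransform (fun x => max (g x) 0) ξ := by
    intro g hg ξ
    rw [charFun_apply, integral_withDensity_eq_integral_toReal_smul₀
      hg.aemeasurable.ennreal_ofReal (ae_of_all _ fun _ => ENNReal.ofReal_lt_top)]
    refine integral_congr_ae (ae_of_all _ fun x => ?_)
    simp only [ENNReal.toReal_ofReal', Complex.real_smul]
    rfl
  have hfin : ∀ g : E n → ℝ, Integrable g →
      IsFiniteMeasure (volume.withDensity fun x => ENNReal.ofReal (g x)) := fun g hg =>
    isFiniteMeasure_withDensity_ofReal hg.2
  have hneg : Integrable fun x => -f x := hf.neg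
  have := hfin f hf
  have := hfin (fun x => -f x) hneg
  have heq : (volume.withDensity fun x => ENNReal.ofReal (f x)) =
      volume.withDensity fun x => ENNReal.ofReal (-f x) := by
    refine Measure.ext_of_charFun (funext fun ξ => ?_)
    rw [hpos f hf, hpos (fun x => -f x) hneg]
    have h1 : waveTransform (fun x => max (f x) 0) ξ =
        waveTransform (fun x => f x + max (-f x) 0) ξ := by
      congr 1
      ext x
      rcases le_total (f x) 0 with h2 | h2
      · rw [max_eq_right h2, max_eq_left (by linarith)]
        ring
      · rw [max_eq_left h2, max_eq_right (by linarith)]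
        ring
    rw [h1, waveTransform_add hf hneg.pos_part, h, zero_add]
  have h2 := (withDensity_eq_iff_of_sigmaFinite hf.aemeasurable.ennreal_ofReal
    hneg.aemeasurable.ennreal_ofReal).1 heq
  filter_upwards [h2] with x hx
  simp only [Pi.zero_apply]
  rcases le_total (f x) 0 with h3 | h3
  · rw [ENNReal.ofReal_of_nonpos h3, eq_comm, ENNReal.ofReal_eq_zero] at hx
    linarith
  · rw [ENNReal.ofReal_of_nonpos (p := -f x) (by linarith),
      ENNReal.ofReal_eq_zero] at hx
    linarith

theorem ae_eq_of_waveTransform_eq {f g : E n → ℝ} (hf : Integrable f) (hg : Integrable g)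
    (h : ∀ ξ, waveTransform f ξ = waveTransform g ξ) : f =ᵐ[volume] g := by
  have h1 := ae_eq_zero_of_waveTransform (hf.add (hg.const_mul (-1))) fun ξ => by
    change waveTransform (fun x => f x + (-1) * g x) ξ = 0
    rw [waveTransform_add hf (hg.const_mul (-1)), waveTransform_const_mul, h]
    push_cast
    ring
  filter_upwards [h1] with x hx
  simp only [Pi.add_apply, Pi.zero_apply] at hx
  linarith

/-- The Fourier transform of a directional derivative. -/
theorem integrable_and_waveTransform_of_hasLineDerivAt {f g : E n → ℝ} {K : ℝ} {v : E n}
    (hlip : ∀ x y, |f x - f y| ≤ K * ‖x - y‖) (hf : Integrable f) (hsupp : ∀ x, 1 ≤ ‖x‖ → f x = 0)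
    (hg : ∀ᵐ x, HasLineDerivAt ℝ f (g x) x v) :
    Integrable g ∧ ∀ ξ, waveTransform g ξ = -(⟪v, ξ⟫ : ℝ) * Complex.I * waveTransform f ξ := by
  -- The derivative is approached by difference quotients with steps `1/(k+1)`. Lipschitz continuity
  -- and bounded support dominate them by `B`, so derivatives existing almost everywhere suffice and
  -- no integration by parts is used.
  set t : ℕ → ℝ := fun k => 1 / ((k : ℝ) + 1) with ht
  have ht0 : ∀ k, 0 < t k := fun k => by positivity
  have ht1 : ∀ k, t k ≤ 1 := fun k => by
    rw [ht]
    simp only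
    rw [div_le_one (by positivity)]
    linarith [Nat.cast_nonneg (α := ℝ) k]
  have htlim : Tendsto t atTop (𝓝[≠] 0) :=
    tendsto_nhdsWithin_iff.2 ⟨tendsto_one_div_add_atTop_nhds_zero_nat,
      Eventually.of_forall fun k => (ht0 k).ne'⟩
  set q : ℕ → E n → ℝ := fun k x => (t k)⁻¹ * (f (x + t k • v) - f x) with hq
  have hqint : ∀ k, Integrable (q k) := fun k => ((hf.comp_add_right _).sub hf).const_mul _
  have hqlim : ∀ᵐ x, Tendsto (fun k => q k x) atTop (𝓝 (g x)) := by
    filter_upwards [hg] with x hx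
    exact (HasLineDerivAt.tendsto_slope_zero hx).comp htlim
  set B : E n → ℝ := (Metric.closedBall (0 : E n) (1 + ‖v‖)).indicator fun _ => K * ‖v‖ with hB
  have hBint : Integrable B := by
    rw [hB, integrable_indicator_iff measurableSet_closedBall]
    exact integrableOn_const measure_closedBall_lt_top.ne
  have hqB : ∀ k x, ‖q k x‖ ≤ B x := by
    intro k x
    have h1 : |f (x + t k • v) - f x| ≤ K * (t k * ‖v‖) := by
      have := hlip (x + t k • v) x
      rwa [add_sub_cancel_left, norm_smul, Real.norm_of_nonneg (ht0 k).le] at this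
    by_cases hx : x ∈ Metric.closedBall (0 : E n) (1 + ‖v‖)
    · rw [hB, Set.indicator_of_mem hx, hq]
      simp only
      rw [norm_mul, norm_inv, Real.norm_of_nonneg (ht0 k).le, Real.norm_eq_abs,
        inv_mul_le_iff₀ (ht0 k)]
      linarith
    · rw [hB, Set.indicator_of_notMem hx]
      rw [mem_closedBall_zero_iff, not_le] at hx
      have h2 : ‖x‖ - ‖t k • v‖ ≤ ‖x + t k • v‖ := by
        have := norm_sub_norm_le x (-(t k • v))
        rwa [norm_neg, sub_neg_eq_add] at this
      rw [norm_smul, Real.norm_of_nonneg (ht0 k).le] at h2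
      have h3 : t k * ‖v‖ ≤ ‖v‖ := by nlinarith [ht1 k, norm_nonneg v]
      rw [hq]
      simp only
      rw [hsupp x (by linarith [norm_nonneg v]), hsupp _ (by linarith)]
      simp
  have hgm : AEStronglyMeasurable g :=
    aestronglyMeasurable_of_tendsto_ae atTop (fun k => (hqint k).aestronglyMeasurable) hqlim
  have hgint : Integrable g := by
    refine hBint.mono' hgm ?_
    filter_upwards [hqlim] with x hx
    exact le_of_tendsto hx.norm (Eventually.of_forall fun k => hqB k x)
  refine ⟨hgint, fun ξ => ?_⟩
  have hlim1 : Tendsto (fun k => waveTransform (q k) ξ) atTop (𝓝 (waveTransform g ξ)) := by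
    refine tendsto_integral_of_dominated_convergence B
      (fun k => (integrable_mul_wave (hqint k) ξ).aestronglyMeasurable) hBint (fun k => ?_) ?_
    · refine ae_of_all _ fun x => ?_
      rw [norm_mul, norm_wave, mul_one, Complex.norm_real]
      exact hqB k x
    · filter_upwards [hqlim] with x hx
      exact ((Complex.continuous_ofReal.tendsto _).comp hx).mul_const _
  have hqt : ∀ k, waveTransform (q k) ξ =
      ((t k : ℂ)⁻¹ * (wave ξ (-(t k • v)) - 1)) * waveTransform f ξ := by
    intro k
    have h1 : q k = fun x => (t k)⁻¹ * (f (x + t k • v) + (-1) * f x) := by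
      ext x
      simp only [hq]
      ring
    rw [h1, waveTransform_const_mul, waveTransform_add (hf.comp_add_right _) (hf.const_mul _),
      waveTransform_const_mul]
    rw [waveTransform_comp_add]
    push_cast
    ring
  have hder : HasDerivAt (fun r : ℝ => wave ξ (-(r • v))) (-(⟪v, ξ⟫ : ℝ) * Complex.I) 0 := by
    have h1 : (fun r : ℝ => wave ξ (-(r • v))) =
        fun r : ℝ => Complex.exp ((r : ℂ) * (-(⟪v, ξ⟫ : ℝ) * Complex.I)) := by
      ext r
      rw [wave, inner_neg_left, inner_smul_left]
      congr 1
      simp only [conj_trivial]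
      push_cast
      ring
    rw [h1]
    have h2 : HasDerivAt (fun r : ℝ => (r : ℂ) * (-(⟪v, ξ⟫ : ℝ) * Complex.I))
        (-(⟪v, ξ⟫ : ℝ) * Complex.I) 0 := by
      refine ((hasDerivAt_id (0 : ℝ)).ofReal_comp.mul_const _).congr_deriv ?_
      simp
    refine h2.cexp.congr_deriv ?_
    simp
  have hlim2 : Tendsto (fun k => waveTransform (q k) ξ) atTop
      (𝓝 (-(⟪v, ξ⟫ : ℝ) * Complex.I * waveTransform f ξ)) := by
    simp only [hqt]
    refine Tendsto.mul_const _ ?_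
    have h1 := hder.tendsto_slope_zero.comp htlim
    refine h1.congr fun k => ?_
    simp [wave_zero, Complex.real_smul]
  exact tendsto_nhds_unique hlim1 hlim2

end wave

end NonlocalABP
namespace NonlocalABP

/-! ### The fractional Hessian of the fractional Laplacian of complementary order -/

open scoped RealInnerProductSpace

theorem norm_one_sub_wave_le {n : ℕ} (ξ z : E n) :
    ‖1 - wave ξ z‖ ≤ (2 + ‖ξ‖) * min 1 (‖z‖ ^ (1 : ℝ)) := by
  rw [Real.rpow_one, mul_min_of_nonneg _ _ (by positivity), mul_one, norm_sub_rev]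
  refine le_min ?_ ?_
  · refine (norm_sub_le _ _).trans ?_
    rw [norm_wave, norm_one]
    linarith [norm_nonneg ξ]
  · have h1 : ‖wave ξ z - 1‖ ≤ ‖(⟪z, ξ⟫ : ℝ)‖ := by
      rw [wave, mul_comm]
      exact Real.norm_exp_I_mul_ofReal_sub_one_le
    have h2 : ‖(⟪z, ξ⟫ : ℝ)‖ ≤ ‖z‖ * ‖ξ‖ := norm_inner_le_norm z ξ
    nlinarith [norm_nonneg z, norm_nonneg ξ]

/-- Averaging with the reflection `z ↦ -z` removes the imaginary part. The condition `s < 1` makes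
the integral of `1 - wave` absolutely convergent before any symmetrization. -/
theorem integral_one_sub_wave {n : ℕ} [NeZero n] {s : ℝ} (hs : 0 < s) (hs1 : s < 1) (ξ : E n) :
    ∫ z : E n, (1 - wave ξ (-z)) / ((‖z‖ ^ ((n : ℝ) + s) : ℝ) : ℂ) =
      ((∫ z : E n, (1 - Real.cos ⟪ξ, z⟫) / ‖z‖ ^ ((n : ℝ) + s) : ℝ) : ℂ) := by
  have hint : Integrable fun z : E n => (1 - wave ξ z) / ((‖z‖ ^ ((n : ℝ) + s) : ℝ) : ℂ) := by
    refine ((integrable_min_one_rpow_div (n := n) hs hs1).const_mul (2 + ‖ξ‖)).mono' ?_ ?_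
    · exact (continuous_const.sub (continuous_wave ξ)).aestronglyMeasurable.div₀
        (Complex.measurable_ofReal.comp (measurable_norm.pow_const _)).aestronglyMeasurable
    · refine ae_of_all _ fun z => ?_
      rw [norm_div, Complex.norm_real, Real.norm_of_nonneg (by positivity), ← mul_div_assoc]
      gcongr
      exact norm_one_sub_wave_le ξ z
  have hneg : ∫ z : E n, (1 - wave ξ (-z)) / ((‖z‖ ^ ((n : ℝ) + s) : ℝ) : ℂ) =
      ∫ z : E n, (1 - wave ξ z) / ((‖z‖ ^ ((n : ℝ) + s) : ℝ) : ℂ) := by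
    rw [← integral_neg_eq_self]
    simp
  have hintneg : Integrable fun z : E n =>
      (1 - wave ξ (-z)) / ((‖z‖ ^ ((n : ℝ) + s) : ℝ) : ℂ) := by
    simpa using hint.comp_neg
  have hsum := integral_add hint hintneg
  rw [hneg] at hsum ⊢
  have h2 : ∀ z : E n, (1 - wave ξ z) / ((‖z‖ ^ ((n : ℝ) + s) : ℝ) : ℂ) +
      (1 - wave ξ (-z)) / ((‖z‖ ^ ((n : ℝ) + s) : ℝ) : ℂ) =
      ((2 * ((1 - Real.cos ⟪ξ, z⟫) / ‖z‖ ^ ((n : ℝ) + s)) : ℝ) : ℂ) := by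
    intro z
    rw [← add_div, show 1 - wave ξ z + (1 - wave ξ (-z)) = 2 - (wave ξ z + wave ξ (-z)) by ring,
      wave_add_wave_neg]
    push_cast
    ring
  simp only [h2] at hsum
  rw [integral_complex_ofReal, integral_const_mul] at hsum
  push_cast at hsum
  rw [← two_mul] at hsum
  exact (mul_left_cancel₀ two_ne_zero hsum).symm

/-- The integrand of `D^σ (-Δ)^{s/2} P`. -/
noncomputable def mixedIntegrand {n : ℕ} (s σ : ℝ) (P : E n → ℝ) (i j : Fin n)
    (p : E n × E n × E n) : ℝ :=
  mixedDiff P p.1 p.2.1 p.2.2 * (p.2.1 i * p.2.1 j) /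
    (‖p.2.1‖ ^ ((n : ℝ) + 2 + σ) * ‖p.2.2‖ ^ ((n : ℝ) + s))

theorem abs_coord_mul_coord_le {n : ℕ} (y : E n) (i j : Fin n) : |y i * y j| ≤ ‖y‖ ^ 2 := by
  rw [abs_mul, sq]
  exact mul_le_mul (PiLp.norm_apply_le y i) (PiLp.norm_apply_le y j) (abs_nonneg _) (norm_nonneg _)

namespace IsC11Bump

variable {n : ℕ} {K : ℝ} {P : E n → ℝ}

theorem continuous_mixedDiff (h : IsC11Bump K P) :
    Continuous fun p : E n × E n × E n => mixedDiff P p.1 p.2.1 p.2.2 := by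
  have := h.continuous
  unfold mixedDiff secondDiff
  fun_prop

/-- Integrating in `x` first and using `hC` leaves a product of two kernels, integrable because `σ <
2` and `s < 1`. Fubini then gives absolute convergence in `(y,z)` for almost every `x`, which is all
that can be expected of a `C^{1,1}` potential. -/
theorem integrable_mixedDiff_div [NeZero n] (h : IsC11Bump K P) {s σ C : ℝ} (hs : 0 < s)
    (hs1 : s < 1) (hσ : 0 < σ) (hσ2 : σ < 2)
    (hC : ∀ y z, ∫ x, |mixedDiff P x y z| ≤
      C * (min 1 (‖y‖ ^ (2 : ℝ)) * min 1 (‖z‖ ^ (1 : ℝ)))) :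
    Integrable fun p : E n × E n × E n =>
      mixedDiff P p.1 p.2.1 p.2.2 / (‖p.2.1‖ ^ ((n : ℝ) + σ) * ‖p.2.2‖ ^ ((n : ℝ) + s)) := by
  have hm : AEStronglyMeasurable (fun p : E n × E n × E n =>
      mixedDiff P p.1 p.2.1 p.2.2 / (‖p.2.1‖ ^ ((n : ℝ) + σ) * ‖p.2.2‖ ^ ((n : ℝ) + s)))
      (volume.prod (volume : Measure (E n × E n))) := by
    refine (h.continuous_mixedDiff.measurable.div (Measurable.mul ?_ ?_)).aestronglyMeasurable
    · exact (measurable_norm.comp (measurable_fst.comp measurable_snd)).pow_const _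
    · exact (measurable_norm.comp (measurable_snd.comp measurable_snd)).pow_const _
  refine (integrable_prod_iff' hm).2 ⟨ae_of_all _ fun p => (h.integrable_mixedDiff p.1 p.2).div_const
    (‖p.1‖ ^ ((n : ℝ) + σ) * ‖p.2‖ ^ ((n : ℝ) + s)), ?_⟩
  have hprod := ((integrable_min_one_rpow_div (n := n) hσ hσ2).mul_prod
    (integrable_min_one_rpow_div (n := n) hs hs1)).const_mul C
  refine hprod.mono' hm.norm.prod_swap.integral_prod_right' (ae_of_all _ fun p => ?_)
  simp only [norm_div]
  rw [integral_div, norm_div, Real.norm_of_nonneg (integral_nonneg fun _ => norm_nonneg _),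
    norm_norm, Real.norm_of_nonneg (by positivity), div_mul_div_comm, ← mul_div_assoc]
  gcongr
  exact hC p.1 p.2

theorem secondDiff_fracLap [NeZero n] (h : IsC11Bump K P) {s : ℝ} (hs : 0 < s) (hs1 : s < 1)
    (x y : E n) :
    secondDiff (fracLap s P) x y =
      normConst n s * ∫ z, mixedDiff P x y z / ‖z‖ ^ ((n : ℝ) + s) := by
  have hi := h.integrable_fracLapIntegrand hs hs1
  have h1 : ∫ z, mixedDiff P x y z / ‖z‖ ^ ((n : ℝ) + s) =
      (∫ z, fracLapIntegrand s P (x + y) z) + (∫ z, fracLapIntegrand s P (x - y) z) -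
        2 * ∫ z, fracLapIntegrand s P x z := by
    rw [← integral_add (hi _) (hi _), ← integral_const_mul,
      ← integral_sub ((hi _).fun_add (hi _)) ((hi _).const_mul _)]
    refine integral_congr_ae (ae_of_all _ fun z => ?_)
    simp only [mixedDiff, secondDiff, fracLapIntegrand]
    rw [add_right_comm x z y, add_sub_right_comm x z y]
    ring
  rw [h1, secondDiff, fracLap, fracLap, fracLap]
  ring

theorem ae_integrable_secondDiff_fracLap [NeZero n] (h : IsC11Bump K P) {s σ C : ℝ} (hs : 0 < s)
    (hs1 : s < 1) (hσ : 0 < σ) (hσ2 : σ < 2)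
    (hC : ∀ y z, ∫ x, |mixedDiff P x y z| ≤
      C * (min 1 (‖y‖ ^ (2 : ℝ)) * min 1 (‖z‖ ^ (1 : ℝ)))) :
    ∀ᵐ x : E n, Integrable fun y => secondDiff (fracLap s P) x y / ‖y‖ ^ ((n : ℝ) + σ) := by
  filter_upwards [(h.integrable_mixedDiff_div hs hs1 hσ hσ2 hC).prod_right_ae] with x hx
  have h1 := (hx.integral_prod_left).const_mul (normConst n s)
  refine h1.congr (ae_of_all _ fun y => ?_)
  simp only [h.secondDiff_fracLap hs hs1]
  rw [← integral_const_mul, ← integral_const_mul, ← integral_div]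
  refine integral_congr_ae (ae_of_all _ fun z => ?_)
  simp only
  rw [mul_comm (‖y‖ ^ _), ← div_div, mul_div_assoc]

theorem integrable_mixedIntegrand [NeZero n] (h : IsC11Bump K P) {s σ C : ℝ} (hs : 0 < s)
    (hs1 : s < 1) (hσ : 0 < σ) (hσ2 : σ < 2)
    (hC : ∀ y z, ∫ x, |mixedDiff P x y z| ≤
      C * (min 1 (‖y‖ ^ (2 : ℝ)) * min 1 (‖z‖ ^ (1 : ℝ)))) (i j : Fin n) :
    Integrable (mixedIntegrand s σ P i j) := by
  refine (h.integrable_mixedDiff_div hs hs1 hσ hσ2 hC).mono ?_ (ae_of_all _ fun p => ?_)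
  · refine Measurable.aestronglyMeasurable ?_
    have h1 : Measurable fun p : E n × E n × E n => p.2.1 i * p.2.1 j :=
      Continuous.measurable (by fun_prop)
    refine (h.continuous_mixedDiff.measurable.mul h1).div (Measurable.mul ?_ ?_)
    · exact (measurable_norm.comp (measurable_fst.comp measurable_snd)).pow_const _
    · exact (measurable_norm.comp (measurable_snd.comp measurable_snd)).pow_const _
  · obtain ⟨x, y, z⟩ := p
    rcases eq_or_ne y 0 with rfl | hy
    · have h0 : mixedIntegrand s σ P i j (x, 0, z) = 0 := by simp [mixedIntegrand]
      rw [h0, norm_zero]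
      exact norm_nonneg _
    have hyp : 0 < ‖y‖ := norm_pos_iff.2 hy
    have h2 : ‖y‖ ^ ((n : ℝ) + 2 + σ) = ‖y‖ ^ 2 * ‖y‖ ^ ((n : ℝ) + σ) := by
      rw [← Real.rpow_natCast, ← Real.rpow_add hyp]
      congr 1
      push_cast
      ring
    have h3 := abs_coord_mul_coord_le y i j
    simp only [mixedIntegrand]
    rw [h2, show mixedDiff P x y z * (y i * y j) /
        (‖y‖ ^ 2 * ‖y‖ ^ ((n : ℝ) + σ) * ‖z‖ ^ ((n : ℝ) + s)) =
        mixedDiff P x y z / (‖y‖ ^ ((n : ℝ) + σ) * ‖z‖ ^ ((n : ℝ) + s)) *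
          ((y i * y j) / ‖y‖ ^ 2) by rw [div_mul_div_comm]; congr 1; ring, norm_mul]
    refine mul_le_of_le_one_right (norm_nonneg _) ?_
    rw [norm_div, Real.norm_of_nonneg (r := ‖y‖ ^ 2) (by positivity), Real.norm_eq_abs]
    exact div_le_one_of_le₀ h3 (by positivity)

theorem ae_fracHessian_fracLap_eq_integral [NeZero n] (h : IsC11Bump K P) {s σ C : ℝ} (hs : 0 < s)
    (hs1 : s < 1) (hσ : 0 < σ) (hσ2 : σ < 2)
    (hC : ∀ y z, ∫ x, |mixedDiff P x y z| ≤
      C * (min 1 (‖y‖ ^ (2 : ℝ)) * min 1 (‖z‖ ^ (1 : ℝ)))) (i j : Fin n) :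
    ∀ᵐ x : E n, fracHessian σ (fracLap s P) x i j =
      normConst n σ / 2 * normConst n s * ∫ p, mixedIntegrand s σ P i j (x, p) := by
  filter_upwards [(h.integrable_mixedIntegrand hs hs1 hσ hσ2 hC i j).prod_right_ae] with x hx
  rw [fracHessian, Matrix.of_apply, mul_assoc]
  congr 1
  have hvol : (volume : Measure (E n × E n)) = volume.prod volume := rfl
  rw [hvol, integral_prod _ hx, ← integral_const_mul]
  refine integral_congr_ae (ae_of_all _ fun y => ?_)
  simp only [h.secondDiff_fracLap hs hs1, mixedIntegrand]
  rw [mul_assoc, mul_div_assoc, mul_div_assoc, ← integral_mul_const]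
  congr 1
  refine integral_congr_ae (ae_of_all _ fun z => ?_)
  simp only
  rw [div_mul_div_comm, mul_comm (‖z‖ ^ _)]

theorem waveTransform_mixedDiff (h : IsC11Bump K P) (y z ξ : E n) :
    waveTransform (fun x => mixedDiff P x y z) ξ =
      waveTransform P ξ * (((2 * Real.cos ⟪ξ, y⟫ - 2 : ℝ) : ℂ) * (1 - wave ξ (-z))) := by
  have hP := h.integrable
  have hsd : ∀ ξ, waveTransform (fun x => secondDiff P x y) ξ =
      waveTransform P ξ * ((2 * Real.cos ⟪ξ, y⟫ - 2 : ℝ) : ℂ) := by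
    intro ξ
    have h1 : (fun x => secondDiff P x y) = fun x => (P (x + y) + P (x + -y)) + (-2) * P x := by
      ext x
      simp only [secondDiff]
      rw [← sub_eq_add_neg x y]
      ring
    rw [h1, waveTransform_add ((hP.comp_add_right y).fun_add (hP.comp_add_right (-y)))
      (hP.const_mul _), waveTransform_add (hP.comp_add_right y) (hP.comp_add_right (-y)),
      waveTransform_const_mul]
    rw [waveTransform_comp_add, waveTransform_comp_add, neg_neg]
    have h4 := wave_add_wave_neg ξ y
    push_cast at h4 ⊢
    linear_combination waveTransform P ξ * h4
  have h1 : (fun x => mixedDiff P x y z) =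
      fun x => secondDiff P x y + (-1) * secondDiff P (x + z) y := by
    ext x
    simp only [mixedDiff]
    ring
  have hi := h.integrable_secondDiff y
  rw [h1, waveTransform_add hi ((hi.comp_add_right z).const_mul _), waveTransform_const_mul, hsd]
  rw [waveTransform_comp_add (fun x => secondDiff P x y), hsd]
  push_cast
  ring

/-- After Fubini the `x`-integral is computed first: translations act as multipliers, and the
remaining integrand is a function of `y` times a function of `z`, namely the two symbols. -/
theorem waveTransform_integral_mixedIntegrand [NeZero n] (h : IsC11Bump K P) {s σ C : ℝ}
    (hs : 0 < s) (hs1 : s < 1) (hσ : 0 < σ) (hσ2 : σ < 2)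
    (hC : ∀ y z, ∫ x, |mixedDiff P x y z| ≤
      C * (min 1 (‖y‖ ^ (2 : ℝ)) * min 1 (‖z‖ ^ (1 : ℝ)))) (i j : Fin n) (ξ : E n) :
    waveTransform (fun x => ∫ p, mixedIntegrand s σ P i j (x, p)) ξ =
      waveTransform P ξ *
        (((-2 * ∫ y : E n, (1 - Real.cos ⟪ξ, y⟫) * (y i * y j) / ‖y‖ ^ ((n : ℝ) + 2 + σ) : ℝ) : ℂ) *
        ((∫ z : E n, (1 - Real.cos ⟪ξ, z⟫) / ‖z‖ ^ ((n : ℝ) + s) : ℝ) : ℂ)) := by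
  have hint := h.integrable_mixedIntegrand hs hs1 hσ hσ2 hC i j
  have hintc : Integrable (Function.uncurry fun (x : E n) (p : E n × E n) =>
      (mixedIntegrand s σ P i j (x, p) : ℂ) * wave ξ x) (volume.prod volume) := by
    refine Integrable.mul_bdd (c := 1) hint.ofReal
      ((continuous_wave ξ).comp continuous_fst).aestronglyMeasurable
      (ae_of_all _ fun p => (norm_wave ξ p.1).le)
  have h1 : waveTransform (fun x => ∫ p, mixedIntegrand s σ P i j (x, p)) ξ =
      ∫ x, ∫ p, (mixedIntegrand s σ P i j (x, p) : ℂ) * wave ξ x := by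
    rw [waveTransform]
    refine integral_congr_ae (ae_of_all _ fun x => ?_)
    simp only
    rw [← integral_complex_ofReal, ← integral_mul_const]
  rw [h1, integral_integral_swap hintc]
  have h2 : ∀ p : E n × E n, ∫ x, (mixedIntegrand s σ P i j (x, p) : ℂ) * wave ξ x =
      waveTransform P ξ * ((((2 * Real.cos ⟪ξ, p.1⟫ - 2) * (p.1 i * p.1 j) /
        ‖p.1‖ ^ ((n : ℝ) + 2 + σ) : ℝ) : ℂ) *
        ((1 - wave ξ (-p.2)) / ((‖p.2‖ ^ ((n : ℝ) + s) : ℝ) : ℂ))) := by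
    intro p
    have h3 := h.waveTransform_mixedDiff p.1 p.2 ξ
    have h4 := waveTransform_const_mul ((p.1 i * p.1 j) /
      (‖p.1‖ ^ ((n : ℝ) + 2 + σ) * ‖p.2‖ ^ ((n : ℝ) + s))) (fun x => mixedDiff P x p.1 p.2) ξ
    rw [h3, waveTransform] at h4
    have h5 : ∫ x, (mixedIntegrand s σ P i j (x, p) : ℂ) * wave ξ x =
        ∫ x, (((p.1 i * p.1 j) / (‖p.1‖ ^ ((n : ℝ) + 2 + σ) * ‖p.2‖ ^ ((n : ℝ) + s)) *
          mixedDiff P x p.1 p.2 : ℝ) : ℂ) * wave ξ x := by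
      refine integral_congr_ae (ae_of_all _ fun x => ?_)
      simp only [mixedIntegrand]
      congr 2
      ring
    rw [h5, h4]
    push_cast
    ring
  simp only [h2]
  rw [integral_const_mul]
  have hvol : (volume : Measure (E n × E n)) = volume.prod volume := rfl
  rw [hvol, integral_prod_mul (L := ℂ) (fun y : E n => ((((2 * Real.cos ⟪ξ, y⟫ - 2) * (y i * y j) /
        ‖y‖ ^ ((n : ℝ) + 2 + σ) : ℝ) : ℂ)))
    (fun z : E n => (1 - wave ξ (-z)) / ((‖z‖ ^ ((n : ℝ) + s) : ℝ) : ℂ)),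
    integral_one_sub_wave hs hs1, integral_complex_ofReal, ← integral_const_mul]
  have h6 : ∀ y : E n, (2 * Real.cos ⟪ξ, y⟫ - 2) * (y i * y j) / ‖y‖ ^ ((n : ℝ) + 2 + σ) =
      -2 * ((1 - Real.cos ⟪ξ, y⟫) * (y i * y j) / ‖y‖ ^ ((n : ℝ) + 2 + σ)) := fun y => by ring
  simp only [h6]

/-- The matrix `H` is a second derivative only almost everywhere. Since the gradient is Lipschitz,
nothing singular sits on the exceptional set, and two applications of the derivative rule give the
multiplier `-ξ_iξ_j`. -/
theorem waveTransform_hessian (h : IsC11Bump K P) {H : E n → Matrix (Fin n) (Fin n) ℝ}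
    (hH : ∀ i j, ∀ᵐ x, HasLineDerivAt ℝ (fun x => fderiv ℝ P x (EuclideanSpace.single j 1))
      (H x i j) x (EuclideanSpace.single i 1)) (i j : Fin n) :
    Integrable (fun x => H x i j) ∧
      ∀ ξ, waveTransform (fun x => H x i j) ξ = -(ξ i * ξ j : ℝ) * waveTransform P ξ := by
  set e : Fin n → E n := fun i => EuclideanSpace.single i (1 : ℝ) with he
  have he1 : ∀ i, ‖e i‖ = 1 := fun i => by simp [he]
  have hei : ∀ i (y : E n), ⟪e i, y⟫ = y i := fun i y => by
    simp [he, EuclideanSpace.inner_single_left]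
  have h1 := integrable_and_waveTransform_of_hasLineDerivAt (f := P)
    (g := fun x => fderiv ℝ P x (e j)) (v := e j) h.abs_sub_le h.integrable h.eq_zero
    (ae_of_all _ fun x => (h.differentiable x).hasFDerivAt.hasLineDerivAt (e j))
  have hfd0 : ∀ x, 1 ≤ ‖x‖ → fderiv ℝ P x = 0 := by
    have hopen : ∀ x, 1 < ‖x‖ → fderiv ℝ P x = 0 := by
      intro x hx
      have h2 : P =ᶠ[𝓝 x] fun _ => 0 := by
        filter_upwards [(isOpen_lt continuous_const continuous_norm).mem_nhds hx] with w hw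
        exact h.eq_zero w (le_of_lt hw)
      rw [h2.fderiv_eq]
      simp
    intro x hx
    have hx0 : x ≠ 0 := by
      rintro rfl
      simp at hx
      linarith
    -- On the unit sphere itself the gradient vanishes by continuity, as a limit along the outward
    -- ray.
    have h3 : Tendsto (fun t : ℝ => fderiv ℝ P (t • x)) (𝓝[>] 1) (𝓝 (fderiv ℝ P ((1 : ℝ) • x))) :=
      ((h.continuous_fderiv.comp (continuous_id.smul continuous_const)).tendsto 1).mono_left
        nhdsWithin_le_nhds
    rw [one_smul] at h3
    refine tendsto_nhds_unique h3 (tendsto_const_nhds.congr' ?_)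
    filter_upwards [self_mem_nhdsWithin] with t ht
    have ht1 : (1 : ℝ) < t := ht
    rw [hopen]
    rw [norm_smul, Real.norm_of_nonneg (by linarith)]
    nlinarith
  have hlip : ∀ x y, |fderiv ℝ P x (e j) - fderiv ℝ P y (e j)| ≤ K * ‖x - y‖ := by
    intro x y
    rw [← sub_apply]
    refine ((fderiv ℝ P x - fderiv ℝ P y).le_opNorm (e j)).trans ?_
    rw [he1, mul_one]
    exact h.norm_fderiv_sub_le x y
  have h2 := integrable_and_waveTransform_of_hasLineDerivAt (f := fun x => fderiv ℝ P x (e j))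
    (g := fun x => H x i j) (v := e i) hlip h1.1
    (fun x hx => by rw [hfd0 x hx]; simp) (hH i j)
  refine ⟨h2.1, fun ξ => ?_⟩
  rw [h2.2, h1.2, hei, hei]
  push_cast
  linear_combination (ξ i * ξ j : ℂ) * waveTransform P ξ * Complex.I_sq

end IsC11Bump

/-- `D^σ (-Δ)^{(2-σ)/2} P` is a multiple of `ΔP Id + σ D²P`. -/
theorem exists_fracHessian_fracLap_eq {n : ℕ} [NeZero n] {σ : ℝ} (hσ1 : 1 < σ) (hσ2 : σ < 2) :
    ∃ κ : ℝ, 0 < κ ∧ ∀ (P : E n → ℝ) (K C : ℝ) (H : E n → Matrix (Fin n) (Fin n) ℝ),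
      IsC11Bump K P →
      (∀ y z, ∫ x, |mixedDiff P x y z| ≤
        C * (min 1 (‖y‖ ^ (2 : ℝ)) * min 1 (‖z‖ ^ (1 : ℝ)))) →
      (∀ i j, ∀ᵐ x, HasLineDerivAt ℝ (fun x => fderiv ℝ P x (EuclideanSpace.single j 1))
        (H x i j) x (EuclideanSpace.single i 1)) →
      ∀ᵐ x, fracHessian σ (fracLap (2 - σ) P) x =
        κ • ((H x).trace • (1 : Matrix (Fin n) (Fin n) ℝ) + σ • H x) := by
  have hs : 0 < 2 - σ := by linarith
  have hs1 : 2 - σ < 1 := by linarith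
  have hσ : 0 < σ := by linarith
  obtain ⟨a, ha, hA⟩ := exists_integral_one_sub_cos_eq (n := n) hs (by linarith)
  obtain ⟨b, hb, hB⟩ := exists_integral_one_sub_cos_eq (n := n) hσ hσ2
  have hc1 := normConst_pos (n := n) hσ hσ2
  have hc2 := normConst_pos (n := n) hs (by linarith)
  have hns : (0 : ℝ) < n + σ := by positivity
  -- The factor `b / (n + σ)` comes from the symbol of the Hessian, `a` from that of the Laplacian,
  -- and `2` from the second difference, whose multiplier is `-2(1 - cos)`.
  set κ : ℝ := normConst n σ / 2 * normConst n (2 - σ) * (2 * (b / (n + σ)) * a) with hκ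
  refine ⟨κ, by positivity, fun P K C H h hC hH => ?_⟩
  have hHt := h.waveTransform_hessian hH
  have hij : ∀ i j, ∀ᵐ x, fracHessian σ (fracLap (2 - σ) P) x i j =
      κ * ((if i = j then 1 else 0) * (∑ k, H x k k) + σ * H x i j) := by
    intro i j
    have hint := h.integrable_mixedIntegrand hs hs1 hσ hσ2 hC i j
    have hsum : Integrable fun x => ∑ k, H x k k := integrable_finsetSum _ fun k _ => (hHt k k).1
    have heq := ae_eq_of_waveTransform_eq
      (f := fun x => normConst n σ / 2 * normConst n (2 - σ) *
        ∫ p, mixedIntegrand (2 - σ) σ P i j (x, p))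
      (g := fun x => κ * ((if i = j then 1 else 0) * (∑ k, H x k k) + σ * H x i j))
      (Integrable.const_mul (Integrable.integral_prod_left (μ := volume) (ν := volume) hint) _)
      (((hsum.const_mul _).add ((hHt i j).1.const_mul _)).const_mul _) fun ξ => by
        rw [waveTransform_const_mul, h.waveTransform_integral_mixedIntegrand hs hs1 hσ hσ2 hC,
          waveTransform_const_mul, waveTransform_add (hsum.const_mul _) ((hHt i j).1.const_mul _),
          waveTransform_const_mul, waveTransform_const_mul,
          waveTransform_finsetSum _ fun k _ => (hHt k k).1, (hHt i j).2]
        simp only [(hHt _ _).2]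
        rw [← Finset.sum_mul, Finset.sum_neg_distrib, ← Complex.ofReal_sum]
        have hnorm : ∑ k, ξ k * ξ k = ‖ξ‖ ^ 2 := by
          rw [EuclideanSpace.real_norm_sq_eq]
          simp [sq]
        rw [hnorm]
        have hmain : normConst n σ / 2 * normConst n (2 - σ) *
            ((-2 * ∫ y : E n, (1 - Real.cos ⟪ξ, y⟫) * (y i * y j) / ‖y‖ ^ ((n : ℝ) + 2 + σ)) *
              ∫ z : E n, (1 - Real.cos ⟪ξ, z⟫) / ‖z‖ ^ ((n : ℝ) + (2 - σ))) =
            κ * ((if i = j then 1 else 0) * (-‖ξ‖ ^ 2) + σ * (-(ξ i * ξ j))) := by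
          rcases eq_or_ne ξ 0 with rfl | hξ
          · simp
          have hr : 0 < ‖ξ‖ := norm_pos_iff.2 hξ
          rw [hA, integral_one_sub_cos_mul_coord hσ hσ2 hB hξ, hκ]
          -- The orders are complementary, so the fractional powers cancel and a quadratic
          -- polynomial in `ξ` is left. This is where nonlocality disappears.
          have e1 : ‖ξ‖ ^ σ * ‖ξ‖ ^ (2 - σ) = ‖ξ‖ ^ 2 := by
            rw [← Real.rpow_add hr, ← Real.rpow_natCast]
            congr 1
            push_cast
            ring
          have e2 : ‖ξ‖ ^ (σ - 2) * ‖ξ‖ ^ (2 - σ) = 1 := by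
            rw [← Real.rpow_add hr]
            simp
          split_ifs
          · linear_combination (-(normConst n σ / 2 * normConst n (2 - σ) *
              (2 * (b / (n + σ)) * a))) * e1 - (normConst n σ / 2 * normConst n (2 - σ) *
              (2 * (b / (n + σ)) * a)) * σ * (ξ i * ξ j) * e2
          · linear_combination - (normConst n σ / 2 * normConst n (2 - σ) *
              (2 * (b / (n + σ)) * a)) * σ * (ξ i * ξ j) * e2
        have hmainc := congrArg (fun r : ℝ => (r : ℂ) * waveTransform P ξ) hmain
        simp only at hmainc
        push_cast at hmainc ⊢
        linear_combination hmainc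
    filter_upwards [heq, h.ae_fracHessian_fracLap_eq_integral hs hs1 hσ hσ2 hC i j] with x h1 h2
    rw [h2, h1]
  have hall : ∀ᵐ x, ∀ i j, fracHessian σ (fracLap (2 - σ) P) x i j =
      κ * ((if i = j then 1 else 0) * (∑ k, H x k k) + σ * H x i j) :=
    ae_all_iff.2 fun i => ae_all_iff.2 fun j => hij i j
  filter_upwards [hall] with x hx
  ext i j
  rw [hx]
  simp only [Matrix.smul_apply, Matrix.add_apply, Matrix.one_apply, smul_eq_mul, Matrix.trace,
    Matrix.diag_apply]
  ring

end NonlocalABP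
namespace NonlocalABP

/-! ### Local bounds from smoothness on compact sets -/

open scoped RealInnerProductSpace

theorem exists_norm_fderiv_le_of_isCompact {V W : Type*} [NormedAddCommGroup V] [NormedSpace ℝ V]
    [NormedAddCommGroup W] [NormedSpace ℝ W] {f : V → W} {C : Set V} (hC : IsCompact C)
    (hf : ∀ x ∈ C, ContDiffAt ℝ 1 f x) : ∃ M, 0 ≤ M ∧ ∀ x ∈ C, ‖fderiv ℝ f x‖ ≤ M := by
  have hcont : ContinuousOn (fderiv ℝ f) C := fun x hx =>
    ((hf x hx).fderiv_right (m := 0) (by norm_num)).continuousAt.continuousWithinAt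
  obtain ⟨M, hM⟩ := hC.exists_bound_of_continuousOn hcont
  exact ⟨max M 0, le_max_right _ _, fun x hx => (hM x hx).trans (le_max_left _ _)⟩

/-- The mean value theorem in the direction `z` reduces the claim to a second difference of `w ↦
Df(w)z`, whose gradient is Lipschitz with constant `M‖z‖`, where `M` bounds the third derivative on
the compact set. -/
theorem exists_abs_mixedDiff_le_of_contDiffAt {n : ℕ} {f : E n → ℝ} {C : Set (E n)}
    (hC : IsCompact C) (hf : ∀ x ∈ C, ContDiffAt ℝ 3 f x) :
    ∃ M, 0 ≤ M ∧ ∀ x y z, Metric.closedBall x (‖y‖ + ‖z‖) ⊆ C →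
      |mixedDiff f x y z| ≤ M * ‖y‖ ^ 2 * ‖z‖ := by
  have hf2 : ∀ x ∈ C, ContDiffAt ℝ 2 (fderiv ℝ f) x := fun x hx =>
    (hf x hx).fderiv_right (by norm_num)
  have hf1 : ∀ x ∈ C, ContDiffAt ℝ 1 (fderiv ℝ (fderiv ℝ f)) x := fun x hx =>
    (hf2 x hx).fderiv_right (by norm_num)
  obtain ⟨M, hM0, hM⟩ := exists_norm_fderiv_le_of_isCompact hC hf1
  refine ⟨2 * M, by positivity, fun x y z hball => ?_⟩
  set h : E n → ℝ := fun w => fderiv ℝ f w z with hh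
  have hhd : ∀ w ∈ C, HasFDerivAt h ((fderiv ℝ (fderiv ℝ f) w).flip z) w := by
    intro w hw
    have h1 : HasFDerivAt (fderiv ℝ f) (fderiv ℝ (fderiv ℝ f) w) w :=
      ((hf2 w hw).differentiableAt (by norm_num)).hasFDerivAt
    refine (h1.clm_apply (hasFDerivAt_const z w)).congr_fderiv ?_
    ext v
    simp
  have hmem : ∀ t ∈ Set.Icc (0 : ℝ) 1, Metric.closedBall (x + t • z) ‖y‖ ⊆ C := by
    intro t ht
    refine (Metric.closedBall_subset_closedBall' ?_).trans hball
    rw [dist_eq_norm, add_sub_cancel_left, norm_smul, Real.norm_of_nonneg ht.1]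
    nlinarith [ht.2, norm_nonneg z]
  have hsd : ∀ t ∈ Set.Icc (0 : ℝ) 1, |secondDiff h (x + t • z) y| ≤ 2 * (M * ‖z‖) * ‖y‖ ^ 2 := by
    intro t ht
    refine abs_secondDiff_le_of_lipschitz (fun w hw => (hhd w (hmem t ht hw)).differentiableAt)
      fun w hw w' hw' => ?_
    rw [(hhd w (hmem t ht hw)).fderiv, (hhd w' (hmem t ht hw')).fderiv]
    have h1 : ‖fderiv ℝ (fderiv ℝ f) w - fderiv ℝ (fderiv ℝ f) w'‖ ≤ M * ‖w - w'‖ :=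
      (convex_closedBall (x + t • z) ‖y‖).norm_image_sub_le_of_norm_fderiv_le
        (fun a ha => (hf1 a (hmem t ht ha)).differentiableAt (by norm_num))
        (fun a ha => hM a (hmem t ht ha)) hw' hw
    refine ContinuousLinearMap.opNorm_le_bound _ (by positivity) fun v => ?_
    have h2 : ((fderiv ℝ (fderiv ℝ f) w).flip z - (fderiv ℝ (fderiv ℝ f) w').flip z) v =
        (fderiv ℝ (fderiv ℝ f) w - fderiv ℝ (fderiv ℝ f) w') v z := by simp
    rw [h2]
    refine (ContinuousLinearMap.le_opNorm₂ _ v z).trans ?_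
    calc _ ≤ M * ‖w - w'‖ * ‖v‖ * ‖z‖ := by gcongr
      _ = _ := by ring
  have hder : ∀ t ∈ Set.Icc (0 : ℝ) 1, HasDerivWithinAt (fun t : ℝ => secondDiff f (x + t • z) y)
      (secondDiff h (x + t • z) y) (Set.Icc 0 1) t := by
    intro t ht
    have hd : ∀ a : E n, x + t • z + a ∈ C →
        HasDerivAt (fun t : ℝ => f (x + t • z + a)) (h (x + t • z + a)) t := by
      intro a ha
      have h1 : HasDerivAt (fun t : ℝ => x + t • z + a) z t := by
        simpa using (((hasDerivAt_id t).smul_const z).const_add x).add_const a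
      exact ((hf _ ha).differentiableAt (by norm_num)).hasFDerivAt.comp_hasDerivAt t h1
    have hin : ∀ a : E n, ‖a‖ ≤ ‖y‖ → x + t • z + a ∈ C := fun a ha => hmem t ht (by
      rw [mem_closedBall_iff_norm, add_sub_cancel_left]
      exact ha)
    have h1 := hd y (hin y le_rfl)
    have h2 := hd (-y) (hin (-y) (norm_neg y).le)
    have h3 := hd 0 (hin 0 (by simp))
    simp only [← sub_eq_add_neg, add_zero] at h2 h3
    exact ((h1.fun_add h2).fun_sub (h3.const_mul 2)).hasDerivWithinAt
  have key := norm_image_sub_le_of_norm_deriv_le_segment_01' hder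
    (C := 2 * (M * ‖z‖) * ‖y‖ ^ 2) (fun t ht => hsd t ⟨ht.1, ht.2.le⟩)
  simp only [one_smul, zero_smul, add_zero] at key
  rw [mixedDiff, abs_sub_comm]
  refine key.trans (le_of_eq (by ring))

theorem abs_sub_le_of_contDiffAt_Icc {f : ℝ → ℝ} {a b : ℝ}
    (hf : ∀ r ∈ Set.Icc a b, ContDiffAt ℝ 1 f r) :
    ∃ M, 0 ≤ M ∧ ∀ r ∈ Set.Icc a b, ∀ r' ∈ Set.Icc a b, |f r - f r'| ≤ M * |r - r'| := by
  obtain ⟨M, hM0, hM⟩ := exists_norm_fderiv_le_of_isCompact isCompact_Icc hf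
  exact ⟨M, hM0, fun r hr r' hr' => (convex_Icc a b).norm_image_sub_le_of_norm_fderiv_le
    (fun x hx => (hf x hx).differentiableAt (by norm_num)) hM hr' hr⟩

/-- Derivative of a function glued from two pieces with the same value and slope. -/
theorem hasDerivAt_ite_le {f g : ℝ → ℝ} {a d : ℝ} (hf : HasDerivAt f d a) (hg : HasDerivAt g d a)
    (h : f a = g a) : HasDerivAt (fun r => if a ≤ r then f r else g r) d a := by
  have h1 : HasDerivWithinAt (fun r => if a ≤ r then f r else g r) d (Set.Ici a) a :=
    hf.hasDerivWithinAt.congr (fun r hr => if_pos hr) (if_pos le_rfl)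
  have h2 : HasDerivWithinAt (fun r => if a ≤ r then f r else g r) d (Set.Iic a) a := by
    refine hg.hasDerivWithinAt.congr (fun r hr => ?_) (by rw [if_pos le_rfl, h])
    rcases eq_or_lt_of_le (show r ≤ a from hr) with rfl | h3
    · rw [if_pos le_rfl, h]
    · exact if_neg (not_le.2 h3)
  have h3 := h1.union h2
  rw [Set.union_comm, Set.Iic_union_Ici, hasDerivWithinAt_univ] at h3
  exact h3

/-! ### Calculus of the radial profile -/

/-- The profile on `1 - t ≤ r < 1`. -/
noncomputable def profileOuter (t : ℝ) (N : ℕ) (r : ℝ) : ℝ :=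
  -((1 - r) ^ 2 * logN t N / (2 * t ^ 2 * (1 - t) ^ ((1 - t) / t)))

/-- `φ'(r)/r` on `1/N ≤ r < 1 - t`. -/
noncomputable def slopeMiddle (t : ℝ) (N : ℕ) (r : ℝ) : ℝ :=
  r ^ (-1 / t) * Real.log (r * N) / t

/-- `φ'(r)/r` on `1 - t ≤ r < 1`. -/
noncomputable def slopeOuter (t : ℝ) (N : ℕ) (r : ℝ) : ℝ :=
  logN t N / (t ^ 2 * (1 - t) ^ ((1 - t) / t)) * ((1 - r) / r)

/-- `φ'(r)/r` for the profile `φ`. -/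
noncomputable def slope (t : ℝ) (N : ℕ) (r : ℝ) : ℝ :=
  if 1 ≤ r then 0
  else if 1 - t ≤ r then slopeOuter t N r
  else if 1 / (N : ℝ) ≤ r then slopeMiddle t N r
  else 0

/-- `r` times the derivative of `φ'(r)/r`. -/
noncomputable def slopeDeriv (t : ℝ) (N : ℕ) (r : ℝ) : ℝ :=
  if 1 ≤ r then 0
  else if 1 - t ≤ r then -(logN t N / (t ^ 2 * (1 - t) ^ ((1 - t) / t)) / r)
  else if 1 / (N : ℝ) ≤ r then r ^ (-1 / t) / t - slopeMiddle t N r / t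
  else 0

section profile

variable {t : ℝ} {N : ℕ}

theorem natCast_pos_of_one_lt (ht1 : t < 1) (hN : 1 < (1 - t) * N) : (0 : ℝ) < N := by
  by_contra h
  have : (1 - t) * N ≤ 0 := mul_nonpos_of_nonneg_of_nonpos (by linarith) (not_lt.1 h)
  linarith

theorem one_div_lt_one_sub (ht1 : t < 1) (hN : 1 < (1 - t) * N) : 1 / (N : ℝ) < 1 - t := by
  rwa [div_lt_iff₀ (natCast_pos_of_one_lt ht1 hN)]

theorem logN_pos (hN : 1 < (1 - t) * N) : 0 < logN t N := Real.log_pos hN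

theorem hasDerivAt_profileOuter (t : ℝ) (N : ℕ) {r : ℝ} (hr : r ≠ 0) :
    HasDerivAt (profileOuter t N) (r * slopeOuter t N r) r := by
  have h1 : HasDerivAt (fun r : ℝ => (1 - r) ^ 2) (2 * (1 - r) * (-1)) r := by
    refine (((hasDerivAt_id r).const_sub 1).fun_pow 2).congr_deriv ?_
    simp
  refine (((h1.mul_const (logN t N)).div_const
    (2 * t ^ 2 * (1 - t) ^ ((1 - t) / t))).fun_neg).congr_deriv ?_
  unfold slopeOuter
  rw [mul_left_comm, mul_div_cancel₀ _ hr]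
  ring

theorem hasDerivAt_profileMiddle (ht : 1 / 2 < t) (hN : (0 : ℝ) < N) {r : ℝ} (hr : 0 < r) :
    HasDerivAt (profileMiddle t N) (r * slopeMiddle t N r) r := by
  have h2t : 0 < 2 * t - 1 := by linarith
  have ht0 : 0 < t := by linarith
  have h1 : HasDerivAt (fun r : ℝ => r ^ ((2 * t - 1) / t))
      ((2 * t - 1) / t * r ^ ((2 * t - 1) / t - 1)) r := by
    refine ((hasDerivAt_id r).rpow_const (Or.inl hr.ne')).congr_deriv ?_
    simp
  have h2 : HasDerivAt (fun r : ℝ => Real.log (r * N)) (1 / r) r := by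
    refine (((hasDerivAt_id r).mul_const (N : ℝ)).log (mul_pos hr hN).ne').congr_deriv ?_
    simp only [id]
    field_simp
  refine (((((h1.fun_mul h2).const_sub (1 / 2 * (1 - t) ^ (-(1 - t) / t) * logN t N)).fun_sub
    ((h1.const_sub ((1 - t) ^ ((2 * t - 1) / t))).const_mul (t / (2 * t - 1)))).const_mul
    (-(1 / (2 * t - 1))))).congr_deriv ?_
  have e1 : r ^ ((2 * t - 1) / t - 1) = r * r ^ (-1 / t) := by
    nth_rewrite 2 [← Real.rpow_one r]
    rw [← Real.rpow_add hr]
    congr 1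
    field_simp
    ring
  have e2 : r ^ ((2 * t - 1) / t) = r * (r * r ^ (-1 / t)) := by
    rw [← e1, Real.rpow_sub hr, Real.rpow_one]
    field_simp
  unfold slopeMiddle
  rw [e1, e2]
  field_simp
  ring

/-- Together with `slopeMiddle_one_sub` this is the `C¹` matching at `1 - t`. The slope fixes the
coefficient of the outer parabola and the value fixes the additive constant of the middle formula.
-/
theorem profileMiddle_one_sub (ht : 1 / 2 < t) (ht1 : t < 1) :
    profileMiddle t N (1 - t) = profileOuter t N (1 - t) := by
  have h2t : 0 < 2 * t - 1 := by linarith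
  have ht0 : 0 < t := by linarith
  have h1t : 0 < 1 - t := by linarith
  unfold profileMiddle profileOuter
  rw [show Real.log ((1 - t) * N) = logN t N from rfl]
  have e1 : (1 - t) ^ ((2 * t - 1) / t) = (1 - t) * (1 - t) ^ (-(1 - t) / t) := by
    nth_rewrite 2 [← Real.rpow_one (1 - t)]
    rw [← Real.rpow_add h1t]
    congr 1
    field_simp
    ring
  have e2 : ((1 - t) ^ ((1 - t) / t))⁻¹ = (1 - t) ^ (-(1 - t) / t) := by
    rw [← Real.rpow_neg h1t.le, neg_div]
  rw [e1, ← e2]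
  have h3 : (1 - t) ^ ((1 - t) / t) ≠ 0 := by positivity
  field_simp
  ring

theorem slopeMiddle_one_sub (ht : 1 / 2 < t) (ht1 : t < 1) :
    slopeMiddle t N (1 - t) = slopeOuter t N (1 - t) := by
  have ht0 : 0 < t := by linarith
  have h1t : 0 < 1 - t := by linarith
  unfold slopeMiddle slopeOuter
  rw [show Real.log ((1 - t) * N) = logN t N from rfl]
  have e1 : (1 - t) ^ (-1 / t) = (1 - t)⁻¹ * ((1 - t) ^ ((1 - t) / t))⁻¹ := by
    rw [← Real.rpow_neg h1t.le, ← Real.rpow_neg_one, ← Real.rpow_add h1t]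
    congr 1
    field_simp
    ring
  rw [e1]
  have h3 : (1 - t) ^ ((1 - t) / t) ≠ 0 := by positivity
  field_simp
  ring

/-- The logarithm vanishes at `r = 1/N`, which lets the constant inner piece join with zero slope.
-/
theorem slopeMiddle_one_div (hN : (0 : ℝ) < N) : slopeMiddle t N (1 / N) = 0 := by
  unfold slopeMiddle
  rw [one_div_mul_cancel hN.ne']
  simp

theorem slope_of_one_le {r : ℝ} (hr : 1 ≤ r) : slope t N r = 0 := if_pos hr

theorem slope_of_mem_outer {r : ℝ} (hr : r ∈ Set.Icc (1 - t) 1) :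
    slope t N r = slopeOuter t N r := by
  rcases eq_or_lt_of_le hr.2 with rfl | h
  · simp [slope, slopeOuter]
  · rw [slope, if_neg (not_le.2 h), if_pos hr.1]

theorem slope_of_mem_middle (ht : 1 / 2 < t) (ht1 : t < 1) {r : ℝ}
    (hr : r ∈ Set.Icc (1 / (N : ℝ)) (1 - t)) : slope t N r = slopeMiddle t N r := by
  rcases eq_or_lt_of_le hr.2 with rfl | h
  · rw [slopeMiddle_one_sub ht ht1, slope_of_mem_outer ⟨le_rfl, by linarith⟩]
  · rw [slope, if_neg (by linarith), if_neg (not_le.2 h), if_pos hr.1]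

theorem slope_of_le (ht : 1 / 2 < t) (ht1 : t < 1) (hN : 1 < (1 - t) * N) {r : ℝ}
    (hr : r ≤ 1 / (N : ℝ)) : slope t N r = 0 := by
  have h1 := one_div_lt_one_sub ht1 hN
  rcases eq_or_lt_of_le hr with rfl | h
  · rw [slope_of_mem_middle ht ht1 ⟨le_rfl, h1.le⟩,
      slopeMiddle_one_div (natCast_pos_of_one_lt ht1 hN)]
  · rw [slope, if_neg (by linarith), if_neg (by linarith), if_neg (not_le.2 h)]

/-- The profile is differentiable, with derivative `r * slope r`. -/
theorem hasDerivAt_profile (ht : 1 / 2 < t) (ht1 : t < 1) (hN : 1 < (1 - t) * N) (r : ℝ) :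
    HasDerivAt (profile t N) (r * slope t N r) r := by
  have hN0 := natCast_pos_of_one_lt ht1 hN
  have hlt := one_div_lt_one_sub ht1 hN
  have hNi : (0 : ℝ) < 1 / N := by positivity
  have ht0 : 0 < t := by linarith
  have hmid : ∀ r, 0 < r → HasDerivAt (profileMiddle t N) (r * slopeMiddle t N r) r :=
    fun r hr => hasDerivAt_profileMiddle ht hN0 hr
  have hout : ∀ r, 0 < r → HasDerivAt (profileOuter t N) (r * slopeOuter t N r) r :=
    fun r hr => hasDerivAt_profileOuter t N hr.ne'
  rcases lt_or_ge r (1 - t) with h1 | h1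
  · have hev : profile t N =ᶠ[𝓝 r] fun r => if 1 / (N : ℝ) ≤ r then profileMiddle t N r
        else profileMiddle t N (1 / (N : ℝ)) := by
      filter_upwards [gt_mem_nhds h1] with x hx
      rw [profile, if_neg (by linarith), if_neg (not_le.2 hx)]
    refine HasDerivAt.congr_of_eventuallyEq ?_ hev
    rcases lt_trichotomy r (1 / (N : ℝ)) with h2 | rfl | h2
    · rw [slope_of_le ht ht1 hN h2.le, mul_zero]
      refine (hasDerivAt_const r (profileMiddle t N (1 / (N : ℝ)))).congr_of_eventuallyEq ?_
      filter_upwards [gt_mem_nhds h2] with x hx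
      rw [if_neg (not_le.2 hx)]
    · rw [slope_of_le ht ht1 hN le_rfl, mul_zero]
      refine hasDerivAt_ite_le ((hmid _ hNi).congr_deriv ?_) (hasDerivAt_const _ _) rfl
      rw [slopeMiddle_one_div hN0, mul_zero]
    · rw [slope_of_mem_middle ht ht1 ⟨h2.le, h1.le⟩]
      refine (hmid r (hNi.trans h2)).congr_of_eventuallyEq ?_
      filter_upwards [lt_mem_nhds h2] with x hx
      rw [if_pos hx.le]
  have hr0 : 0 < r := by linarith
  rcases lt_or_ge r 1 with h2 | h2
  · have hev : profile t N =ᶠ[𝓝 r] fun r => if 1 - t ≤ r then profileOuter t N r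
        else profileMiddle t N r := by
      filter_upwards [gt_mem_nhds h2, lt_mem_nhds (hlt.trans_le h1)] with x hx hx'
      rw [profile, if_neg (not_le.2 hx), if_pos hx'.le]
      rfl
    refine HasDerivAt.congr_of_eventuallyEq ?_ hev
    rw [slope_of_mem_outer ⟨h1, h2.le⟩]
    rcases eq_or_lt_of_le h1 with rfl | h3
    · refine hasDerivAt_ite_le (hout _ hr0) ((hmid _ hr0).congr_deriv ?_)
        (profileMiddle_one_sub ht ht1).symm
      rw [slopeMiddle_one_sub ht ht1]
    · refine (hout r hr0).congr_of_eventuallyEq ?_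
      filter_upwards [lt_mem_nhds h3] with x hx
      rw [if_pos hx.le]
  · have hev : profile t N =ᶠ[𝓝 r] fun r => if 1 ≤ r then 0 else profileOuter t N r := by
      filter_upwards [lt_mem_nhds (show 1 - t < r by linarith)] with x hx
      rw [profile]
      split_ifs with h3 h4
      · rfl
      · rfl
      · exact absurd hx.le h4
      · exact absurd hx.le h4
    refine HasDerivAt.congr_of_eventuallyEq ?_ hev
    rw [slope_of_one_le h2, mul_zero]
    rcases eq_or_lt_of_le h2 with rfl | h3
    · refine hasDerivAt_ite_le (hasDerivAt_const _ _) ((hout _ one_pos).congr_deriv ?_) ?_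
      · simp [slopeOuter]
      · simp [profileOuter]
    · refine (hasDerivAt_const r (0 : ℝ)).congr_of_eventuallyEq ?_
      filter_upwards [lt_mem_nhds h3] with x hx
      rw [if_pos hx.le]

theorem slope_nonneg (ht : 1 / 2 < t) (ht1 : t < 1) (hN : 1 < (1 - t) * N) (r : ℝ) :
    0 ≤ slope t N r := by
  have hN0 := natCast_pos_of_one_lt ht1 hN
  have hlt := one_div_lt_one_sub ht1 hN
  have hNi : (0 : ℝ) < 1 / N := by positivity
  have ht0 : 0 < t := by linarith
  have h1t : 0 < 1 - t := by linarith
  have hL := logN_pos hN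
  unfold slope
  split_ifs with h1 h2 h3
  · exact le_rfl
  · unfold slopeOuter
    have : 0 < 1 - r := by linarith [not_le.1 h1]
    have : 0 < r := by linarith
    positivity
  · unfold slopeMiddle
    have h4 : 0 < r := hNi.trans_le h3
    have h5 : 0 ≤ Real.log (r * N) := Real.log_nonneg (by rwa [div_le_iff₀ hN0] at h3)
    positivity
  · exact le_rfl

theorem monotoneOn_profile (ht : 1 / 2 < t) (ht1 : t < 1) (hN : 1 < (1 - t) * N) :
    MonotoneOn (profile t N) (Set.Ici 0) := by
  have hd := hasDerivAt_profile ht ht1 hN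
  refine monotoneOn_of_deriv_nonneg (convex_Ici 0)
    (fun r _ => (hd r).continuousAt.continuousWithinAt)
    (fun r _ => (hd r).differentiableAt.differentiableWithinAt) fun r hr => ?_
  rw [interior_Ici] at hr
  rw [(hd r).deriv]
  exact mul_nonneg (le_of_lt hr) (slope_nonneg ht ht1 hN r)

theorem profile_nonpos (ht : 1 / 2 < t) (ht1 : t < 1) (hN : 1 < (1 - t) * N) {r : ℝ} (hr : 0 ≤ r) :
    profile t N r ≤ 0 := by
  have h1 : profile t N (max r 1) = 0 := if_pos (le_max_right _ _)
  rw [← h1]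
  exact monotoneOn_profile ht ht1 hN hr (hr.trans (le_max_left _ _)) (le_max_left _ _)

theorem contDiffAt_slopeMiddle (hN : (0 : ℝ) < N) {r : ℝ} (hr : 0 < r) {k : WithTop ℕ∞} :
    ContDiffAt ℝ k (slopeMiddle t N) r := by
  have h1 : ContDiffAt ℝ k (fun r : ℝ => r ^ (-1 / t)) r :=
    contDiffAt_id.rpow_const_of_ne hr.ne'
  have h2 : ContDiffAt ℝ k (fun r : ℝ => Real.log (r * N)) r :=
    (contDiffAt_id.mul contDiffAt_const).log (mul_pos hr hN).ne'
  exact (h1.mul h2).div_const t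

theorem contDiffAt_slopeOuter {r : ℝ} (hr : r ≠ 0) {k : WithTop ℕ∞} :
    ContDiffAt ℝ k (slopeOuter t N) r :=
  contDiffAt_const.mul ((contDiffAt_const.sub contDiffAt_id).div contDiffAt_id hr)

/-- The gradient of `φ(|x|)` is `slope(|x|) x`, so it is `φ'(r)/r` that has to be Lipschitz. Each
smooth formula is composed with a clamp to its closed interval, a 1-Lipschitz map, and `slope` is
the sum of the two compositions minus the common value at `1 - t`. Pairs of points in different
regions then need no separate treatment. -/
theorem exists_abs_slope_sub_le (ht : 1 / 2 < t) (ht1 : t < 1) (hN : 1 < (1 - t) * N) :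
    ∃ M, 0 ≤ M ∧ ∀ r r', |slope t N r - slope t N r'| ≤ M * |r - r'| := by
  have hN0 := natCast_pos_of_one_lt ht1 hN
  have hlt := one_div_lt_one_sub ht1 hN
  have hNi : (0 : ℝ) < 1 / N := by positivity
  have ht0 : 0 < t := by linarith
  obtain ⟨M1, hM1, h1⟩ := abs_sub_le_of_contDiffAt_Icc (a := 1 / (N : ℝ)) (b := 1 - t)
    fun r hr => contDiffAt_slopeMiddle (t := t) hN0 (hNi.trans_le hr.1)
  obtain ⟨M2, hM2, h2⟩ := abs_sub_le_of_contDiffAt_Icc (a := 1 - t) (b := 1)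
    fun r hr => contDiffAt_slopeOuter (t := t) (N := N) (r := r) (by linarith [hr.1])
  set c1 : ℝ → ℝ := fun r => max (1 / (N : ℝ)) (min r (1 - t)) with hc1
  set c2 : ℝ → ℝ := fun r => max (1 - t) (min r 1) with hc2
  have hclamp : ∀ a b r r' : ℝ, |max a (min r b) - max a (min r' b)| ≤ |r - r'| := by
    intro a b r r'
    refine (abs_max_sub_max_le_max _ _ _ _).trans ?_
    rw [sub_self, abs_zero, max_eq_right (abs_nonneg _)]
    refine (abs_min_sub_min_le_max _ _ _ _).trans ?_
    rw [sub_self, abs_zero, max_eq_left (abs_nonneg _)]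
  have hmem1 : ∀ r, c1 r ∈ Set.Icc (1 / (N : ℝ)) (1 - t) := fun r =>
    ⟨le_max_left _ _, max_le hlt.le (min_le_right _ _)⟩
  have hmem2 : ∀ r, c2 r ∈ Set.Icc (1 - t) 1 := fun r =>
    ⟨le_max_left _ _, max_le (by linarith) (min_le_right _ _)⟩
  have hG : ∀ r, slope t N r =
      slopeMiddle t N (c1 r) + slopeOuter t N (c2 r) - slopeOuter t N (1 - t) := by
    intro r
    rcases le_total r (1 - t) with h3 | h3
    · have e2 : c2 r = 1 - t := by
        simp only [hc2]
        rw [min_eq_left (by linarith), max_eq_left h3]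
      rw [e2, add_sub_cancel_right]
      rcases le_total r (1 / (N : ℝ)) with h4 | h4
      · have e1 : c1 r = 1 / N := by
          simp only [hc1]
          rw [min_eq_left h3, max_eq_left h4]
        rw [e1, slopeMiddle_one_div hN0, slope_of_le ht ht1 hN h4]
      · have e1 : c1 r = r := by
          simp only [hc1]
          rw [min_eq_left h3, max_eq_right h4]
        rw [e1, slope_of_mem_middle ht ht1 ⟨h4, h3⟩]
    · have e1 : c1 r = 1 - t := by
        simp only [hc1]
        rw [min_eq_right h3, max_eq_right hlt.le]
      rw [e1, slopeMiddle_one_sub ht ht1, add_sub_cancel_left]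
      rcases le_total r 1 with h4 | h4
      · have e2 : c2 r = r := by
          simp only [hc2]
          rw [min_eq_left h4, max_eq_right h3]
        rw [e2, slope_of_mem_outer ⟨h3, h4⟩]
      · have e2 : c2 r = 1 := by
          simp only [hc2]
          rw [min_eq_right h4, max_eq_right (by linarith)]
        rw [e2, slope_of_one_le h4]
        simp [slopeOuter]
  refine ⟨M1 + M2, by positivity, fun r r' => ?_⟩
  rw [hG, hG]
  have h3 := (h1 _ (hmem1 r) _ (hmem1 r')).trans (mul_le_mul_of_nonneg_left (hclamp _ _ r r') hM1)
  have h4 := (h2 _ (hmem2 r) _ (hmem2 r')).trans (mul_le_mul_of_nonneg_left (hclamp _ _ r r') hM2)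
  calc _ = |(slopeMiddle t N (c1 r) - slopeMiddle t N (c1 r')) +
        (slopeOuter t N (c2 r) - slopeOuter t N (c2 r'))| := by congr 1; ring
    _ ≤ _ := (abs_add_le _ _).trans (by linarith)

theorem exists_abs_slope_le (ht : 1 / 2 < t) (ht1 : t < 1) (hN : 1 < (1 - t) * N) :
    ∃ M, 0 ≤ M ∧ ∀ r, 0 ≤ r → |slope t N r| ≤ M := by
  obtain ⟨M, hM0, hM⟩ := exists_abs_slope_sub_le ht ht1 hN
  refine ⟨M, hM0, fun r hr => ?_⟩
  rcases le_total 1 r with h1 | h1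
  · rw [slope_of_one_le h1, abs_zero]
    exact hM0
  · have h2 := hM r 1
    rw [slope_of_one_le le_rfl, sub_zero] at h2
    have h3 : |r - 1| ≤ 1 := by
      rw [abs_le]
      constructor <;> linarith
    nlinarith

end profile

end NonlocalABP
namespace NonlocalABP

/-! ### The radial potential -/

open scoped RealInnerProductSpace

theorem hasFDerivAt_norm_of_ne_zero {n : ℕ} {x : E n} (hx : x ≠ 0) :
    HasFDerivAt (fun x : E n => ‖x‖) (‖x‖⁻¹ • innerSL ℝ x) x := by
  have h1 : 0 < ‖x‖ := norm_pos_iff.2 hx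
  have h2 := ((hasStrictFDerivAt_norm_sq x).hasFDerivAt.sqrt (by positivity))
  simp only [Real.sqrt_sq (norm_nonneg _)] at h2
  refine h2.congr_fderiv ?_
  ext v
  simp only [smul_apply, smul_eq_mul, innerSL_apply_apply, nsmul_eq_mul, Nat.cast_ofNat]
  field_simp

/-- The Hessian of the radial function `x ↦ φ(|x|)`. -/
noncomputable def radialHessian {n : ℕ} (t : ℝ) (N : ℕ) (x : E n) : Matrix (Fin n) (Fin n) ℝ :=
  Matrix.of fun i j => slope t N ‖x‖ * (if i = j then 1 else 0) +
    slopeDeriv t N ‖x‖ / ‖x‖ ^ 2 * (x i * x j)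

section potential

variable {n : ℕ} {t : ℝ} {N : ℕ}

theorem hasFDerivAt_profile_norm (ht : 1 / 2 < t) (ht1 : t < 1) (hN : 1 < (1 - t) * N) (x : E n) :
    HasFDerivAt (fun x : E n => profile t N ‖x‖) (slope t N ‖x‖ • innerSL ℝ x) x := by
  have hN0 := natCast_pos_of_one_lt ht1 hN
  have hlt := one_div_lt_one_sub ht1 hN
  have hNi : (0 : ℝ) < 1 / N := by positivity
  rcases eq_or_ne x 0 with rfl | hx
  · have hev : (fun x : E n => profile t N ‖x‖) =ᶠ[𝓝 0] fun _ => profileMiddle t N (1 / N) := by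
      filter_upwards [Metric.ball_mem_nhds (0 : E n) hNi] with w hw
      rw [mem_ball_zero_iff] at hw
      rw [profile, if_neg (by linarith), if_neg (by linarith), if_neg (not_le.2 hw)]
    refine ((hasFDerivAt_const _ _).congr_of_eventuallyEq hev).congr_fderiv ?_
    simp
  · have h1 : 0 < ‖x‖ := norm_pos_iff.2 hx
    refine ((hasDerivAt_profile ht ht1 hN ‖x‖).comp_hasFDerivAt x
      (hasFDerivAt_norm_of_ne_zero hx)).congr_fderiv ?_
    rw [smul_smul]
    congr 1
    field_simp

theorem exists_isC11Bump_profile (ht : 1 / 2 < t) (ht1 : t < 1) (hN : 1 < (1 - t) * N) :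
    ∃ K, IsC11Bump K fun x : E n => profile t N ‖x‖ := by
  obtain ⟨M₁, hM₁, h₁⟩ := exists_abs_slope_sub_le ht ht1 hN
  obtain ⟨M₂, hM₂, h₂⟩ := exists_abs_slope_le ht ht1 hN
  obtain ⟨M, hM0, hM, hsl⟩ : ∃ M, 0 ≤ M ∧ (∀ r r', |slope t N r - slope t N r'| ≤ M * |r - r'|) ∧
      ∀ r, 0 ≤ r → |slope t N r| ≤ M :=
    ⟨max M₁ M₂, hM₁.trans (le_max_left _ _),
      fun r r' => (h₁ r r').trans (by gcongr; exact le_max_left _ _),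
      fun r hr => (h₂ r hr).trans (le_max_right _ _)⟩
  have hfd := fun x : E n => (hasFDerivAt_profile_norm ht ht1 hN x).fderiv
  -- One point in the unit ball is enough: the difference of slopes is multiplied by that point, of
  -- norm at most `1`. If both points lie outside, both gradients vanish.
  have h1 : ∀ x y : E n, ‖x‖ ≤ 1 → ‖slope t N ‖x‖ • innerSL ℝ x - slope t N ‖y‖ • innerSL ℝ y‖ ≤
      2 * M * ‖x - y‖ := by
    intro x y hx
    have h2 : slope t N ‖x‖ • innerSL ℝ x - slope t N ‖y‖ • innerSL ℝ y =
        (slope t N ‖x‖ - slope t N ‖y‖) • innerSL ℝ x +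
          slope t N ‖y‖ • innerSL ℝ (x - y) := by
      ext v
      simp only [sub_apply, add_apply, smul_apply, smul_eq_mul, innerSL_apply_apply,
        inner_sub_left]
      ring
    rw [h2]
    refine (norm_add_le _ _).trans ?_
    rw [norm_smul, norm_smul, innerSL_apply_norm, innerSL_apply_norm]
    have h3 := hM ‖x‖ ‖y‖
    have h4 := hsl ‖y‖ (norm_nonneg y)
    have h5 := abs_norm_sub_norm_le x y
    rw [Real.norm_eq_abs, Real.norm_eq_abs]
    calc _ ≤ M * ‖x - y‖ * 1 + M * ‖x - y‖ := by
          gcongr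
          exact h3.trans (by gcongr)
      _ = _ := by ring
  refine ⟨2 * M + |profile t N 0|, ⟨fun x => (hasFDerivAt_profile_norm ht ht1 hN x).differentiableAt,
    fun x => ?_, fun x => ?_, fun x y => ?_, fun x hx => if_pos hx⟩⟩
  · have h2 := monotoneOn_profile ht ht1 hN (Set.mem_Ici.2 le_rfl) (norm_nonneg x) (norm_nonneg x)
    have h3 := profile_nonpos ht ht1 hN (norm_nonneg x)
    rw [abs_of_nonpos h3, abs_of_nonpos (h2.trans h3)]
    linarith
  · rw [hfd, norm_smul, innerSL_apply_norm, Real.norm_eq_abs]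
    have h2 := hsl ‖x‖ (norm_nonneg x)
    have h3 := abs_nonneg (profile t N 0)
    rcases le_total 1 ‖x‖ with h4 | h4
    · rw [slope_of_one_le h4, abs_zero, zero_mul]
      positivity
    · nlinarith [abs_nonneg (slope t N ‖x‖), norm_nonneg x]
  · rw [hfd, hfd]
    have h3 : 0 ≤ |profile t N 0| * ‖x - y‖ := by positivity
    have h4 : 0 ≤ 2 * M * ‖x - y‖ := by positivity
    rw [add_mul]
    rcases le_total ‖x‖ 1 with h5 | h5
    · linarith [h1 x y h5]
    rcases le_total ‖y‖ 1 with h6 | h6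
    · have h7 := h1 y x h6
      rw [norm_sub_rev, norm_sub_rev y x] at h7
      linarith
    · rw [slope_of_one_le h5, slope_of_one_le h6]
      simp only [zero_smul, sub_zero, norm_zero]
      linarith

theorem contDiffAt_profileMiddle (hN : (0 : ℝ) < N) {r : ℝ} (hr : 0 < r) {k : WithTop ℕ∞} :
    ContDiffAt ℝ k (profileMiddle t N) r := by
  have h1 : ContDiffAt ℝ k (fun r : ℝ => r ^ ((2 * t - 1) / t)) r :=
    contDiffAt_id.rpow_const_of_ne hr.ne'
  have h2 : ContDiffAt ℝ k (fun r : ℝ => Real.log (r * N)) r :=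
    (contDiffAt_id.mul contDiffAt_const).log (mul_pos hr hN).ne'
  exact contDiffAt_const.mul ((contDiffAt_const.sub (h1.mul h2)).sub
    (contDiffAt_const.mul (contDiffAt_const.sub h1)))

theorem contDiff_profileOuter {k : WithTop ℕ∞} : ContDiff ℝ k (profileOuter t N) := by
  unfold profileOuter
  fun_prop

/-- When `‖x‖` is further than `‖y‖+‖z‖` from the three gluing radii, all six points of the mixed
difference lie in one region, where the profile is given by a single formula. Both nonconstant
formulas extend smoothly past the ends of their regions, so compactness of the closed annuli yields
the bound. -/
theorem exists_abs_mixedDiff_profile_le (ht : 1 / 2 < t) (ht1 : t < 1) (hN : 1 < (1 - t) * N) :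
    ∃ M, 0 ≤ M ∧ ∀ x y z : E n,
      (∀ r ∈ ({1 / (N : ℝ), 1 - t, 1} : Finset ℝ), ‖y‖ + ‖z‖ < |‖x‖ - r|) →
      |mixedDiff (fun x : E n => profile t N ‖x‖) x y z| ≤ M * ‖y‖ ^ 2 * ‖z‖ := by
  have hN0 := natCast_pos_of_one_lt ht1 hN
  have hlt := one_div_lt_one_sub ht1 hN
  have hNi : (0 : ℝ) < 1 / N := by positivity
  set A : ℝ → ℝ → Set (E n) := fun a b => {x | a ≤ ‖x‖ ∧ ‖x‖ ≤ b} with hA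
  have hAc : ∀ a b, IsCompact (A a b) := fun a b =>
    (isCompact_closedBall (0 : E n) b).of_isClosed_subset
      ((isClosed_le continuous_const continuous_norm).inter
        (isClosed_le continuous_norm continuous_const))
      fun x hx => by
        rw [mem_closedBall_zero_iff]
        exact hx.2
  have hne : ∀ a b, 0 < a → ∀ x ∈ A a b, x ≠ 0 := by
    rintro a b ha x hx rfl
    have := hx.1
    rw [norm_zero] at this
    linarith
  obtain ⟨M1, hM1, h1⟩ := exists_abs_mixedDiff_le_of_contDiffAt
    (f := fun x : E n => profileMiddle t N ‖x‖) (hAc (1 / N) (1 - t)) fun x hx => by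
      have hx0 := hne _ _ hNi x hx
      exact (contDiffAt_profileMiddle hN0 (norm_pos_iff.2 hx0)).comp x (contDiffAt_norm ℝ hx0)
  obtain ⟨M2, hM2, h2⟩ := exists_abs_mixedDiff_le_of_contDiffAt
    (f := fun x : E n => profileOuter t N ‖x‖) (hAc (1 - t) 1) fun x hx =>
      contDiff_profileOuter.contDiffAt.comp x (contDiffAt_norm ℝ (hne _ _ (by linarith) x hx))
  refine ⟨M1 + M2, by positivity, fun x y z hxyz => ?_⟩
  set ρ := ‖y‖ + ‖z‖ with hρ
  have hρ0 : 0 ≤ ρ := by positivity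
  have hball : ∀ w ∈ Metric.closedBall x ρ, ‖x‖ - ρ ≤ ‖w‖ ∧ ‖w‖ ≤ ‖x‖ + ρ := by
    intro w hw
    rw [mem_closedBall_iff_norm] at hw
    have h3 := norm_sub_norm_le w x
    have h4 := norm_sub_norm_le x w
    rw [norm_sub_rev] at h4
    constructor <;> linarith
  have hcongr : ∀ f g : E n → ℝ, (∀ w ∈ Metric.closedBall x ρ, f w = g w) →
      mixedDiff f x y z = mixedDiff g x y z := by
    intro f g hfg
    have hin : ∀ a, ‖a‖ ≤ ρ → f (x + a) = g (x + a) := fun a ha => hfg _ (by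
      rw [mem_closedBall_iff_norm, add_sub_cancel_left]
      exact ha)
    have e1 := hin y (by linarith [norm_nonneg z])
    have e2 := hin (-y) (by rw [norm_neg]; linarith [norm_nonneg z])
    have e3 := hin 0 (by rw [norm_zero]; exact hρ0)
    have e4 := hin (z + y) (by rw [hρ, add_comm ‖y‖]; exact norm_add_le z y)
    have e5 := hin (z - y) (by rw [hρ, add_comm ‖y‖]; exact norm_sub_le z y)
    have e6 := hin z (by linarith [norm_nonneg y])
    rw [add_zero] at e3
    rw [← sub_eq_add_neg] at e2
    simp only [mixedDiff, secondDiff, add_assoc, add_sub_assoc, e1, e3, e4, e5, e6]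
    rw [e2]
  have hconst : ∀ c : ℝ, mixedDiff (fun _ : E n => c) x y z = 0 := fun c => by
    simp [mixedDiff, secondDiff]
  have hb1 : 0 ≤ M1 * ‖y‖ ^ 2 * ‖z‖ := by positivity
  have hb2 : 0 ≤ M2 * ‖y‖ ^ 2 * ‖z‖ := by positivity
  rw [add_mul, add_mul]
  have hr1 := hxyz (1 / N) (by simp)
  have hr2 := hxyz (1 - t) (by simp)
  have hr3 := hxyz 1 (by simp)
  rw [lt_abs] at hr1 hr2 hr3
  rcases hr3 with h3 | h3
  · rw [hcongr (fun x : E n => profile t N ‖x‖) (fun _ => 0) fun w hw =>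
      if_pos (by linarith [(hball w hw).1]), hconst, abs_zero]
    linarith
  rcases hr2 with h4 | h4
  · rw [hcongr _ (fun x : E n => profileOuter t N ‖x‖) fun w hw => by
      have h5 := hball w hw
      rw [profile, if_neg (by linarith), if_pos (by linarith)]
      rfl]
    have := h2 x y z fun w hw => by
      have h5 := hball w hw
      exact ⟨by linarith, by linarith⟩
    linarith
  rcases hr1 with h5 | h5
  · rw [hcongr _ (fun x : E n => profileMiddle t N ‖x‖) fun w hw => by
      have h5 := hball w hw
      rw [profile, if_neg (by linarith), if_neg (by linarith), if_pos (by linarith)]]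
    have := h1 x y z fun w hw => by
      have h5 := hball w hw
      exact ⟨by linarith, by linarith⟩
    linarith
  · rw [hcongr _ (fun _ => profileMiddle t N (1 / N)) fun w hw => by
      have h5 := hball w hw
      rw [profile, if_neg (by linarith), if_neg (by linarith), if_neg (by linarith)], hconst,
      abs_zero]
    linarith

theorem hasDerivAt_slope (ht : 1 / 2 < t) (ht1 : t < 1) (hN : 1 < (1 - t) * N) {r : ℝ} (hr : 0 < r)
    (h1 : r ≠ 1 / N) (h2 : r ≠ 1 - t) (h3 : r ≠ 1) :
    HasDerivAt (slope t N) (slopeDeriv t N r / r) r := by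
  have ht0 : t ≠ 0 := by linarith
  have hN0 := natCast_pos_of_one_lt ht1 hN
  have hlt := one_div_lt_one_sub ht1 hN
  rcases lt_or_gt_of_ne h3 with h4 | h4
  · rcases lt_or_gt_of_ne h2 with h5 | h5
    · rcases lt_or_gt_of_ne h1 with h6 | h6
      · have e : slopeDeriv t N r = 0 := by
          rw [slopeDeriv, if_neg (not_le.2 h4), if_neg (not_le.2 h5), if_neg (not_le.2 h6)]
        rw [e, zero_div]
        refine (hasDerivAt_const r (0 : ℝ)).congr_of_eventuallyEq ?_
        filter_upwards [gt_mem_nhds h4, gt_mem_nhds h5, gt_mem_nhds h6] with x hx hx' hx''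
        rw [slope, if_neg (not_le.2 hx), if_neg (not_le.2 hx'), if_neg (not_le.2 hx'')]
      · have e : slopeDeriv t N r = r ^ (-1 / t) / t - slopeMiddle t N r / t := by
          rw [slopeDeriv, if_neg (not_le.2 h4), if_neg (not_le.2 h5), if_pos h6.le]
        have hev : slope t N =ᶠ[𝓝 r] slopeMiddle t N := by
          filter_upwards [gt_mem_nhds h4, gt_mem_nhds h5, lt_mem_nhds h6] with x hx hx' hx''
          rw [slope, if_neg (not_le.2 hx), if_neg (not_le.2 hx'), if_pos (le_of_lt hx'')]
        refine HasDerivAt.congr_of_eventuallyEq ?_ hev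
        have e1 : HasDerivAt (fun r : ℝ => r ^ (-1 / t)) ((-1 / t) * r ^ (-1 / t - 1)) r := by
          refine ((hasDerivAt_id r).rpow_const (Or.inl hr.ne')).congr_deriv ?_
          simp
        have e2 : HasDerivAt (fun r : ℝ => Real.log (r * N)) (1 / r) r := by
          refine (((hasDerivAt_id r).mul_const (N : ℝ)).log (mul_pos hr hN0).ne').congr_deriv ?_
          simp only [id]
          field_simp
        refine ((e1.fun_mul e2).div_const t).congr_deriv ?_
        rw [e, Real.rpow_sub hr, Real.rpow_one, slopeMiddle]
        field_simp
        ring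
    · have e : slopeDeriv t N r = -(logN t N / (t ^ 2 * (1 - t) ^ ((1 - t) / t)) / r) := by
        rw [slopeDeriv, if_neg (not_le.2 h4), if_pos h5.le]
      have hev : slope t N =ᶠ[𝓝 r] slopeOuter t N := by
        filter_upwards [gt_mem_nhds h4, lt_mem_nhds h5] with x hx hx'
        rw [slope, if_neg (not_le.2 hx), if_pos (le_of_lt hx')]
      refine HasDerivAt.congr_of_eventuallyEq ?_ hev
      rw [e]
      refine ((((hasDerivAt_id r).const_sub 1).fun_div (hasDerivAt_id r) hr.ne').const_mul
        _).congr_deriv ?_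
      simp only [id]
      field_simp
      ring
  · have e : slopeDeriv t N r = 0 := if_pos h4.le
    rw [e, zero_div]
    refine (hasDerivAt_const r (0 : ℝ)).congr_of_eventuallyEq ?_
    filter_upwards [lt_mem_nhds h4] with x hx
    exact if_pos (le_of_lt hx)

theorem ae_norm_ne [NeZero n] (r : ℝ) : ∀ᵐ x : E n, ‖x‖ ≠ r := by
  have h := Measure.addHaar_sphere (volume : Measure (E n)) 0 r
  rw [ae_iff]
  simp only [not_not]
  have h2 : {a : E n | ‖a‖ = r} = Metric.sphere 0 r := by
    ext x
    simp
  rw [h2, h]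

theorem ae_hasLineDerivAt_fderiv_profile [NeZero n] (ht : 1 / 2 < t) (ht1 : t < 1)
    (hN : 1 < (1 - t) * N) (i j : Fin n) :
    ∀ᵐ x : E n, HasLineDerivAt ℝ
      (fun x => fderiv ℝ (fun x : E n => profile t N ‖x‖) x (EuclideanSpace.single j 1))
      (radialHessian t N x i j) x (EuclideanSpace.single i 1) := by
  filter_upwards [ae_norm_ne (n := n) 0, ae_norm_ne (n := n) (1 / N), ae_norm_ne (n := n) (1 - t),
    ae_norm_ne (n := n) 1] with x h0 h1 h2 h3
  have hx0 : x ≠ 0 := norm_ne_zero_iff.1 h0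
  have hr : 0 < ‖x‖ := norm_pos_iff.2 hx0
  have hfun : (fun x => fderiv ℝ (fun x : E n => profile t N ‖x‖) x (EuclideanSpace.single j 1)) =
      fun x : E n => slope t N ‖x‖ * x j := by
    ext w
    rw [(hasFDerivAt_profile_norm ht ht1 hN w).fderiv]
    simp [EuclideanSpace.inner_single_right]
  rw [hfun]
  have e1 := (hasDerivAt_slope ht ht1 hN hr h1 h2 h3).comp_hasFDerivAt x
    (hasFDerivAt_norm_of_ne_zero hx0)
  have e2 : HasFDerivAt (fun x : E n => x j) (EuclideanSpace.proj j : E n →L[ℝ] ℝ) x :=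
    (EuclideanSpace.proj j : E n →L[ℝ] ℝ).hasFDerivAt
  have e3 := (e1.mul e2).hasLineDerivAt (EuclideanSpace.single i (1 : ℝ))
  refine (congrArg (fun a => HasLineDerivAt ℝ (fun x : E n => slope t N ‖x‖ * x j) a x
    (EuclideanSpace.single i 1)) ?_).mp e3
  simp only [radialHessian, Matrix.of_apply, add_apply, smul_apply, smul_eq_mul,
    innerSL_apply_apply, EuclideanSpace.inner_single_right, Function.comp_apply]
  have e4 : (EuclideanSpace.proj j : E n →L[ℝ] ℝ) (EuclideanSpace.single i 1) =
      if i = j then 1 else 0 := by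
    simp [eq_comm]
  rw [e4]
  simp
  field_simp

end potential

end NonlocalABP
namespace NonlocalABP

/-! ### Size of the potential and of its fractional Laplacian -/

section estimates

variable {t : ℝ}

/-- The left side is `φ'(r)`, and the exponent is `1 - 1/t`. The constant does not depend on `N`; on
the outer annulus the power of `r` is at least `1` and can be inserted freely. -/
theorem exists_mul_slope_le (ht : 1 / 2 < t) (ht1 : t < 1) :
    ∃ C, 0 < C ∧ ∀ N : ℕ, 1 < (1 - t) * N → ∀ r, 0 < r →
      r * slope t N r ≤ C * logN t N * r ^ ((2 * t - 1) / t - 1) := by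
  have ht0 : 0 < t := by linarith
  have h1t : 0 < 1 - t := by linarith
  refine ⟨1 / t + 1 / (t ^ 2 * (1 - t) ^ ((1 - t) / t)), by positivity, fun N hN r hr => ?_⟩
  have hN0 := natCast_pos_of_one_lt ht1 hN
  have hL := logN_pos hN
  have hpow : 0 ≤ r ^ ((2 * t - 1) / t - 1) := by positivity
  have e1 : r ^ ((2 * t - 1) / t - 1) = r * r ^ (-1 / t) := by
    nth_rewrite 2 [← Real.rpow_one r]
    rw [← Real.rpow_add hr]
    congr 1
    field_simp
    ring
  have hc : 0 ≤ 1 / (t ^ 2 * (1 - t) ^ ((1 - t) / t)) * logN t N := by positivity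
  have hc' : 0 ≤ 1 / t * logN t N := by positivity
  rw [add_mul, add_mul]
  unfold slope
  split_ifs with h1 h2 h3
  · rw [mul_zero]
    positivity
  · have h4 : 1 ≤ r ^ ((2 * t - 1) / t - 1) := by
      refine Real.one_le_rpow_of_pos_of_le_one_of_nonpos hr (by linarith) ?_
      rw [sub_nonpos, div_le_one ht0]
      linarith
    have h5 : r * slopeOuter t N r =
        1 / (t ^ 2 * (1 - t) ^ ((1 - t) / t)) * logN t N * (1 - r) := by
      unfold slopeOuter
      field_simp
    rw [h5]
    have h6 : 1 / (t ^ 2 * (1 - t) ^ ((1 - t) / t)) * logN t N * (1 - r) ≤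
        1 / (t ^ 2 * (1 - t) ^ ((1 - t) / t)) * logN t N * r ^ ((2 * t - 1) / t - 1) :=
      mul_le_mul_of_nonneg_left (by linarith) hc
    nlinarith
  · have h4 : Real.log (r * N) ≤ logN t N := by
      refine Real.log_le_log (by positivity) ?_
      gcongr
      exact (not_le.1 h2).le
    have h5 : r * slopeMiddle t N r ≤ 1 / t * logN t N * r ^ ((2 * t - 1) / t - 1) := by
      rw [e1, slopeMiddle]
      calc _ = 1 / t * Real.log (r * N) * (r * r ^ (-1 / t)) := by ring
        _ ≤ _ := by gcongr
    nlinarith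
  · rw [mul_zero]
    positivity

theorem rpow_sub_rpow_le {a r r' : ℝ} (ha : 0 ≤ a) (ha1 : a ≤ 1) (hr' : 0 ≤ r') (h : r' ≤ r) :
    r ^ a - r' ^ a ≤ (r - r') ^ a := by
  have h1 := NNReal.rpow_add_le_add_rpow ⟨r - r', sub_nonneg.2 h⟩ ⟨r', hr'⟩ ha ha1
  rw [← NNReal.coe_le_coe] at h1
  push_cast at h1
  change (r - r' + r') ^ a ≤ (r - r') ^ a + r' ^ a at h1
  rw [sub_add_cancel] at h1
  linarith

/-- The profile is Hölder continuous, with a constant proportional to `logN t N`. -/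
theorem exists_abs_profile_sub_le (ht : 1 / 2 < t) (ht1 : t < 1) :
    ∃ C, 0 < C ∧ ∀ N : ℕ, 1 < (1 - t) * N → ∀ r r', 0 ≤ r → 0 ≤ r' →
      |profile t N r - profile t N r'| ≤ C * logN t N * |r - r'| ^ ((2 * t - 1) / t) := by
  have ht0 : 0 < t := by linarith
  obtain ⟨C, hC, h⟩ := exists_mul_slope_le ht ht1
  set a := (2 * t - 1) / t with ha
  have ha0 : 0 < a := div_pos (by linarith) ht0
  have ha1 : a ≤ 1 := by
    rw [ha, div_le_one ht0]
    linarith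
  refine ⟨C / a, by positivity, fun N hN => ?_⟩
  have hL := logN_pos hN
  have key : ∀ r r', 0 ≤ r' → r' ≤ r →
      |profile t N r - profile t N r'| ≤ C / a * logN t N * |r - r'| ^ a := by
    intro r r' hr' hrr'
    have hmono := monotoneOn_profile ht ht1 hN hr' (hr'.trans hrr') hrr'
    rw [abs_of_nonneg (sub_nonneg.2 hmono), abs_of_nonneg (sub_nonneg.2 hrr')]
    have hd : ∀ x, 0 < x → HasDerivAt (fun x => C / a * logN t N * x ^ a - profile t N x)
        (C * logN t N * x ^ (a - 1) - x * slope t N x) x := by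
      intro x hx
      refine ((((hasDerivAt_id x).rpow_const (p := a) (Or.inl hx.ne')).const_mul
        (C / a * logN t N)).fun_sub (hasDerivAt_profile ht ht1 hN x)).congr_deriv ?_
      simp only [id]
      field_simp
    -- The bound on `φ'` is integrated as monotonicity of a difference; subadditivity of `r ↦ r^a`
    -- for `0 ≤ a ≤ 1` then converts it into a Hölder estimate.
    have hm : MonotoneOn (fun x => C / a * logN t N * x ^ a - profile t N x) (Set.Ici 0) := by
      refine monotoneOn_of_deriv_nonneg (convex_Ici 0) ?_ ?_ ?_
      · refine ContinuousOn.sub ?_ fun x _ =>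
          (hasDerivAt_profile ht ht1 hN x).continuousAt.continuousWithinAt
        exact (continuous_const.mul (Real.continuous_rpow_const ha0.le)).continuousOn
      · intro x hx
        rw [interior_Ici] at hx
        exact (hd x hx).differentiableAt.differentiableWithinAt
      · intro x hx
        rw [interior_Ici] at hx
        rw [(hd x hx).deriv]
        linarith [h N hN x hx]
    have h1 := hm hr' (hr'.trans hrr') hrr'
    simp only at h1
    have h2 : C / a * logN t N * (r ^ a - r' ^ a) ≤ C / a * logN t N * (r - r') ^ a :=
      mul_le_mul_of_nonneg_left (rpow_sub_rpow_le ha0.le ha1 hr' hrr') (by positivity)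
    linarith
  intro r r' hr hr'
  rcases le_total r' r with h1 | h1
  · exact key r r' hr' h1
  · rw [abs_sub_comm, abs_sub_comm r]
    exact key r' r hr h1

theorem exists_abs_profile_norm_sub_add_le (ht : 1 / 2 < t) (ht1 : t < 1) :
    ∃ C, 0 < C ∧ ∀ N : ℕ, 1 < (1 - t) * N → ∀ (n : ℕ) (x y : E n),
      |profile t N ‖x‖ - profile t N ‖x + y‖| ≤
        C * logN t N * min 1 (‖y‖ ^ ((2 * t - 1) / t)) := by
  have ht0 : 0 < t := by linarith
  obtain ⟨C, hC, h⟩ := exists_abs_profile_sub_le ht ht1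
  refine ⟨C, hC, fun N hN n x y => ?_⟩
  have hL := logN_pos hN
  have ha0 : 0 < (2 * t - 1) / t := div_pos (by linarith) ht0
  rw [mul_min_of_nonneg _ _ (by positivity)]
  refine le_min ?_ ?_
  · have h1 := h N hN 0 1 le_rfl zero_le_one
    have h0 : profile t N 1 = 0 := if_pos le_rfl
    rw [h0, sub_zero, zero_sub, abs_neg, abs_one, Real.one_rpow] at h1
    have hb : ∀ r, 0 ≤ r → profile t N 0 ≤ profile t N r ∧ profile t N r ≤ 0 := fun r hr =>
      ⟨monotoneOn_profile ht ht1 hN (Set.mem_Ici.2 le_rfl) hr hr, profile_nonpos ht ht1 hN hr⟩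
    have h2 := hb ‖x‖ (norm_nonneg x)
    have h3 := hb ‖x + y‖ (norm_nonneg _)
    refine le_trans ?_ h1
    rw [abs_of_nonpos (hb 0 le_rfl).2, abs_le]
    constructor <;> linarith
  · refine (h N hN _ _ (norm_nonneg _) (norm_nonneg _)).trans ?_
    gcongr
    refine (abs_norm_sub_norm_le _ _).trans ?_
    rw [sub_add_cancel_left, norm_neg]

/-- By monotonicity the value at `0` is at most the explicit value at the gluing radius `1 - t`. -/
theorem profile_zero_le (ht : 1 / 2 < t) (ht1 : t < 1) {N : ℕ} (hN : 1 < (1 - t) * N) :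
    profile t N 0 ≤ -(1 / (2 * (1 - t) ^ ((1 - t) / t)) * logN t N) := by
  have h1 := monotoneOn_profile ht ht1 hN (Set.mem_Ici.2 le_rfl)
    (show (0 : ℝ) ≤ 1 - t by linarith) (show (0 : ℝ) ≤ 1 - t by linarith)
  refine h1.trans (le_of_eq ?_)
  rw [profile, if_neg (by linarith), if_pos le_rfl, sub_sub_cancel]
  have ht0 : 0 < t := by linarith
  have h2 : 0 < (1 - t) ^ ((1 - t) / t) := Real.rpow_pos_of_pos (by linarith) _
  field_simp

/-! ### The example function -/

variable {n : ℕ} {s : ℝ}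

/-- Outside the unit ball the potential attains its maximum `0`, so the integrand has a sign. -/
theorem fracLap_profile_nonneg (ht : 1 / 2 < t) (ht1 : t < 1) (hs : 0 < s) (hs2 : s < 2) {N : ℕ}
    (hN : 1 < (1 - t) * N) {x : E n} (hx : 1 ≤ ‖x‖) :
    0 ≤ fracLap s (fun x : E n => profile t N ‖x‖) x := by
  refine mul_nonneg (normConst_pos hs hs2).le (integral_nonneg fun y => ?_)
  have h1 : profile t N ‖x‖ = 0 := if_pos hx
  have h2 := profile_nonpos ht ht1 hN (norm_nonneg (x + y))
  simp only [fracLapIntegrand, h1, Pi.zero_apply]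
  exact div_nonneg (by linarith) (by positivity)

theorem fracLap_radial {φ : ℝ → ℝ} {x y : E n} (h : ‖x‖ = ‖y‖) :
    fracLap s (fun x : E n => φ ‖x‖) x = fracLap s (fun x : E n => φ ‖x‖) y := by
  obtain ⟨T, rfl⟩ := exists_linearIsometryEquiv_of_norm_eq h
  unfold fracLap
  congr 1
  rw [← T.measurePreserving.integral_comp T.toHomeomorph.measurableEmbedding
    (fracLapIntegrand s (fun x : E n => φ ‖x‖) (T x))]
  refine integral_congr_ae (ae_of_all _ fun z => ?_)
  simp only [fracLapIntegrand]
  rw [← map_add, T.norm_map, T.norm_map, T.norm_map]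

variable [NeZero n]

/-- Hypothesis `hst` says that the Hölder exponent of the profile exceeds the order `s`, so the
integral converges with a bound proportional to the Hölder constant. -/
theorem exists_abs_fracLap_profile_le (ht : 1 / 2 < t) (ht1 : t < 1) (hs : 0 < s) (hs1 : s < 1)
    (hst : s < (2 * t - 1) / t) :
    ∃ C, 0 < C ∧ ∀ N : ℕ, 1 < (1 - t) * N → ∀ x : E n,
      |fracLap s (fun x : E n => profile t N ‖x‖) x| ≤ C * logN t N := by
  obtain ⟨C, hC, h⟩ := exists_abs_profile_norm_sub_add_le ht ht1
  set I := ∫ y : E n, min 1 (‖y‖ ^ ((2 * t - 1) / t)) / ‖y‖ ^ ((n : ℝ) + s) with hI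
  have hI0 : 0 ≤ I := integral_nonneg fun y => by positivity
  have hc := normConst_pos (n := n) hs (by linarith)
  refine ⟨normConst n s * (C * (I + 1)), by positivity, fun N hN x => ?_⟩
  have hL := logN_pos hN
  refine (abs_fracLap_le hs hs1 hst (h N hN n x)).trans ?_
  rw [← hI]
  have h1 : 0 ≤ normConst n s * (C * logN t N) := by positivity
  nlinarith

/-- The origin is a minimum of the potential, so the integrand is nonpositive there and may be
discarded off any chosen set. The ball of radius `1/2` about a point of norm `3/2` lies in `1 ≤ ‖y‖
≤ 2`, where the potential vanishes and the kernel is bounded below. -/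
theorem exists_fracLap_profile_zero_le (ht : 1 / 2 < t) (ht1 : t < 1) (hs : 0 < s) (hs1 : s < 1) :
    ∃ c, 0 < c ∧ ∀ N : ℕ, 1 < (1 - t) * N →
      fracLap s (fun x : E n => profile t N ‖x‖) 0 ≤ -(c * logN t N) := by
  have h1t : 0 < 1 - t := by linarith
  have ht0 : 0 < t := by linarith
  set b := 1 / (2 * (1 - t) ^ ((1 - t) / t)) with hb
  have hb0 : 0 < b := by positivity
  have hc := normConst_pos (n := n) hs (by linarith)
  obtain ⟨w, hw⟩ : ∃ w : E n, ‖w‖ = 3 / 2 :=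
    ⟨EuclideanSpace.single 0 (3 / 2), by rw [PiLp.norm_single]; norm_num⟩
  set m := volume.real (Metric.ball w (1 / 2)) with hm
  have hm0 : 0 < m := ENNReal.toReal_pos (Metric.measure_ball_pos _ _ (by norm_num)).ne'
    measure_ball_lt_top.ne
  refine ⟨normConst n s * (b / 2 ^ ((n : ℝ) + s) * m), by positivity, fun N hN => ?_⟩
  have hL := logN_pos hN
  obtain ⟨K, hK⟩ := exists_isC11Bump_profile (n := n) ht ht1 hN
  have hint := hK.integrable_fracLapIntegrand hs hs1 0
  have h0 := profile_zero_le ht ht1 hN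
  rw [← hb] at h0
  have key : ∫ y, fracLapIntegrand s (fun x : E n => profile t N ‖x‖) 0 y ≤
      ∫ y, (Metric.ball w (1 / 2)).indicator (fun _ => -(b * logN t N / 2 ^ ((n : ℝ) + s))) y := by
    refine integral_mono hint ((integrable_indicator_iff measurableSet_ball).2
      (integrableOn_const measure_ball_lt_top.ne)) fun y => ?_
    simp only [fracLapIntegrand, norm_zero, zero_add]
    have hmono := monotoneOn_profile ht ht1 hN (Set.mem_Ici.2 le_rfl) (norm_nonneg y) (norm_nonneg y)
    by_cases hy : y ∈ Metric.ball w (1 / 2)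
    · rw [Set.indicator_of_mem hy]
      rw [mem_ball_iff_norm] at hy
      have h2 := norm_sub_norm_le y w
      have h3 := norm_sub_norm_le w y
      rw [norm_sub_rev w y] at h3
      have h4 : 1 ≤ ‖y‖ := by linarith
      have h5 : ‖y‖ ≤ 2 := by linarith
      rw [show profile t N ‖y‖ = 0 from if_pos h4, sub_zero, ← neg_div]
      rw [div_le_div_iff₀ (by positivity) (by positivity)]
      have h6 : ‖y‖ ^ ((n : ℝ) + s) ≤ 2 ^ ((n : ℝ) + s) := by gcongr
      have h7 : 0 ≤ ‖y‖ ^ ((n : ℝ) + s) := by positivity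
      have h8 : 0 < b * logN t N := by positivity
      nlinarith
    · rw [Set.indicator_of_notMem hy]
      exact div_nonpos_of_nonpos_of_nonneg (by linarith) (by positivity)
  rw [integral_indicator measurableSet_ball, setIntegral_const, ← hm, smul_eq_mul] at key
  unfold fracLap
  calc _ ≤ normConst n s * (m * -(b * logN t N / 2 ^ ((n : ℝ) + s))) := by gcongr
    _ = _ := by ring

theorem exists_le_infDrop_fracLap_profile (ht : 1 / 2 < t) (ht1 : t < 1) (hs : 0 < s) (hs1 : s < 1)
    (hst : s < (2 * t - 1) / t) :
    ∃ c, 0 < c ∧ ∀ N : ℕ, 1 < (1 - t) * N →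
      c * logN t N ≤ infDrop (fracLap s fun x : E n => profile t N ‖x‖) := by
  obtain ⟨c, hc, h⟩ := exists_fracLap_profile_zero_le (n := n) ht ht1 hs hs1
  obtain ⟨C, hC, hb⟩ := exists_abs_fracLap_profile_le (n := n) ht ht1 hs hs1 hst
  refine ⟨c, hc, fun N hN => ?_⟩
  have h1 : sInf ((fracLap s fun x : E n => profile t N ‖x‖) '' Metric.ball 0 1) ≤
      fracLap s (fun x : E n => profile t N ‖x‖) 0 := by
    refine csInf_le ⟨-(C * logN t N), ?_⟩ (Set.mem_image_of_mem _ (Metric.mem_ball_self one_pos))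
    rintro _ ⟨x, _, rfl⟩
    exact (abs_le.1 (hb N hN x)).1
  have h2 : 0 ≤ sInf ((fracLap s fun x : E n => profile t N ‖x‖) '' (Metric.ball 0 1)ᶜ) := by
    refine Real.sInf_nonneg ?_
    rintro _ ⟨x, hx, rfl⟩
    rw [Set.mem_compl_iff, mem_ball_zero_iff, not_lt] at hx
    exact fracLap_profile_nonneg ht ht1 hs (by linarith) hN hx
  have h3 := h N hN
  unfold infDrop
  linarith

theorem exists_linftyNorm_fracLap_profile_le (ht : 1 / 2 < t) (ht1 : t < 1) (hs : 0 < s)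
    (hs1 : s < 1) (hst : s < (2 * t - 1) / t) :
    ∃ C, 0 < C ∧ ∀ N : ℕ, 1 < (1 - t) * N →
      linftyNorm (fracLap s fun x : E n => profile t N ‖x‖) ≤ C * logN t N := by
  obtain ⟨C, hC, hb⟩ := exists_abs_fracLap_profile_le (n := n) ht ht1 hs hs1 hst
  refine ⟨C, hC, fun N hN => ?_⟩
  have hL := logN_pos hN
  refine ENNReal.toReal_le_of_le_ofReal (by positivity) ?_
  rw [eLpNorm_exponent_top]
  exact eLpNormEssSup_le_of_ae_bound (ae_of_all _ (hb N hN))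

end estimates

/-! ### The exponents -/

section exponents

variable {n : ℕ} {σ : ℝ}

theorem one_lt_of_sqrt_lt (hn : n = 2 ∨ n = 3) (hσ : Real.sqrt (n : ℝ) < σ) : 1 < σ := by
  refine lt_of_le_of_lt ?_ hσ
  rw [Real.one_le_sqrt]
  rcases hn with rfl | rfl <;> norm_num

theorem lt_sq_of_sqrt_lt (hσ : Real.sqrt (n : ℝ) < σ) : (n : ℝ) < σ ^ 2 :=
  Real.lt_sq_of_sqrt_lt hσ

theorem natCast_bounds (hn : n = 2 ∨ n = 3) : (2 : ℝ) ≤ n ∧ (n : ℝ) ≤ 3 := by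
  rcases hn with rfl | rfl <;> norm_num

/-- The claim amounts to `n < σ + 2`, hence the restriction to `n ≤ 3` with `σ > 1`. It makes the
exponent `(2τ-1)/τ` positive and places the radius `1-τ` below `1/2`. -/
theorem half_lt_tau (hn : n = 2 ∨ n = 3) (hσ : Real.sqrt (n : ℝ) < σ) : 1 / 2 < tau n σ := by
  have h1 := one_lt_of_sqrt_lt hn hσ
  have h2 := natCast_bounds hn
  rw [tau, div_lt_div_iff₀ (by norm_num) (by linarith)]
  linarith

theorem tau_lt_one (hn : n = 2 ∨ n = 3) (hσ : Real.sqrt (n : ℝ) < σ) : tau n σ < 1 := by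
  have h1 := one_lt_of_sqrt_lt hn hσ
  have h2 := natCast_bounds hn
  rw [tau, div_lt_one (by linarith)]
  linarith

theorem pZero_eq : pZero n σ = n * tau n σ := by
  unfold pZero tau
  rw [mul_div_assoc, add_comm (n : ℝ) σ]

/-- Cross-multiplication reduces this to `n < σ²`. -/
theorem div_lt_pZero (hn : n = 2 ∨ n = 3) (hσ : Real.sqrt (n : ℝ) < σ) :
    (n : ℝ) / σ < pZero n σ := by
  have h1 := one_lt_of_sqrt_lt hn hσ
  have h2 := natCast_bounds hn
  have h3 := lt_sq_of_sqrt_lt hσ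
  rw [pZero, div_lt_div_iff₀ (by linarith) (by linarith)]
  nlinarith

theorem one_lt_pZero (hn : n = 2 ∨ n = 3) (hσ : Real.sqrt (n : ℝ) < σ) : 1 < pZero n σ := by
  have h1 := one_lt_of_sqrt_lt hn hσ
  have h2 := natCast_bounds hn
  rw [pZero, one_lt_div (by linarith)]
  nlinarith

/-- The right side is `2 - 1/τ`, so the claim is `στ > 1`, which is again `n < σ²`. This is the
condition under which `u_N` is bounded by a multiple of `logN`. -/
theorem two_sub_lt (hn : n = 2 ∨ n = 3) (hσ : Real.sqrt (n : ℝ) < σ) :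
    2 - σ < (2 * tau n σ - 1) / tau n σ := by
  have h1 := one_lt_of_sqrt_lt hn hσ
  have h2 := natCast_bounds hn
  have h3 := lt_sq_of_sqrt_lt hσ
  have h4 := half_lt_tau hn hσ
  rw [lt_div_iff₀ (by linarith), sub_mul]
  have h5 : 1 < σ * tau n σ := by
    rw [tau, ← mul_div_assoc, one_lt_div (by linarith)]
    nlinarith
  linarith

end exponents

end NonlocalABP
namespace NonlocalABP

/-! ### Symmetric matrices in the elliptic class -/

section matrices

variable {n : ℕ}

open Matrix in
theorem quadForm_pair_nonneg {A : Matrix (Fin n) (Fin n) ℝ} (hA : A.PosSemidef) (i j : Fin n)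
    (a b : ℝ) : 0 ≤ a ^ 2 * A i i + 2 * (a * b) * A i j + b ^ 2 * A j j := by
  have h := hA.dotProduct_mulVec_nonneg (Pi.single i a + Pi.single j b)
  have hs : A j i = A i j := by
    have := hA.1.apply i j
    simpa using this
  simp only [star_trivial, mulVec_add, add_dotProduct, dotProduct_add, single_dotProduct,
    mulVec_single, op_smul_eq_smul, Pi.smul_apply, col_apply, smul_eq_mul, hs] at h
  linarith

theorem abs_apply_le_trace {A : Matrix (Fin n) (Fin n) ℝ} (hA : A.PosSemidef) (i j : Fin n) :
    |A i j| ≤ A.trace := by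
  have h1 := quadForm_pair_nonneg hA i j 1 1
  have h2 := quadForm_pair_nonneg hA i j 1 (-1)
  have hd : ∀ k, A k k ≤ A.trace := fun k =>
    Finset.single_le_sum (f := fun k => A k k) (fun k _ => hA.diag_nonneg) (Finset.mem_univ k)
  have h3 := hd i
  have h4 := hd j
  rw [abs_le]
  constructor <;> linarith

theorem sum_sq_eq_norm_sq (x : E n) : ∑ i, x i ^ 2 = ‖x‖ ^ 2 := by
  rw [EuclideanSpace.norm_sq_eq]
  simp

/-- The quadratic form of a matrix. -/
def quadForm (A : Matrix (Fin n) (Fin n) ℝ) (x : E n) : ℝ := ∑ i, ∑ j, A i j * (x i * x j)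

theorem quadForm_nonneg {A : Matrix (Fin n) (Fin n) ℝ} (hA : A.PosSemidef) (x : E n) :
    0 ≤ quadForm A x := by
  have h := hA.dotProduct_mulVec_nonneg (WithLp.ofLp x)
  refine h.trans (le_of_eq ?_)
  simp only [quadForm, dotProduct, Matrix.mulVec, star_trivial, Finset.mul_sum]
  refine Finset.sum_congr rfl fun i _ => Finset.sum_congr rfl fun j _ => ?_
  ring

/-- Summing the two-by-two forms of `A` over all pairs `(i,j)` at the vectors `(x_j, -x_i)` gives
`2(tr A)|x|² - 2⟨Ax,x⟩ ≥ 0`, with no recourse to eigenvalues. -/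
theorem quadForm_le_trace {A : Matrix (Fin n) (Fin n) ℝ} (hA : A.PosSemidef) (x : E n) :
    quadForm A x ≤ A.trace * ‖x‖ ^ 2 := by
  have h : 0 ≤ ∑ i, ∑ j, (x j ^ 2 * A i i + 2 * (x j * -x i) * A i j + (-x i) ^ 2 * A j j) :=
    Finset.sum_nonneg fun i _ => Finset.sum_nonneg fun j _ => quadForm_pair_nonneg hA i j _ _
  have e1 : ∑ i, ∑ j, x j ^ 2 * A i i = A.trace * ‖x‖ ^ 2 := by
    rw [← sum_sq_eq_norm_sq, Matrix.trace, Finset.sum_mul_sum]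
    simp [mul_comm]
  have e2 : ∑ i, ∑ j, (-x i) ^ 2 * A j j = A.trace * ‖x‖ ^ 2 := by
    rw [Finset.sum_comm, ← e1]
    simp
  have e3 : ∑ i, ∑ j, 2 * (x j * -x i) * A i j = -2 * quadForm A x := by
    simp only [quadForm, Finset.mul_sum]
    refine Finset.sum_congr rfl fun i _ => Finset.sum_congr rfl fun j _ => ?_
    ring
  simp only [Finset.sum_add_distrib, e1, e2, e3] at h
  linarith

theorem quadForm_one (x : E n) : quadForm (1 : Matrix (Fin n) (Fin n) ℝ) x = ‖x‖ ^ 2 := by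
  rw [← sum_sq_eq_norm_sq]
  simp [quadForm, Matrix.one_apply, pow_two]

theorem quadForm_smul (c : ℝ) (B : Matrix (Fin n) (Fin n) ℝ) (x : E n) :
    quadForm (c • B) x = c * quadForm B x := by
  simp only [quadForm, Matrix.smul_apply, smul_eq_mul, Finset.mul_sum, mul_assoc]

theorem quadForm_add (A B : Matrix (Fin n) (Fin n) ℝ) (x : E n) :
    quadForm (A + B) x = quadForm A x + quadForm B x := by
  simp only [quadForm, Matrix.add_apply, add_mul, Finset.sum_add_distrib]

theorem quadForm_weighted (s : ℝ) (A : Matrix (Fin n) (Fin n) ℝ) (x : E n) :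
    quadForm (weighted s A) x = (s * quadForm A x + A.trace * ‖x‖ ^ 2) / (n + s) := by
  rw [weighted, quadForm_smul, quadForm_add, quadForm_smul, quadForm_smul, quadForm_one]
  ring

theorem quadForm_sub_smul_one (B : Matrix (Fin n) (Fin n) ℝ) (c : ℝ) (x : E n) :
    quadForm (B - c • (1 : Matrix (Fin n) (Fin n) ℝ)) x = quadForm B x - c * ‖x‖ ^ 2 := by
  rw [sub_eq_add_neg, ← neg_smul, quadForm_add, quadForm_smul, quadForm_one]
  ring

variable {s lam Lam : ℝ} {A : Matrix (Fin n) (Fin n) ℝ}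

/-- The weighting preserves the trace, so the trace of the upper matrix bound is enough. -/
theorem trace_le_of_mem_ellipticSet [NeZero n] (hs : 0 < s) (hA : A ∈ ellipticSet n s lam Lam) :
    A.trace ≤ n * Lam := by
  have h := hA.2.2.trace_nonneg
  have hn : (0 : ℝ) < n + s := by positivity
  have e : (weighted s A).trace = A.trace := by
    simp only [weighted, Matrix.trace_smul, Matrix.trace_add, Matrix.trace_one, Fintype.card_fin,
      smul_eq_mul]
    field_simp
    ring
  rw [Matrix.trace_sub, e, Matrix.trace_smul, Matrix.trace_one, Fintype.card_fin, smul_eq_mul] at h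
  linarith

theorem le_of_mem_ellipticSet [NeZero n] (hs : 0 < s) (hA : A ∈ ellipticSet n s lam Lam)
    (x : E n) : (n + s) * lam * ‖x‖ ^ 2 ≤ s * quadForm A x + A.trace * ‖x‖ ^ 2 := by
  have h := quadForm_nonneg hA.2.1 x
  have hn : (0 : ℝ) < n + s := by positivity
  rw [quadForm_sub_smul_one, quadForm_weighted, sub_nonneg, le_div_iff₀ hn] at h
  linarith

/-- The matrix `(n + s) λ x xᵀ`. -/
def radialMatrix (s lam : ℝ) (x : E n) : Matrix (Fin n) (Fin n) ℝ :=
  ((n + s) * lam) • Matrix.vecMulVec (WithLp.ofLp x) (WithLp.ofLp x)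

/-- The weighted matrix has eigenvalue `λ` orthogonally to `x` and `(1+s)λ` along `x`. The lower
constraint is thus saturated, and the upper one is exactly `hLam`. -/
theorem radialMatrix_mem_ellipticSet [NeZero n] (hs : 0 < s) (hlam : 0 < lam)
    (hLam : (1 + s) * lam ≤ Lam) {x : E n} (hx : ‖x‖ = 1) :
    radialMatrix s lam x ∈ ellipticSet n s lam Lam := by
  have hn : (0 : ℝ) < n + s := by positivity
  have hp : (Matrix.vecMulVec (WithLp.ofLp x) (WithLp.ofLp x)).PosSemidef := by
    simpa using Matrix.posSemidef_vecMulVec_self_star (WithLp.ofLp x)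
  have htr : (Matrix.vecMulVec (WithLp.ofLp x) (WithLp.ofLp x)).trace = 1 := by
    rw [← one_pow 2, ← hx, ← sum_sq_eq_norm_sq]
    simp [Matrix.trace, Matrix.vecMulVec_apply, pow_two]
  have hw : weighted s (radialMatrix s lam x) =
      lam • (1 : Matrix (Fin n) (Fin n) ℝ) +
        (s * lam) • Matrix.vecMulVec (WithLp.ofLp x) (WithLp.ofLp x) := by
    rw [weighted, radialMatrix, Matrix.trace_smul, htr]
    ext i j
    simp only [Matrix.smul_apply, Matrix.add_apply, smul_eq_mul]
    field_simp
    ring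
  refine ⟨hp.smul (by positivity), ?_, ?_⟩
  · rw [hw, add_sub_cancel_left]
    exact hp.smul (by positivity)
  · have hI : ((1 : Matrix (Fin n) (Fin n) ℝ) -
        Matrix.vecMulVec (WithLp.ofLp x) (WithLp.ofLp x)).PosSemidef := by
      refine Matrix.PosSemidef.of_dotProduct_mulVec_nonneg (Matrix.isHermitian_one.sub hp.1)
        fun v => ?_
      have h1 := Finset.sum_mul_sq_le_sq_mul_sq Finset.univ v (WithLp.ofLp x)
      rw [sum_sq_eq_norm_sq x, hx] at h1
      simp only [Matrix.sub_mulVec, Matrix.one_mulVec, Matrix.vecMulVec_mulVec, star_trivial,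
        dotProduct_sub, op_smul_eq_smul, dotProduct_smul, smul_eq_mul]
      simp only [dotProduct, ← pow_two]
      simp only [mul_comm (x.ofLp _)]
      nlinarith
    have e : Lam • (1 : Matrix (Fin n) (Fin n) ℝ) - weighted s (radialMatrix s lam x) =
        (Lam - (1 + s) * lam) • (1 : Matrix (Fin n) (Fin n) ℝ) +
          (s * lam) • ((1 : Matrix (Fin n) (Fin n) ℝ) -
            Matrix.vecMulVec (WithLp.ofLp x) (WithLp.ofLp x)) := by
      rw [hw]
      module
    rw [e]
    exact (Matrix.PosSemidef.one.smul (by linarith)).add (hI.smul (by positivity))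

theorem ellipticSet_nonempty [NeZero n] (hs : 0 < s) (hlam : 0 < lam)
    (hLam : (1 + s) * lam ≤ Lam) : (ellipticSet n s lam Lam).Nonempty :=
  ⟨_, radialMatrix_mem_ellipticSet hs hlam hLam
    (x := EuclideanSpace.single 0 1) (by rw [PiLp.norm_single, norm_one])⟩

theorem isClosed_setOf_posSemidef : IsClosed {A : Matrix (Fin n) (Fin n) ℝ | A.PosSemidef} := by
  simp only [Matrix.posSemidef_iff_dotProduct_mulVec, Set.ofPred_and, Set.ofPred_forall]
  refine IsClosed.inter ?_ (isClosed_iInter fun x => ?_)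
  · exact isClosed_eq continuous_id.matrix_conjTranspose continuous_id
  · exact isClosed_le continuous_const
      (continuous_const.dotProduct (continuous_id.matrix_mulVec continuous_const))

theorem continuous_weighted (s : ℝ) :
    Continuous (weighted s : Matrix (Fin n) (Fin n) ℝ → Matrix (Fin n) (Fin n) ℝ) := by
  unfold weighted
  fun_prop

/-- The entries of a positive semidefinite matrix are bounded by its trace. Compactness provides
lower bounds for the infimum and makes it continuous in the Hessian, hence measurable in `x`. -/
theorem isCompact_ellipticSet [NeZero n] (hs : 0 < s) : IsCompact (ellipticSet n s lam Lam) := by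
  have hK : IsCompact (Set.pi Set.univ fun _ : Fin n => Set.pi Set.univ fun _ : Fin n =>
      Set.Icc (-(n * Lam)) (n * Lam)) :=
    isCompact_univ_pi fun _ => isCompact_univ_pi fun _ => isCompact_Icc
  refine hK.of_isClosed_subset ?_ ?_
  · refine (isClosed_setOf_posSemidef (n := n)).inter (IsClosed.inter ?_ ?_)
    · exact isClosed_setOf_posSemidef.preimage (f := fun A : Matrix (Fin n) (Fin n) ℝ => weighted s A - lam • 1)
        ((continuous_weighted s).sub continuous_const)
    · exact isClosed_setOf_posSemidef.preimage (f := fun A : Matrix (Fin n) (Fin n) ℝ => Lam • 1 - weighted s A)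
        (continuous_const.sub (continuous_weighted s))
  · intro A hA i _ j _
    have h := (abs_apply_le_trace hA.1 i j).trans (trace_le_of_mem_ellipticSet hs hA)
    exact abs_le.1 h

/-- The minimal Pucci operator as a function of the Hessian matrix. -/
noncomputable def pucciMatrix (n : ℕ) (s lam Lam : ℝ) (D : Matrix (Fin n) (Fin n) ℝ) : ℝ :=
  sInf ((fun A => (A * D).trace) '' ellipticSet n s lam Lam)

theorem continuous_pucciMatrix [NeZero n] (hs : 0 < s) :
    Continuous (pucciMatrix n s lam Lam) :=
  (isCompact_ellipticSet hs).continuous_sInf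
    (f := fun D A : Matrix (Fin n) (Fin n) ℝ => (A * D).trace)
    (continuous_snd.matrix_mul continuous_fst).matrix_trace

/-- For a radial Hessian, `G = φ'/r` and `W = φ'' - φ'/r`. The matrix `A` enters only through its
trace and its radial value, so the Pucci infimum becomes a problem in two numbers. -/
theorem trace_mul_radial (κ s G W : ℝ) {x : E n} (hx : x ≠ 0) {H : Matrix (Fin n) (Fin n) ℝ}
    (hH : ∀ i j, H i j = G * (if i = j then 1 else 0) + W / ‖x‖ ^ 2 * (x i * x j)) :
    (A * (κ • (H.trace • (1 : Matrix (Fin n) (Fin n) ℝ) + s • H))).trace =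
      κ * (G * (n + s) * A.trace + W * (A.trace + s * (quadForm A x / ‖x‖ ^ 2))) := by
  have hx2 : ‖x‖ ^ 2 ≠ 0 := by
    have := norm_pos_iff.2 hx
    positivity
  have e1 : H.trace = n * G + W := by
    simp only [Matrix.trace, Matrix.diag_apply, hH, Finset.sum_add_distrib, if_true, mul_one,
      Finset.sum_const, Finset.card_univ, Fintype.card_fin, nsmul_eq_mul, ← Finset.mul_sum,
      ← pow_two, sum_sq_eq_norm_sq]
    field_simp
  have e2 : (A * H).trace = G * A.trace + W * (quadForm A x / ‖x‖ ^ 2) := by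
    simp only [Matrix.trace, Matrix.diag_apply, Matrix.mul_apply, hH, mul_add,
      Finset.sum_add_distrib]
    congr 1
    · simp [Finset.mul_sum, mul_comm]
    · simp only [quadForm, Finset.mul_sum, Finset.sum_div]
      refine Finset.sum_congr rfl fun i _ => Finset.sum_congr rfl fun j _ => ?_
      field_simp
  rw [Matrix.mul_smul, Matrix.trace_smul, mul_add, Matrix.trace_add, Matrix.mul_smul,
    Matrix.mul_smul, Matrix.trace_smul, Matrix.trace_smul, e1, e2, mul_one]
  simp only [smul_eq_mul]
  ring

end matrices

end NonlocalABP
namespace NonlocalABP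

/-! ### The Pucci operator on the radial Hessian -/

section pucci

variable {n : ℕ} {t : ℝ} {N : ℕ} {κ σ lam Lam : ℝ}

/-- The fractional Hessian of the example in terms of the Hessian of the potential. -/
noncomputable def hessMatrix (κ σ t : ℝ) (N : ℕ) (x : E n) : Matrix (Fin n) (Fin n) ℝ :=
  κ • ((radialHessian t N x).trace • (1 : Matrix (Fin n) (Fin n) ℝ) + σ • radialHessian t N x)

/-- The function `|x| ^ (-1/t)` restricted to the annulus `a ≤ |x| < b`. -/
noncomputable def annulusPower (t a b : ℝ) (x : E n) : ℝ :=
  {x : E n | a ≤ ‖x‖ ∧ ‖x‖ < b}.indicator (fun x => ‖x‖ ^ (-1 / t)) x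

theorem annulusPower_nonneg (t a b : ℝ) (x : E n) : 0 ≤ annulusPower t a b x :=
  Set.indicator_nonneg (fun _ _ => by positivity) x

theorem trace_mul_hessMatrix (A : Matrix (Fin n) (Fin n) ℝ) {x : E n} (hx : x ≠ 0) :
    (A * hessMatrix κ σ t N x).trace = κ * (slope t N ‖x‖ * (n + σ) * A.trace +
      slopeDeriv t N ‖x‖ * (A.trace + σ * (quadForm A x / ‖x‖ ^ 2))) :=
  trace_mul_radial κ σ _ _ hx fun i j => by rw [radialHessian, Matrix.of_apply]

theorem quadForm_radialMatrix (s lam : ℝ) {x : E n} (hx : x ≠ 0) :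
    quadForm (radialMatrix s lam (‖x‖⁻¹ • x)) x / ‖x‖ ^ 2 = (n + s) * lam := by
  have h : ‖x‖ ≠ 0 := norm_ne_zero_iff.2 hx
  have e : quadForm (radialMatrix s lam (‖x‖⁻¹ • x)) x =
      (n + s) * lam * (‖x‖⁻¹ ^ 2 * (∑ i, x i ^ 2) * ∑ i, x i ^ 2) := by
    rw [radialMatrix, quadForm_smul, mul_assoc (‖x‖⁻¹ ^ 2), Finset.sum_mul_sum, Finset.mul_sum]
    congr 1
    simp only [quadForm, Finset.mul_sum]
    refine Finset.sum_congr rfl fun i _ => Finset.sum_congr rfl fun j _ => ?_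
    simp only [Matrix.vecMulVec_apply, PiLp.smul_apply, smul_eq_mul]
    ring
  rw [e, sum_sq_eq_norm_sq]
  field_simp

theorem trace_radialMatrix (s lam : ℝ) {x : E n} (hx : ‖x‖ = 1) :
    (radialMatrix s lam x).trace = (n + s) * lam := by
  have htr : (Matrix.vecMulVec (WithLp.ofLp x) (WithLp.ofLp x)).trace = 1 := by
    rw [← one_pow 2, ← hx, ← sum_sq_eq_norm_sq]
    simp [Matrix.trace, Matrix.vecMulVec_apply, pow_two]
  rw [radialMatrix, Matrix.trace_smul, htr, smul_eq_mul, mul_one]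

theorem norm_inv_smul_self {x : E n} (hx : x ≠ 0) : ‖‖x‖⁻¹ • x‖ = 1 := by
  rw [norm_smul, norm_inv, norm_norm, inv_mul_cancel₀ (norm_ne_zero_iff.2 hx)]

theorem abs_trace_le_sqrt_mul_matNorm (M : Matrix (Fin n) (Fin n) ℝ) :
    |M.trace| ≤ Real.sqrt n * matNorm M := by
  rw [matNorm, ← Real.sqrt_mul (Nat.cast_nonneg n)]
  refine Real.abs_le_sqrt ?_
  refine (sq_sum_le_card_mul_sum_sq (s := Finset.univ) (f := fun i => M i i)).trans ?_
  rw [Finset.card_univ, Fintype.card_fin]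
  gcongr with i _
  exact Finset.single_le_sum (f := fun j => M i j ^ 2) (fun j _ => sq_nonneg _) (Finset.mem_univ i)

/-- The trace of `hessMatrix` is `κ(n+σ)ΔP`, and on the middle annulus `ΔP = (n - 1/t)G +
r^{-1/t}/t`. Here `n - 1/t > 0` because `1/t < 2 ≤ n`, so the logarithm in `G` survives. For `r ≥
N^{-1/2}` that logarithm is at least `(log N)/2`, hence at least half of `logN t N`. -/
theorem exists_le_matNorm_hessMatrix (hn : 2 ≤ n) (hκ : 0 < κ) (hσ : 0 < σ) (ht : 1 / 2 < t)
    (ht1 : t < 1) :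
    ∃ c, 0 < c ∧ ∀ N : ℕ, 1 < (1 - t) * N → ∀ x : E n, x ≠ 0 →
      c * logN t N * annulusPower t (1 / Real.sqrt N) (1 - t) x ≤
        matNorm (hessMatrix κ σ t N x) := by
  have ht0 : 0 < t := by linarith
  have h1t : 0 < 1 - t := by linarith
  have hn2 : (2 : ℝ) ≤ n := by exact_mod_cast hn
  have hd : 0 < n - 1 / t := by
    have : 1 / t < 2 := by
      rw [div_lt_iff₀ ht0]
      linarith
    linarith
  have hsq : 0 < Real.sqrt n := Real.sqrt_pos.2 (by linarith)
  refine ⟨κ * (n + σ) * (n - 1 / t) / (2 * t) / Real.sqrt n, by positivity, fun N hN x hx => ?_⟩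
  have hL := logN_pos hN
  have hN0 := natCast_pos_of_one_lt ht1 hN
  have hN1 : (1 : ℝ) ≤ N := by nlinarith
  by_cases hmem : x ∈ {x : E n | 1 / Real.sqrt N ≤ ‖x‖ ∧ ‖x‖ < 1 - t}
  · rw [annulusPower, Set.indicator_of_mem hmem]
    have hr : 0 < ‖x‖ := norm_pos_iff.2 hx
    have hsN : 0 < Real.sqrt N := Real.sqrt_pos.2 hN0
    have hsN1 : 1 ≤ Real.sqrt N := Real.one_le_sqrt.2 hN1
    have hm : Real.sqrt N * Real.sqrt N = N := Real.mul_self_sqrt hN0.le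
    have h1 : 1 / (N : ℝ) ≤ ‖x‖ := by
      refine le_trans ?_ hmem.1
      refine one_div_le_one_div_of_le hsN ?_
      nlinarith
    have hG : slope t N ‖x‖ = ‖x‖ ^ (-1 / t) * Real.log (‖x‖ * N) / t := by
      rw [slope_of_mem_middle ht ht1 ⟨h1, hmem.2.le⟩, slopeMiddle]
    have hW : slopeDeriv t N ‖x‖ = ‖x‖ ^ (-1 / t) / t - slope t N ‖x‖ / t := by
      rw [slope_of_mem_middle ht ht1 ⟨h1, hmem.2.le⟩, slopeDeriv, if_neg (by linarith [hmem.2]),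
        if_neg (not_le.2 hmem.2), if_pos h1]
    have hlog : logN t N / 2 ≤ Real.log (‖x‖ * N) := by
      have h2 : Real.sqrt N ≤ ‖x‖ * N := by
        have h3 := hmem.1
        rw [div_le_iff₀ hsN] at h3
        nlinarith
      have h4 : Real.log (Real.sqrt N) ≤ Real.log (‖x‖ * N) := Real.log_le_log hsN h2
      rw [Real.log_sqrt hN0.le] at h4
      have h5 : logN t N ≤ Real.log N := Real.log_le_log (by linarith) (by nlinarith)
      linarith
    have htr : (hessMatrix κ σ t N x).trace = κ * (n + σ) *
        ((n - 1 / t) * slope t N ‖x‖ + ‖x‖ ^ (-1 / t) / t) := by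
      have h2 := trace_mul_hessMatrix (κ := κ) (σ := σ) (t := t) (N := N) 1 hx
      rw [one_mul, quadForm_one, Matrix.trace_one, Fintype.card_fin, hW] at h2
      rw [h2]
      field_simp
      ring
    have h6 : κ * (n + σ) * ((n - 1 / t) * (‖x‖ ^ (-1 / t) * (logN t N / 2) / t)) ≤
        |(hessMatrix κ σ t N x).trace| := by
      refine le_trans ?_ (le_abs_self _)
      rw [htr, hG]
      have h7 : 0 ≤ ‖x‖ ^ (-1 / t) / t := by positivity
      gcongr
      refine le_add_of_le_of_nonneg ?_ h7
      gcongr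
    have h8 := h6.trans (abs_trace_le_sqrt_mul_matNorm _)
    rw [← div_le_iff₀' hsq] at h8
    refine le_trans (le_of_eq ?_) h8
    ring
  · rw [annulusPower, Set.indicator_of_notMem hmem, mul_zero]
    exact Real.sqrt_nonneg _

variable [NeZero n]

theorem le_pucciMatrix (hσ : 0 < σ) (hlam : 0 < lam) (hLam : (1 + σ) * lam ≤ Lam)
    {D : Matrix (Fin n) (Fin n) ℝ} {m : ℝ}
    (h : ∀ A ∈ ellipticSet n σ lam Lam, m ≤ (A * D).trace) : m ≤ pucciMatrix n σ lam Lam D := by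
  refine le_csInf ((ellipticSet_nonempty hσ hlam hLam).image _) ?_
  rintro _ ⟨A, hA, rfl⟩
  exact h A hA

theorem pucciMatrix_le (hσ : 0 < σ) {D A : Matrix (Fin n) (Fin n) ℝ}
    (hA : A ∈ ellipticSet n σ lam Lam) : pucciMatrix n σ lam Lam D ≤ (A * D).trace := by
  refine csInf_le ?_ (Set.mem_image_of_mem _ hA)
  exact ((isCompact_ellipticSet hσ).image
    (continuous_id.matrix_mul continuous_const).matrix_trace).bddBelow

theorem pucciMatrix_hessMatrix_le (hσ : 0 < σ) (hlam : 0 < lam) (hLam : (1 + σ) * lam ≤ Lam)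
    {x : E n} (hx : x ≠ 0) : pucciMatrix n σ lam Lam (hessMatrix κ σ t N x) ≤
      κ * ((n + σ) * lam *
        ((n + σ) * slope t N ‖x‖ + (1 + σ) * slopeDeriv t N ‖x‖)) := by
  have h1 := norm_inv_smul_self hx
  refine (pucciMatrix_le hσ (radialMatrix_mem_ellipticSet hσ hlam hLam h1)).trans (le_of_eq ?_)
  rw [trace_mul_hessMatrix _ hx, quadForm_radialMatrix _ _ hx, trace_radialMatrix _ _ h1]
  ring

/-- With `T` the trace of `A` and `q` its radial value, the identity `htn` makes the trace equal, up
to `κ`, to `(σ/t)G(T-q) + (r^{-1/t}/t)(T+σq)`. The logarithmic term has coefficient `T - q ≥ 0`, so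
dropping it and using `T + σq ≥ (n+σ)λ` gives the lower bound. The radial matrix has `T = q`, which
removes the logarithm altogether and gives the upper bound. -/
theorem pucciMatrix_hessMatrix_middle (hκ : 0 < κ) (hσ : 0 < σ) (hlam : 0 < lam)
    (hLam : (1 + σ) * lam ≤ Lam) (ht : 1 / 2 < t) (ht1 : t < 1) (htn : (n + σ) * t = σ + 1)
    (hN : 1 < (1 - t) * N) {x : E n} (h1 : 1 / (N : ℝ) ≤ ‖x‖) (h2 : ‖x‖ < 1 - t) :
    κ * (n + σ) * lam / t * ‖x‖ ^ (-1 / t) ≤ pucciMatrix n σ lam Lam (hessMatrix κ σ t N x) ∧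
      pucciMatrix n σ lam Lam (hessMatrix κ σ t N x) ≤
        κ * (n + σ) * lam / t * (1 + σ) * ‖x‖ ^ (-1 / t) := by
  have hN0 := natCast_pos_of_one_lt ht1 hN
  have ht0 : 0 < t := by linarith
  have hr : 0 < ‖x‖ := lt_of_lt_of_le (by positivity) h1
  have hx : x ≠ 0 := norm_pos_iff.1 hr
  have hW : slopeDeriv t N ‖x‖ = ‖x‖ ^ (-1 / t) / t - slope t N ‖x‖ / t := by
    rw [slope_of_mem_middle ht ht1 ⟨h1, h2.le⟩, slopeDeriv, if_neg (by linarith),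
      if_neg (not_le.2 h2), if_pos h1]
  have hG := slope_nonneg ht ht1 hN ‖x‖
  have hns : (n : ℝ) + σ = (σ + 1) / t := by
    field_simp
    linarith
  constructor
  · refine le_pucciMatrix hσ hlam hLam fun A hA => ?_
    rw [trace_mul_hessMatrix _ hx, hW]
    set q := quadForm A x / ‖x‖ ^ 2 with hq
    have h3 : q ≤ A.trace := by
      rw [hq, div_le_iff₀ (by positivity)]
      exact quadForm_le_trace hA.1 x
    have h4 : (n + σ) * lam ≤ A.trace + σ * q := by
      have h5 := le_of_mem_ellipticSet hσ hA x
      have h6 : σ * quadForm A x + A.trace * ‖x‖ ^ 2 = (A.trace + σ * q) * ‖x‖ ^ 2 := by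
        rw [hq]
        field_simp
        ring
      rw [h6] at h5
      exact le_of_mul_le_mul_right h5 (by positivity)
    have h7 : slope t N ‖x‖ * (n + σ) * A.trace +
        (‖x‖ ^ (-1 / t) / t - slope t N ‖x‖ / t) * (A.trace + σ * q) =
        slope t N ‖x‖ * σ / t * (A.trace - q) + ‖x‖ ^ (-1 / t) / t * (A.trace + σ * q) := by
      rw [hns]
      field_simp
      ring
    rw [h7]
    have h8 : 0 ≤ slope t N ‖x‖ * σ / t * (A.trace - q) :=
      mul_nonneg (by positivity) (by linarith)
    have h9 : ‖x‖ ^ (-1 / t) / t * ((n + σ) * lam) ≤ ‖x‖ ^ (-1 / t) / t * (A.trace + σ * q) :=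
      mul_le_mul_of_nonneg_left h4 (by positivity)
    calc _ = κ * (‖x‖ ^ (-1 / t) / t * ((n + σ) * lam)) := by ring
      _ ≤ _ := by
        gcongr
        linarith
  · refine (pucciMatrix_hessMatrix_le hσ hlam hLam hx).trans (le_of_eq ?_)
    rw [hW, hns]
    field_simp
    ring

/-- Testing with the radial matrix produces the factor `(n+σ)(1-r) - (1+σ)`, nonpositive exactly
when `1 - r ≤ t`; this dictates the gluing radius `1 - t`. The positive part of the operator
therefore ignores the outer annulus. The lower bound only has to be linear in `logN`. -/
theorem pucciMatrix_hessMatrix_outer (hκ : 0 < κ) (hσ : 0 < σ) (hlam : 0 < lam)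
    (hLam : (1 + σ) * lam ≤ Lam) (ht : 1 / 2 < t) (ht1 : t < 1) (htn : (n + σ) * t = σ + 1)
    (hN : 1 < (1 - t) * N) {x : E n} (h1 : 1 - t ≤ ‖x‖) (h2 : ‖x‖ < 1) :
    -(κ * (1 / (t ^ 2 * (1 - t) ^ ((1 - t) / t)) / (1 - t) * ((1 + σ) * (n * Lam))) * logN t N) ≤
        pucciMatrix n σ lam Lam (hessMatrix κ σ t N x) ∧
      pucciMatrix n σ lam Lam (hessMatrix κ σ t N x) ≤ 0 := by
  have ht0 : 0 < t := by linarith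
  have h1t : 0 < 1 - t := by linarith
  have hr : 0 < ‖x‖ := h1t.trans_le h1
  have hx : x ≠ 0 := norm_pos_iff.1 hr
  have hL := logN_pos hN
  set b := 1 / (t ^ 2 * (1 - t) ^ ((1 - t) / t)) with hb
  have hb0 : 0 < b := by positivity
  have hW : slopeDeriv t N ‖x‖ = -(b * logN t N / ‖x‖) := by
    rw [slopeDeriv, if_neg (not_le.2 h2), if_pos h1, hb]
    ring
  have hG : slope t N ‖x‖ = b * logN t N * ((1 - ‖x‖) / ‖x‖) := by
    rw [slope_of_mem_outer ⟨h1, h2.le⟩, slopeOuter, hb]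
    ring
  have hG0 := slope_nonneg ht ht1 hN ‖x‖
  constructor
  · refine le_pucciMatrix hσ hlam hLam fun A hA => ?_
    rw [trace_mul_hessMatrix _ hx, hW]
    set q := quadForm A x / ‖x‖ ^ 2 with hq
    have h3 : q ≤ A.trace := by
      rw [hq, div_le_iff₀ (by positivity)]
      exact quadForm_le_trace hA.1 x
    have h4 : 0 ≤ q := div_nonneg (quadForm_nonneg hA.1 x) (by positivity)
    have h5 := trace_le_of_mem_ellipticSet hσ hA
    have h6 := hA.1.trace_nonneg
    have h7 : A.trace + σ * q ≤ (1 + σ) * (n * Lam) := by nlinarith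
    have h8 : b * logN t N / ‖x‖ * (A.trace + σ * q) ≤
        b * logN t N / (1 - t) * ((1 + σ) * (n * Lam)) := by
      gcongr
    have h9 : 0 ≤ slope t N ‖x‖ * (n + σ) * A.trace := by positivity
    calc _ = κ * -(b * logN t N / (1 - t) * ((1 + σ) * (n * Lam))) := by ring
      _ ≤ _ := by
        gcongr
        linarith
  · refine (pucciMatrix_hessMatrix_le hσ hlam hLam hx).trans ?_
    have h3 : (n + σ) * slope t N ‖x‖ + (1 + σ) * slopeDeriv t N ‖x‖ =
        b * logN t N / ‖x‖ * ((n + σ) * (1 - ‖x‖) - (1 + σ)) := by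
      rw [hW, hG]
      ring
    rw [h3]
    refine mul_nonpos_of_nonneg_of_nonpos hκ.le (mul_nonpos_of_nonneg_of_nonpos (by positivity)
      (mul_nonpos_of_nonneg_of_nonpos (by positivity) ?_))
    have h4 : (n + σ) * (1 - ‖x‖) ≤ (n + σ) * t :=
      mul_le_mul_of_nonneg_left (by linarith) (by positivity)
    linarith

theorem pucciMatrix_hessMatrix_of_eq_zero (hσ : 0 < σ) (hlam : 0 < lam)
    (hLam : (1 + σ) * lam ≤ Lam) {x : E n} (hx : x ≠ 0) (h1 : slope t N ‖x‖ = 0)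
    (h2 : slopeDeriv t N ‖x‖ = 0) : pucciMatrix n σ lam Lam (hessMatrix κ σ t N x) = 0 := by
  refine le_antisymm ((pucciMatrix_hessMatrix_le hσ hlam hLam hx).trans ?_)
    (le_pucciMatrix hσ hlam hLam fun A _ => ?_)
  · simp [h1, h2]
  · rw [trace_mul_hessMatrix _ hx, h1, h2]
    simp

theorem exists_pucciMatrix_hessMatrix_bounds (hκ : 0 < κ) (hσ : 0 < σ) (hlam : 0 < lam)
    (hLam : (1 + σ) * lam ≤ Lam) (ht : 1 / 2 < t) (ht1 : t < 1) (htn : (n + σ) * t = σ + 1) :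
    ∃ c C, 0 < c ∧ 0 < C ∧ ∀ N : ℕ, 1 < (1 - t) * N → ∀ x : E n, x ≠ 0 →
      c * annulusPower t (1 / N) (1 - t) x ≤
        max (pucciMatrix n σ lam Lam (hessMatrix κ σ t N x)) 0 ∧
      max (pucciMatrix n σ lam Lam (hessMatrix κ σ t N x)) 0 ≤
        C * annulusPower t (1 / N) (1 - t) x ∧
      |pucciMatrix n σ lam Lam (hessMatrix κ σ t N x)| ≤
        C * annulusPower t (1 / N) (1 - t) x + C * logN t N := by
  have ht0 : 0 < t := by linarith
  have h1t : 0 < 1 - t := by linarith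
  have hLam0 : 0 < Lam := lt_of_lt_of_le (by positivity) hLam
  have hn0 : (0 : ℝ) < n := Nat.cast_pos.2 (NeZero.pos n)
  set c := κ * (n + σ) * lam / t with hc
  have hc0 : 0 < c := by positivity
  set C := κ * (1 / (t ^ 2 * (1 - t) ^ ((1 - t) / t)) / (1 - t) * ((1 + σ) * (n * Lam))) with hC
  have hC0 : 0 < C := by positivity
  refine ⟨c, c * (1 + σ) + C, hc0, by positivity, fun N hN x hx => ?_⟩
  have hL := logN_pos hN
  have hCL : 0 ≤ C * logN t N := by positivity
  have hcL : 0 ≤ c * (1 + σ) * logN t N := by positivity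
  have hlt := one_div_lt_one_sub ht1 hN
  by_cases hmem : x ∈ {x : E n | 1 / (N : ℝ) ≤ ‖x‖ ∧ ‖x‖ < 1 - t}
  · obtain ⟨h1, h2⟩ := pucciMatrix_hessMatrix_middle hκ hσ hlam hLam ht ht1 htn hN hmem.1 hmem.2
    rw [annulusPower, Set.indicator_of_mem hmem, max_eq_left (le_trans (by positivity) h1),
      abs_of_nonneg (le_trans (by positivity) h1)]
    have h3 : 0 ≤ C * ‖x‖ ^ (-1 / t) := by positivity
    refine ⟨h1, ?_, ?_⟩ <;> rw [add_mul] <;> linarith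
  · rw [annulusPower, Set.indicator_of_notMem hmem, mul_zero, mul_zero, zero_add]
    have hcase : -(C * logN t N) ≤ pucciMatrix n σ lam Lam (hessMatrix κ σ t N x) ∧
        pucciMatrix n σ lam Lam (hessMatrix κ σ t N x) ≤ 0 := by
      rcases lt_or_ge ‖x‖ 1 with h1 | h1
      · rcases lt_or_ge ‖x‖ (1 - t) with h2 | h2
        · have h3 : ‖x‖ < 1 / N := by
            by_contra h
            exact hmem ⟨not_lt.1 h, h2⟩
          rw [pucciMatrix_hessMatrix_of_eq_zero hσ hlam hLam hx (slope_of_le ht ht1 hN h3.le)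
            (by rw [slopeDeriv, if_neg (not_le.2 h1), if_neg (not_le.2 h2), if_neg (not_le.2 h3)])]
          constructor <;> linarith
        · exact pucciMatrix_hessMatrix_outer hκ hσ hlam hLam ht ht1 htn hN h2 h1
      · rw [pucciMatrix_hessMatrix_of_eq_zero hσ hlam hLam hx (slope_of_one_le h1) (if_pos h1)]
        constructor <;> linarith
    rw [max_eq_right hcase.2, abs_of_nonpos hcase.2]
    refine ⟨le_rfl, le_rfl, ?_⟩
    rw [add_mul]
    linarith

end pucci

end NonlocalABP
namespace NonlocalABP

/-! ### Lebesgue norms on balls -/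

section norms

variable {n : ℕ} {p : ℝ} {Ω : Set (E n)} {f g : E n → ℝ}

theorem lpNormOn_nonneg (p : ℝ) (Ω : Set (E n)) (f : E n → ℝ) : 0 ≤ lpNormOn p Ω f :=
  ENNReal.toReal_nonneg

theorem lpNormOn_congr_ae (h : f =ᵐ[volume] g) : lpNormOn p Ω f = lpNormOn p Ω g := by
  rw [lpNormOn, lpNormOn, eLpNorm_congr_ae (ae_restrict_of_ae h)]

theorem lpNormOn_le_mul {c : ℝ} (hc : 0 ≤ c)
    (hg : MemLp g (ENNReal.ofReal p) (volume.restrict Ω)) (h : ∀ᵐ x, |f x| ≤ c * |g x|) :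
    lpNormOn p Ω f ≤ c * lpNormOn p Ω g := by
  have h1 := eLpNorm_le_mul_eLpNorm_of_ae_le_mul (μ := volume.restrict Ω) (f := f) (g := g)
    (ae_restrict_of_ae h) (ENNReal.ofReal p)
  have h2 := ENNReal.toReal_mono (ENNReal.mul_ne_top ENNReal.ofReal_ne_top hg.eLpNorm_ne_top) h1
  rwa [ENNReal.toReal_mul, ENNReal.toReal_ofReal hc] at h2

theorem mul_lpNormOn_le {c : ℝ} (hc : 0 < c)
    (hf : MemLp f (ENNReal.ofReal p) (volume.restrict Ω)) (h : ∀ᵐ x, c * |g x| ≤ |f x|) :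
    c * lpNormOn p Ω g ≤ lpNormOn p Ω f := by
  have h1 : lpNormOn p Ω g ≤ c⁻¹ * lpNormOn p Ω f := by
    refine lpNormOn_le_mul (by positivity) hf ?_
    filter_upwards [h] with x hx
    rwa [← div_eq_inv_mul, le_div_iff₀' hc]
  rwa [← div_eq_inv_mul, le_div_iff₀' hc] at h1

theorem lpNormOn_add_le (hp : 1 ≤ p) (hf : MemLp f (ENNReal.ofReal p) (volume.restrict Ω))
    (hg : MemLp g (ENNReal.ofReal p) (volume.restrict Ω)) :
    lpNormOn p Ω (f + g) ≤ lpNormOn p Ω f + lpNormOn p Ω g := by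
  rw [lpNormOn, lpNormOn, lpNormOn, ← ENNReal.toReal_add hf.eLpNorm_ne_top hg.eLpNorm_ne_top]
  exact ENNReal.toReal_mono (ENNReal.add_ne_top.2 ⟨hf.eLpNorm_ne_top, hg.eLpNorm_ne_top⟩)
    (eLpNorm_add_le hf.1 hg.1 (by rwa [ENNReal.one_le_ofReal]))

theorem memLp_ball_of_bound (r : ℝ) {B : ℝ} (q : ENNReal) (hf : AEStronglyMeasurable f)
    (hb : ∀ᵐ x, |f x| ≤ B) : MemLp f q (volume.restrict (Metric.ball (0 : E n) r)) :=
  haveI : IsFiniteMeasure (volume.restrict (Metric.ball (0 : E n) r)) :=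
    ⟨by rw [Measure.restrict_apply_univ]; exact measure_ball_lt_top⟩
  MemLp.of_bound hf.restrict B (ae_restrict_of_ae hb)

variable {t a b : ℝ}

theorem measurable_annulusPower (t a b : ℝ) : Measurable (annulusPower t a b : E n → ℝ) := by
  refine (measurable_norm.pow_const _).indicator ?_
  exact (measurableSet_le measurable_const measurable_norm).inter
    (measurableSet_lt measurable_norm measurable_const)

theorem annulusPower_le (ht : 0 < t) (ha : 0 < a) (x : E n) :
    annulusPower t a b x ≤ a ^ (-1 / t) := by
  refine Set.indicator_apply_le' (fun hx => ?_) fun _ => by positivity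
  exact Real.rpow_le_rpow_of_nonpos ha hx.1 (div_nonpos_of_nonpos_of_nonneg (by norm_num) ht.le)

theorem memLp_annulusPower (ht : 0 < t) (ha : 0 < a) (r : ℝ) (q : ENNReal) :
    MemLp (annulusPower t a b) q (volume.restrict (Metric.ball (0 : E n) r)) :=
  memLp_ball_of_bound r q (measurable_annulusPower t a b).aestronglyMeasurable
    (ae_of_all _ fun x => by
      rw [abs_of_nonneg (annulusPower_nonneg _ _ _ _)]
      exact annulusPower_le ht ha x)

/-- The power `nt` turns `r^{-1/t}` into `r^{-n}`, the borderline case in dimension `n`, so the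
radial integral is a logarithm. -/
theorem integral_annulusPower [NeZero n] (ht : 0 < t) (ha : 0 < a) (hab : a ≤ b) :
    ∫ x : E n, annulusPower t a b x ^ (n * t) =
      n * volume.real (Metric.ball (0 : E n) 1) * Real.log (b / a) := by
  have hn : 1 ≤ n := NeZero.one_le
  have h1 := integral_fun_norm_addHaar (volume : Measure (E n))
    (fun r : ℝ => (Set.Ico a b).indicator (fun r : ℝ => r ^ (-(n : ℝ))) r)
  have h2 : ∀ x : E n, annulusPower t a b x ^ (n * t) =
      (Set.Ico a b).indicator (fun r : ℝ => r ^ (-(n : ℝ))) ‖x‖ := by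
    intro x
    by_cases hx : ‖x‖ ∈ Set.Ico a b
    · have hx' : x ∈ {x : E n | a ≤ ‖x‖ ∧ ‖x‖ < b} := hx
      rw [Set.indicator_of_mem hx, annulusPower, Set.indicator_of_mem hx', ← Real.rpow_mul (norm_nonneg x)]
      congr 1
      field_simp
    · have hx' : x ∉ {x : E n | a ≤ ‖x‖ ∧ ‖x‖ < b} := hx
      rw [Set.indicator_of_notMem hx, annulusPower, Set.indicator_of_notMem hx', Real.zero_rpow]
      have : (0 : ℝ) < n := Nat.cast_pos.2 hn
      positivity
  simp only [h2]
  rw [h1, finrank_euclideanSpace, Fintype.card_fin]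
  have h3 : ∫ y in Set.Ioi (0 : ℝ), y ^ (n - 1) •
      (Set.Ico a b).indicator (fun r : ℝ => r ^ (-(n : ℝ))) y = Real.log (b / a) := by
    rw [← integral_inv_of_pos ha (ha.trans_le hab), intervalIntegral.integral_of_le hab,
      ← integral_Ico_eq_integral_Ioc, ← integral_indicator measurableSet_Ioi,
      ← integral_indicator measurableSet_Ico]
    refine integral_congr_ae (ae_of_all _ fun y => ?_)
    by_cases hy : y ∈ Set.Ico a b
    · have hy0 : 0 < y := ha.trans_le hy.1
      rw [Set.indicator_of_mem (Set.mem_Ioi.2 hy0), Set.indicator_of_mem hy,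
        Set.indicator_of_mem hy, smul_eq_mul, ← Real.rpow_natCast, ← Real.rpow_add hy0,
        Nat.cast_sub hn, ← Real.rpow_neg_one]
      congr 1
      push_cast
      ring
    · rw [Set.indicator_of_notMem hy, Set.indicator_apply]
      simp [Set.indicator_of_notMem hy]
  rw [h3]
  simp only [nsmul_eq_mul, smul_eq_mul]
  ring

theorem lpNormOn_annulusPower [NeZero n] (ht : 0 < t) (ha : 0 < a) (hab : a ≤ b) {r : ℝ}
    (hbr : b ≤ r) :
    lpNormOn (n * t) (Metric.ball 0 r) (annulusPower t a b : E n → ℝ) =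
      (n * volume.real (Metric.ball (0 : E n) 1) * Real.log (b / a)) ^ (1 / (n * t)) := by
  have hn : (0 : ℝ) < n := Nat.cast_pos.2 (NeZero.pos n)
  have hp : 0 < n * t := by positivity
  have hlog : 0 ≤ Real.log (b / a) := Real.log_nonneg (by rwa [one_le_div ha])
  rw [lpNormOn, (memLp_annulusPower ht ha r _).eLpNorm_eq_integral_rpow_norm
    (ENNReal.ofReal_pos.2 hp).ne' ENNReal.ofReal_ne_top, ENNReal.toReal_ofReal hp.le,
    ENNReal.toReal_ofReal (Real.rpow_nonneg (integral_nonneg fun _ => by positivity) _),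
    one_div, ← integral_annulusPower ht ha hab]
  congr 1
  rw [setIntegral_eq_integral_of_forall_compl_eq_zero]
  · refine integral_congr_ae (ae_of_all _ fun x => ?_)
    simp only [Real.norm_of_nonneg (annulusPower_nonneg t a b x)]
  · intro x hx
    rw [mem_ball_zero_iff] at hx
    rw [annulusPower, Set.indicator_of_notMem (fun h => hx (h.2.trans_le hbr)), norm_zero,
      Real.zero_rpow hp.ne']

end norms

/-! ### Measurability and boundedness of the fractional Hessian -/

section admissible

variable {n : ℕ} {t : ℝ} {N : ℕ} {κ σ lam Lam : ℝ}

theorem measurable_slope (t : ℝ) (N : ℕ) : Measurable (slope t N) := by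
  unfold slope slopeOuter slopeMiddle
  refine Measurable.ite measurableSet_Ici measurable_const
    (Measurable.ite measurableSet_Ici ?_ (Measurable.ite measurableSet_Ici ?_ measurable_const))
  · fun_prop
  · fun_prop

theorem measurable_slopeDeriv (t : ℝ) (N : ℕ) : Measurable (slopeDeriv t N) := by
  unfold slopeDeriv slopeMiddle
  refine Measurable.ite measurableSet_Ici measurable_const
    (Measurable.ite measurableSet_Ici ?_ (Measurable.ite measurableSet_Ici ?_ measurable_const))
  · fun_prop
  · fun_prop

theorem measurable_radialHessian (t : ℝ) (N : ℕ) (i j : Fin n) :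
    Measurable fun x : E n => radialHessian t N x i j := by
  have h1 : Measurable fun x : E n => slope t N ‖x‖ := (measurable_slope t N).comp measurable_norm
  have h2 : Measurable fun x : E n => slopeDeriv t N ‖x‖ :=
    (measurable_slopeDeriv t N).comp measurable_norm
  have h3 : ∀ i, Measurable fun x : E n => x i := fun i => by fun_prop
  simp only [radialHessian, Matrix.of_apply]
  exact (h1.mul_const _).add ((h2.div (measurable_norm.pow_const 2)).mul ((h3 i).mul (h3 j)))

theorem measurable_hessMatrix (κ σ t : ℝ) (N : ℕ) (i j : Fin n) :
    Measurable fun x : E n => hessMatrix κ σ t N x i j := by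
  simp only [hessMatrix, Matrix.smul_apply, Matrix.add_apply, smul_eq_mul, Matrix.trace,
    Matrix.diag_apply]
  exact (((Finset.measurable_sum _ fun k _ => measurable_radialHessian t N k k).mul_const _).add
    ((measurable_radialHessian t N i j).const_mul σ)).const_mul κ

/-- The bound depends on `N` and is used only for membership in `L^p`, never for rates. -/
theorem exists_abs_slopeDeriv_le (ht : 1 / 2 < t) (ht1 : t < 1) (hN : 1 < (1 - t) * N) :
    ∃ M, 0 ≤ M ∧ ∀ r, 0 ≤ r → |slopeDeriv t N r| ≤ M := by
  obtain ⟨M, hM0, hM⟩ := exists_abs_slope_le ht ht1 hN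
  have hN0 := natCast_pos_of_one_lt ht1 hN
  have ht0 : 0 < t := by linarith
  have h1t : 0 < 1 - t := by linarith
  have hL := logN_pos hN
  set c := logN t N / (t ^ 2 * (1 - t) ^ ((1 - t) / t)) with hc
  have hc0 : 0 < c := by positivity
  have hb : 0 ≤ (1 / (N : ℝ)) ^ (-1 / t) / t + M / t := by positivity
  have hb' : 0 ≤ c / (1 - t) := by positivity
  refine ⟨c / (1 - t) + ((1 / (N : ℝ)) ^ (-1 / t) / t + M / t), by positivity, fun r hr => ?_⟩
  unfold slopeDeriv
  split_ifs with h1 h2 h3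
  · rw [abs_zero]
    positivity
  · have hr0 : 0 < r := by linarith
    rw [abs_neg, abs_of_nonneg (by positivity)]
    have : c / r ≤ c / (1 - t) := by gcongr
    linarith
  · have hr0 : 0 < r := lt_of_lt_of_le (by positivity) h3
    have h4 := hM r hr
    rw [slope_of_mem_middle ht ht1 ⟨h3, (not_le.1 h2).le⟩] at h4
    have h5 : r ^ (-1 / t) ≤ (1 / (N : ℝ)) ^ (-1 / t) :=
      Real.rpow_le_rpow_of_nonpos (by positivity) h3
        (div_nonpos_of_nonpos_of_nonneg (by norm_num) ht0.le)
    refine (abs_sub _ _).trans ?_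
    rw [abs_of_nonneg (show 0 ≤ r ^ (-1 / t) / t by positivity), abs_div, abs_of_pos ht0]
    have h6 : r ^ (-1 / t) / t ≤ (1 / (N : ℝ)) ^ (-1 / t) / t := by gcongr
    have h7 : |slopeMiddle t N r| / t ≤ M / t := by gcongr
    linarith
  · rw [abs_zero]
    positivity

theorem exists_abs_radialHessian_le (ht : 1 / 2 < t) (ht1 : t < 1) (hN : 1 < (1 - t) * N) :
    ∃ M, 0 ≤ M ∧ ∀ (x : E n) i j, |radialHessian t N x i j| ≤ M := by
  obtain ⟨M1, hM1, h1⟩ := exists_abs_slope_le ht ht1 hN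
  obtain ⟨M2, hM2, h2⟩ := exists_abs_slopeDeriv_le ht ht1 hN
  refine ⟨M1 + M2, by positivity, fun x i j => ?_⟩
  rw [radialHessian, Matrix.of_apply]
  refine (abs_add_le _ _).trans (add_le_add ?_ ?_)
  · rw [abs_mul]
    have h3 : |(if i = j then 1 else 0 : ℝ)| ≤ 1 := by split_ifs <;> simp
    have h4 := h1 ‖x‖ (norm_nonneg x)
    nlinarith [abs_nonneg (slope t N ‖x‖)]
  · rcases eq_or_ne x 0 with rfl | hx
    · simpa using hM2
    have hr : 0 < ‖x‖ := norm_pos_iff.2 hx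
    have h3 : ∀ k, |x k| ≤ ‖x‖ := fun k => PiLp.norm_apply_le x k
    rw [abs_mul, abs_div, abs_of_nonneg (show 0 ≤ ‖x‖ ^ 2 by positivity), abs_mul]
    calc _ ≤ M2 / ‖x‖ ^ 2 * (‖x‖ * ‖x‖) := by
          gcongr
          · exact h2 _ hr.le
          · exact h3 i
          · exact h3 j
      _ = M2 := by
          field_simp

theorem exists_abs_hessMatrix_le (κ σ : ℝ) (ht : 1 / 2 < t) (ht1 : t < 1) (hN : 1 < (1 - t) * N) :
    ∃ M, ∀ (x : E n) i j, |hessMatrix κ σ t N x i j| ≤ M := by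
  obtain ⟨M, hM0, hM⟩ := exists_abs_radialHessian_le (n := n) ht ht1 hN
  refine ⟨|κ| * (n * M + |σ| * M), fun x i j => ?_⟩
  simp only [hessMatrix, Matrix.smul_apply, Matrix.add_apply, smul_eq_mul]
  rw [abs_mul]
  refine mul_le_mul_of_nonneg_left ((abs_add_le _ _).trans (add_le_add ?_ ?_)) (abs_nonneg κ)
  · have h1 : |(radialHessian t N x).trace| ≤ n * M := by
      refine (Finset.abs_sum_le_sum_abs _ _).trans ((Finset.sum_le_sum fun k _ => hM x k k).trans ?_)
      simp
    have h2 : |(1 : Matrix (Fin n) (Fin n) ℝ) i j| ≤ 1 := by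
      rw [Matrix.one_apply]
      split_ifs <;> simp
    rw [abs_mul]
    nlinarith [abs_nonneg ((radialHessian t N x).trace)]
  · rw [abs_mul]
    exact mul_le_mul_of_nonneg_left (hM x i j) (abs_nonneg σ)

theorem measurable_pucciMatrix_hessMatrix [NeZero n] (hσ : 0 < σ) :
    Measurable fun x : E n => pucciMatrix n σ lam Lam (hessMatrix κ σ t N x) :=
  (show Continuous fun M : Fin n → Fin n → ℝ => pucciMatrix n σ lam Lam (Matrix.of M) from
    continuous_pucciMatrix hσ).measurable.comp
      (measurable_pi_lambda _ fun i => measurable_pi_lambda _ fun j =>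
        measurable_hessMatrix κ σ t N i j)

theorem measurable_matNorm_hessMatrix :
    Measurable fun x : E n => matNorm (hessMatrix κ σ t N x) := by
  unfold matNorm
  exact (Finset.measurable_sum _ fun i _ => Finset.measurable_sum _ fun j _ =>
    (measurable_hessMatrix κ σ t N i j).pow_const 2).sqrt

end admissible

end NonlocalABP
namespace NonlocalABP

/-! ### The examples -/

section examples

variable {n : ℕ} {σ lam Lam : ℝ}

theorem neZero_of_dim (hn : n = 2 ∨ n = 3) : NeZero n := ⟨by rcases hn with rfl | rfl <;> norm_num⟩

theorem add_mul_tau [NeZero n] (hσ : 0 < σ) : (n + σ) * tau n σ = σ + 1 := by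
  have : (0 : ℝ) < σ + n := by positivity
  rw [tau, add_comm (n : ℝ), mul_div_cancel₀ _ this.ne']

theorem exists_integral_abs_mixedDiff_profile_le [NeZero n] {t : ℝ} {N : ℕ} (ht : 1 / 2 < t)
    (ht1 : t < 1) (hN : 1 < (1 - t) * N) :
    ∃ C, 0 ≤ C ∧ ∀ y z, ∫ x, |mixedDiff (fun x : E n => profile t N ‖x‖) x y z| ≤
      C * (min 1 (‖y‖ ^ (2 : ℝ)) * min 1 (‖z‖ ^ (1 : ℝ))) := by
  obtain ⟨K, hK⟩ := exists_isC11Bump_profile (n := n) ht ht1 hN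
  obtain ⟨M, hM, h⟩ := exists_abs_mixedDiff_profile_le (n := n) ht ht1 hN
  refine hK.exists_integral_abs_mixedDiff_le hM (fun r hr => ?_) h
  have hlt := one_div_lt_one_sub ht1 hN
  simp only [Finset.mem_insert, Finset.mem_singleton] at hr
  rcases hr with rfl | rfl | rfl <;> linarith

theorem exists_fracHessian_exampleFn_eq (hn : n = 2 ∨ n = 3) (hσ : Real.sqrt (n : ℝ) < σ)
    (hσ2 : σ < 2) :
    ∃ κ, 0 < κ ∧ ∀ N : ℕ, 1 < (1 - tau n σ) * N →
      ∀ᵐ x, fracHessian σ (exampleFn n σ N) x = hessMatrix κ σ (tau n σ) N x := by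
  have := neZero_of_dim hn
  obtain ⟨κ, hκ, h⟩ := exists_fracHessian_fracLap_eq (n := n) (one_lt_of_sqrt_lt hn hσ) hσ2
  refine ⟨κ, hκ, fun N hN => ?_⟩
  have ht := half_lt_tau hn hσ
  have ht1 := tau_lt_one hn hσ
  obtain ⟨K, hK⟩ := exists_isC11Bump_profile (n := n) ht ht1 hN
  obtain ⟨C, _, hC⟩ := exists_integral_abs_mixedDiff_profile_le (n := n) ht ht1 hN
  exact h _ K C _ hK hC (ae_hasLineDerivAt_fderiv_profile ht ht1 hN)

theorem pucciMinus_eq {u : E n → ℝ} {D : E n → Matrix (Fin n) (Fin n) ℝ}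
    (h : ∀ᵐ x, fracHessian σ u x = D x) :
    pucciMinus σ lam Lam u =ᵐ[volume] fun x => pucciMatrix n σ lam Lam (D x) := by
  filter_upwards [h] with x hx
  rw [pucciMinus, hx, pucciMatrix]

theorem exists_abs_pucciMatrix_hessMatrix_le (hn : n = 2 ∨ n = 3) (hσ : Real.sqrt (n : ℝ) < σ)
    (hlam : 0 < lam) (hLam : (1 + σ) * lam ≤ Lam) {κ : ℝ} (hκ : 0 < κ) {N : ℕ}
    (hN : 1 < (1 - tau n σ) * N) :
    ∃ B, ∀ᵐ x : E n, |pucciMatrix n σ lam Lam (hessMatrix κ σ (tau n σ) N x)| ≤ B := by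
  have := neZero_of_dim hn
  have hσ1 := one_lt_of_sqrt_lt hn hσ
  have ht := half_lt_tau hn hσ
  have ht1 := tau_lt_one hn hσ
  obtain ⟨c, C, _, hC, h⟩ := exists_pucciMatrix_hessMatrix_bounds (n := n) (t := tau n σ) hκ
    (by linarith) hlam hLam ht ht1 (add_mul_tau (by linarith))
  have hNi : (0 : ℝ) < 1 / N := one_div_pos.2 (natCast_pos_of_one_lt ht1 hN)
  refine ⟨C * (1 / (N : ℝ)) ^ (-1 / tau n σ) + C * logN (tau n σ) N, ?_⟩
  filter_upwards [ae_norm_ne (n := n) 0] with x hx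
  refine (h N hN x (norm_ne_zero_iff.1 hx)).2.2.trans ?_
  gcongr
  exact annulusPower_le (by linarith) hNi x

theorem admissible_exampleFn (hn : n = 2 ∨ n = 3) (hσ : Real.sqrt (n : ℝ) < σ) (hσ2 : σ < 2)
    (hlam : 0 < lam) (hLam : (1 + σ) * lam ≤ Lam) {N : ℕ} (hN : 1 < (1 - tau n σ) * N) :
    Admissible σ lam Lam (pZero n σ) (exampleFn n σ N) := by
  have := neZero_of_dim hn
  have hσ1 := one_lt_of_sqrt_lt hn hσ
  have ht := half_lt_tau hn hσ
  have ht1 := tau_lt_one hn hσ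
  obtain ⟨K, hK⟩ := exists_isC11Bump_profile (n := n) ht ht1 hN
  obtain ⟨C, _, hC⟩ := exists_integral_abs_mixedDiff_profile_le (n := n) ht ht1 hN
  obtain ⟨κ, hκ, h⟩ := exists_fracHessian_exampleFn_eq hn hσ hσ2
  have hae := h N hN
  refine ⟨?_, ?_, fun i j => ?_, ?_⟩
  · have h1 := hK.isCHolder_fracLap (s := 2 - σ) (by linarith) (by linarith)
    rwa [sub_sub_cancel] at h1
  · exact hK.ae_integrable_secondDiff_fracLap (by linarith) (by linarith) (by linarith) hσ2 hC
  · obtain ⟨M, hM⟩ := exists_abs_hessMatrix_le (n := n) κ σ ht ht1 hN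
    refine (memLp_ball_of_bound 1 _ (measurable_hessMatrix κ σ _ N i j).aestronglyMeasurable
      (ae_of_all _ fun x => hM x i j)).ae_eq (ae_restrict_of_ae ?_)
    filter_upwards [hae] with x hx
    rw [hx]
  · obtain ⟨B, hB⟩ := exists_abs_pucciMatrix_hessMatrix_le hn hσ hlam hLam hκ hN
    exact (memLp_ball_of_bound 1 _
      (measurable_pucciMatrix_hessMatrix (by linarith)).aestronglyMeasurable hB).ae_eq
      (ae_restrict_of_ae (pucciMinus_eq hae).symm)

/-- The positive part lives on the middle annulus and costs `logN^(1/p₀)`; the full operator also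
sees the outer annulus, which adds a term linear in `logN`. Strict positivity is needed because the
norm is a denominator and division by `0` yields `0`. -/
theorem exists_lpNormOn_pucciMinus_bounds (hn : n = 2 ∨ n = 3) (hσ : Real.sqrt (n : ℝ) < σ)
    (hσ2 : σ < 2) (hlam : 0 < lam) (hLam : (1 + σ) * lam ≤ Lam) :
    ∃ C, 0 < C ∧ ∀ N : ℕ, 1 < (1 - tau n σ) * N →
      0 < lpNormOn (pZero n σ) (Metric.ball 0 1)
        (fun x => max (pucciMinus σ lam Lam (exampleFn n σ N) x) 0) ∧
      lpNormOn (pZero n σ) (Metric.ball 0 1)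
        (fun x => max (pucciMinus σ lam Lam (exampleFn n σ N) x) 0) ≤
          C * logN (tau n σ) N ^ (1 / pZero n σ) ∧
      lpNormOn (pZero n σ) (Metric.ball 0 1) (pucciMinus σ lam Lam (exampleFn n σ N)) ≤
        C * (logN (tau n σ) N ^ (1 / pZero n σ) + logN (tau n σ) N) := by
  have := neZero_of_dim hn
  have hσ1 := one_lt_of_sqrt_lt hn hσ
  have ht := half_lt_tau hn hσ
  have ht1 := tau_lt_one hn hσ
  have hp := one_lt_pZero hn hσ
  have hn0 : (0 : ℝ) < n := Nat.cast_pos.2 (NeZero.pos n)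
  obtain ⟨κ, hκ, hH⟩ := exists_fracHessian_exampleFn_eq hn hσ hσ2
  obtain ⟨c, C, hc, hC, h⟩ := exists_pucciMatrix_hessMatrix_bounds (n := n) (t := tau n σ) hκ
    (by linarith) hlam hLam ht ht1 (add_mul_tau (by linarith))
  set ω := n * volume.real (Metric.ball (0 : E n) 1) with hω
  have hω0 : 0 < ω := mul_pos hn0 (ENNReal.toReal_pos
    (Metric.measure_ball_pos _ _ one_pos).ne' measure_ball_lt_top.ne)
  set V := lpNormOn (pZero n σ) (Metric.ball (0 : E n) 1) (fun _ => (1 : ℝ)) with hV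
  have hV0 : 0 ≤ V := lpNormOn_nonneg _ _ _
  have hωp : 0 < ω ^ (1 / pZero n σ) := by positivity
  refine ⟨C * ω ^ (1 / pZero n σ) + C * V, by positivity, fun N hN => ?_⟩
  have hL := logN_pos hN
  have hNi : (0 : ℝ) < 1 / N := one_div_pos.2 (natCast_pos_of_one_lt ht1 hN)
  have hlt := one_div_lt_one_sub ht1 hN
  have hLp : 0 < logN (tau n σ) N ^ (1 / pZero n σ) := by positivity
  set a : E n → ℝ := annulusPower (tau n σ) (1 / N) (1 - tau n σ) with ha
  have ha0 : ∀ x, |a x| = a x := fun x => abs_of_nonneg (annulusPower_nonneg _ _ _ x)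
  have hamem : MemLp a (ENNReal.ofReal (pZero n σ)) (volume.restrict (Metric.ball 0 1)) :=
    memLp_annulusPower (by linarith) hNi 1 _
  have hanorm : lpNormOn (pZero n σ) (Metric.ball 0 1) a =
      ω ^ (1 / pZero n σ) * logN (tau n σ) N ^ (1 / pZero n σ) := by
    rw [pZero_eq, ha, lpNormOn_annulusPower (by linarith) hNi hlt.le (by linarith),
      ← Real.mul_rpow hω0.le hL.le, ← hω, logN, div_div_eq_mul_div, div_one]
  have hae := pucciMinus_eq (lam := lam) (Lam := Lam) (hH N hN)
  have hne := ae_norm_ne (n := n) 0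
  have hmem := (admissible_exampleFn hn hσ hσ2 hlam hLam hN).2.2.2
  refine ⟨?_, ?_, ?_⟩
  · refine lt_of_lt_of_le ?_ (mul_lpNormOn_le (g := a) hc (hmem.sup (MemLp.zero' )) ?_)
    · rw [hanorm]
      positivity
    · filter_upwards [hae, hne] with x hx hx0
      refine le_trans ?_ (le_abs_self _)
      change c * |a x| ≤ max (pucciMinus σ lam Lam (exampleFn n σ N) x) 0
      rw [hx, ha0]
      exact (h N hN x (norm_ne_zero_iff.1 hx0)).1
  · refine (lpNormOn_le_mul hC.le hamem ?_).trans ?_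
    · filter_upwards [hae, hne] with x hx hx0
      rw [hx, ha0, abs_of_nonneg (le_max_right _ _)]
      exact (h N hN x (norm_ne_zero_iff.1 hx0)).2.1
    · rw [hanorm, add_mul, mul_assoc]
      have : 0 ≤ C * V * logN (tau n σ) N ^ (1 / pZero n σ) := by positivity
      linarith
  · have h1mem : MemLp (fun _ : E n => (1 : ℝ)) (ENNReal.ofReal (pZero n σ))
        (volume.restrict (Metric.ball 0 1)) :=
      memLp_ball_of_bound 1 (B := 1) _ aestronglyMeasurable_const (ae_of_all _ fun x => by simp)
    have h2 : lpNormOn (pZero n σ) (Metric.ball 0 1) (pucciMinus σ lam Lam (exampleFn n σ N)) ≤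
        1 * lpNormOn (pZero n σ) (Metric.ball 0 1)
          ((fun x => C * a x) + fun _ => C * logN (tau n σ) N * 1) := by
      refine lpNormOn_le_mul zero_le_one
        ((hamem.const_mul C).add (h1mem.const_mul (C * logN (tau n σ) N))) ?_
      filter_upwards [hae, hne] with x hx hx0
      rw [hx, one_mul, Pi.add_apply, mul_one]
      exact (h N hN x (norm_ne_zero_iff.1 hx0)).2.2.trans (le_abs_self _)
    rw [one_mul] at h2
    have h3 := lpNormOn_add_le hp.le (hamem.const_mul C)
      (h1mem.const_mul (C * logN (tau n σ) N))
    have h4 : lpNormOn (pZero n σ) (Metric.ball 0 1) (fun x => C * a x) ≤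
        C * lpNormOn (pZero n σ) (Metric.ball 0 1) a :=
      lpNormOn_le_mul hC.le hamem (ae_of_all _ fun x => by rw [abs_mul, abs_of_pos hC])
    have h5 : lpNormOn (pZero n σ) (Metric.ball (0 : E n) 1)
        (fun _ => C * logN (tau n σ) N * 1) ≤ C * logN (tau n σ) N * V :=
      lpNormOn_le_mul (by positivity) h1mem (ae_of_all _ fun x => by
        rw [abs_mul, abs_of_pos (by positivity)])
    rw [hanorm] at h4
    have h6 : 0 ≤ C * V * logN (tau n σ) N ^ (1 / pZero n σ) := by positivity
    have h7 : 0 ≤ C * ω ^ (1 / pZero n σ) * logN (tau n σ) N := by positivity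
    calc _ ≤ C * (ω ^ (1 / pZero n σ) * logN (tau n σ) N ^ (1 / pZero n σ)) +
          C * logN (tau n σ) N * V := by linarith
      _ ≤ _ := by nlinarith

theorem tendsto_logN {t : ℝ} (ht1 : t < 1) : Tendsto (logN t) atTop atTop :=
  Real.tendsto_log_atTop.comp
    ((tendsto_natCast_atTop_atTop (R := ℝ)).const_mul_atTop (by linarith : 0 < 1 - t))

/-- The logarithm on the right equals `(logN t N + log(1-t))/2`, so stopping at radius `N^{-1/2}`
halves the main term. Hypothesis `h` absorbs `log(1-t)` at the price of another factor `2`. -/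
theorem logN_le_four_mul_log {t : ℝ} (ht1 : t < 1) {N : ℕ} (hN : 1 < (1 - t) * N)
    (h : -2 * Real.log (1 - t) ≤ logN t N) :
    logN t N ≤ 4 * Real.log ((1 - t) / (1 / Real.sqrt N)) := by
  have hN0 := natCast_pos_of_one_lt ht1 hN
  have h1t : 1 - t ≠ 0 := by linarith
  rw [div_div_eq_mul_div, div_one, Real.log_mul h1t (Real.sqrt_pos.2 hN0).ne',
    Real.log_sqrt hN0.le]
  rw [logN, Real.log_mul h1t hN0.ne'] at h ⊢
  linarith

theorem exists_le_lpNormOn_matNorm (hn : n = 2 ∨ n = 3) (hσ : Real.sqrt (n : ℝ) < σ) (hσ2 : σ < 2) :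
    ∃ c, 0 < c ∧ ∀ᶠ N : ℕ in atTop,
      c * (logN (tau n σ) N * logN (tau n σ) N ^ (1 / pZero n σ)) ≤
        lpNormOn (pZero n σ) (Metric.ball 0 (1 / 2))
          (fun x => matNorm (fracHessian σ (exampleFn n σ N) x)) := by
  have := neZero_of_dim hn
  have hσ1 := one_lt_of_sqrt_lt hn hσ
  have ht := half_lt_tau hn hσ
  have ht1 := tau_lt_one hn hσ
  have hp := one_lt_pZero hn hσ
  have hn0 : (0 : ℝ) < n := Nat.cast_pos.2 (NeZero.pos n)
  have hn2 : 2 ≤ n := by rcases hn with rfl | rfl <;> norm_num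
  obtain ⟨κ, hκ, hH⟩ := exists_fracHessian_exampleFn_eq hn hσ hσ2
  obtain ⟨c, hc, h⟩ := exists_le_matNorm_hessMatrix (n := n) (t := tau n σ) hn2 hκ
    (by linarith : 0 < σ) ht ht1
  set ω := n * volume.real (Metric.ball (0 : E n) 1) with hω
  have hω0 : 0 < ω := mul_pos hn0 (ENNReal.toReal_pos
    (Metric.measure_ball_pos _ _ one_pos).ne' measure_ball_lt_top.ne)
  refine ⟨c * (ω / 4) ^ (1 / pZero n σ), by positivity, ?_⟩
  have hlim := tendsto_logN ht1
  have hlim' := (tendsto_natCast_atTop_atTop (R := ℝ)).const_mul_atTop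
    (by linarith : 0 < 1 - tau n σ)
  filter_upwards [hlim'.eventually_gt_atTop 1,
    hlim.eventually_ge_atTop (-2 * Real.log (1 - tau n σ))] with N hN hNlog
  have hL := logN_pos hN
  have hN0 := natCast_pos_of_one_lt ht1 hN
  have h4 := logN_le_four_mul_log ht1 hN hNlog
  have hsi : 0 < 1 / Real.sqrt N := one_div_pos.2 (Real.sqrt_pos.2 hN0)
  -- Otherwise the logarithm in `h4` would be nonpositive, contradicting `0 < logN`.
  have hle : 1 / Real.sqrt N ≤ 1 - tau n σ := by
    rw [← one_le_div hsi]
    by_contra hlt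
    have h5 := Real.log_nonpos (div_nonneg (by linarith) hsi.le) (not_le.1 hlt).le
    linarith
  set a : E n → ℝ := annulusPower (tau n σ) (1 / Real.sqrt N) (1 - tau n σ) with ha
  -- The annulus fits in the ball of radius `1/2` because `τ > 1/2`. Its norm supplies
  -- `logN^(1/p₀)`; the further full factor `logN` comes from the pointwise size of the Hessian.
  have hanorm : (ω / 4) ^ (1 / pZero n σ) * logN (tau n σ) N ^ (1 / pZero n σ) ≤
      lpNormOn (pZero n σ) (Metric.ball 0 (1 / 2)) a := by
    rw [pZero_eq, ha, lpNormOn_annulusPower (by linarith) hsi hle (by linarith),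
      ← Real.mul_rpow (by positivity) hL.le, ← hω]
    refine Real.rpow_le_rpow (by positivity) ?_ (by rw [← pZero_eq]; positivity)
    nlinarith
  obtain ⟨M, hM⟩ := exists_abs_hessMatrix_le (n := n) κ σ ht ht1 hN
  have hmem : MemLp (fun x : E n => matNorm (hessMatrix κ σ (tau n σ) N x))
      (ENNReal.ofReal (pZero n σ)) (volume.restrict (Metric.ball 0 (1 / 2))) := by
    refine memLp_ball_of_bound _ (B := Real.sqrt (∑ _i : Fin n, ∑ _j : Fin n, M ^ 2)) _
      measurable_matNorm_hessMatrix.aestronglyMeasurable (ae_of_all _ fun x => ?_)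
    rw [matNorm, abs_of_nonneg (Real.sqrt_nonneg _)]
    refine Real.sqrt_le_sqrt (Finset.sum_le_sum fun i _ => Finset.sum_le_sum fun j _ => ?_)
    rw [← sq_abs]
    exact pow_le_pow_left₀ (abs_nonneg _) (hM x i j) 2
  have hae : (fun x => matNorm (fracHessian σ (exampleFn n σ N) x)) =ᵐ[volume]
      fun x => matNorm (hessMatrix κ σ (tau n σ) N x) := by
    filter_upwards [hH N hN] with x hx
    rw [hx]
  rw [lpNormOn_congr_ae hae]
  refine le_trans ?_ (mul_lpNormOn_le (g := a) (c := c * logN (tau n σ) N) (by positivity) hmem ?_)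
  · calc _ = c * logN (tau n σ) N *
          ((ω / 4) ^ (1 / pZero n σ) * logN (tau n σ) N ^ (1 / pZero n σ)) := by ring
      _ ≤ _ := by gcongr
  · filter_upwards [ae_norm_ne (n := n) 0] with x hx0
    rw [abs_of_nonneg (annulusPower_nonneg _ _ _ x)]
    exact (h N hN x (norm_ne_zero_iff.1 hx0)).trans (le_abs_self _)

end examples

/-! ### Divergent quotients -/

theorem tendsto_atTop_of_rpow_le {L q : ℕ → ℝ} {a : ℝ} (ha : 0 < a) (hL : Tendsto L atTop atTop)
    (h : ∃ c, 0 < c ∧ ∀ᶠ N in atTop, c * L N ^ a ≤ q N) : Tendsto q atTop atTop := by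
  obtain ⟨c, hc, hcq⟩ := h
  exact tendsto_atTop_mono' _ hcq (((tendsto_rpow_atTop ha).comp hL).const_mul_atTop hc)

theorem not_eventually_le_mul {f g : ℕ → ℝ} (hg : ∀ N, 0 ≤ g N)
    (h : Tendsto (fun N => f N / g N) atTop atTop) (C : ℝ) : ¬ ∀ᶠ N in atTop, f N ≤ C * g N := by
  intro hC
  obtain ⟨N, h1, h2⟩ := (hC.and (h.eventually_gt_atTop (max C 0))).exists
  -- If `g N = 0` the quotient is `0` by convention and cannot exceed `max C 0`; taking this maximum
  -- lets one threshold serve both cases.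
  rcases eq_or_lt_of_le (hg N) with h3 | h3
  · rw [← h3, div_zero] at h2
    exact (le_max_right C 0).not_gt h2
  · have h4 : f N / g N ≤ C := by rwa [div_le_iff₀ h3]
    exact (h4.trans (le_max_left C 0)).not_gt h2

end NonlocalABP

/-! ### Blow-up rates and failure of the two estimates. -/

theorem mainTheorem3 (n : ℕ) (hn : n = 2 ∨ n = 3) (σ : ℝ) (hσ : Real.sqrt (n : ℝ) < σ)
    (hσ2 : σ < 2) (lam Lam : ℝ) (hlam : 0 < lam) (hLam : (1 + σ) * lam ≤ Lam) :
    -- the exponent is above the critical one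
    (n : ℝ) / σ < NonlocalABP.pZero n σ ∧
    -- the functions `P_N` and `u_N`
    (∀ N : ℕ, 1 < (1 - NonlocalABP.tau n σ) * (N : ℝ) →
      MonotoneOn (NonlocalABP.profile (NonlocalABP.tau n σ) N) (Set.Ici 0) ∧
      ContDiff ℝ 1 (NonlocalABP.potential n σ N) ∧
      (∃ K, LipschitzWith K (fderiv ℝ (NonlocalABP.potential n σ N))) ∧
      (∀ x, 1 ≤ ‖x‖ → NonlocalABP.potential n σ N x = 0) ∧
      (∀ x, MeasureTheory.Integrable
        (NonlocalABP.fracLapIntegrand (2 - σ) (NonlocalABP.potential n σ N) x)) ∧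
      (∀ x y, ‖x‖ = ‖y‖ → NonlocalABP.exampleFn n σ N x = NonlocalABP.exampleFn n σ N y) ∧
      (∀ x, 1 ≤ ‖x‖ → 0 ≤ NonlocalABP.exampleFn n σ N x) ∧
      NonlocalABP.Admissible σ lam Lam (NonlocalABP.pZero n σ) (NonlocalABP.exampleFn n σ N)) ∧
    -- blow-up of the ABP quotient, with its rate
    (∃ c : ℝ, 0 < c ∧ ∀ᶠ N : ℕ in Filter.atTop,
      c * NonlocalABP.logN (NonlocalABP.tau n σ) N ^ (1 - 1 / NonlocalABP.pZero n σ) ≤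
        NonlocalABP.infDrop (NonlocalABP.exampleFn n σ N) /
          NonlocalABP.lpNormOn (NonlocalABP.pZero n σ) (Metric.ball 0 1)
            (fun x => max (NonlocalABP.pucciMinus σ lam Lam (NonlocalABP.exampleFn n σ N) x) 0)) ∧
    Filter.Tendsto (fun N : ℕ =>
        NonlocalABP.infDrop (NonlocalABP.exampleFn n σ N) /
          NonlocalABP.lpNormOn (NonlocalABP.pZero n σ) (Metric.ball 0 1)
            (fun x => max (NonlocalABP.pucciMinus σ lam Lam (NonlocalABP.exampleFn n σ N) x) 0))
      Filter.atTop Filter.atTop ∧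
    -- blow-up of the `W^{σ,p₀}` quotient, with its rate
    (∃ c : ℝ, 0 < c ∧ ∀ᶠ N : ℕ in Filter.atTop,
      c * NonlocalABP.logN (NonlocalABP.tau n σ) N ^ (1 / NonlocalABP.pZero n σ) ≤
        NonlocalABP.lpNormOn (NonlocalABP.pZero n σ) (Metric.ball 0 (1 / 2))
            (fun x => NonlocalABP.matNorm
              (NonlocalABP.fracHessian σ (NonlocalABP.exampleFn n σ N) x)) /
          (NonlocalABP.lpNormOn (NonlocalABP.pZero n σ) (Metric.ball 0 1)
              (NonlocalABP.pucciMinus σ lam Lam (NonlocalABP.exampleFn n σ N)) +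
            NonlocalABP.linftyNorm (NonlocalABP.exampleFn n σ N))) ∧
    Filter.Tendsto (fun N : ℕ =>
        NonlocalABP.lpNormOn (NonlocalABP.pZero n σ) (Metric.ball 0 (1 / 2))
            (fun x => NonlocalABP.matNorm
              (NonlocalABP.fracHessian σ (NonlocalABP.exampleFn n σ N) x)) /
          (NonlocalABP.lpNormOn (NonlocalABP.pZero n σ) (Metric.ball 0 1)
              (NonlocalABP.pucciMinus σ lam Lam (NonlocalABP.exampleFn n σ N)) +
            NonlocalABP.linftyNorm (NonlocalABP.exampleFn n σ N)))
      Filter.atTop Filter.atTop ∧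
    -- the ABP estimate fails at `p₀`
    (¬ ∃ C : ℝ, ∀ u : NonlocalABP.E n → ℝ,
      NonlocalABP.Admissible σ lam Lam (NonlocalABP.pZero n σ) u →
      -sInf (u '' Metric.ball 0 1) ≤ -sInf (u '' (Metric.ball 0 1)ᶜ) +
        C * NonlocalABP.lpNormOn (NonlocalABP.pZero n σ) (Metric.ball 0 1)
          (fun x => max (NonlocalABP.pucciMinus σ lam Lam u x) 0)) ∧
    -- the `W^{σ,p₀}` estimate fails
    (¬ ∃ C : ℝ, ∀ u : NonlocalABP.E n → ℝ,
      NonlocalABP.Admissible σ lam Lam (NonlocalABP.pZero n σ) u →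
      NonlocalABP.lpNormOn (NonlocalABP.pZero n σ) (Metric.ball 0 (1 / 2))
          (fun x => NonlocalABP.matNorm (NonlocalABP.fracHessian σ u x)) ≤
        C * (NonlocalABP.lpNormOn (NonlocalABP.pZero n σ) (Metric.ball 0 1)
            (NonlocalABP.pucciMinus σ lam Lam u) + NonlocalABP.linftyNorm u)) := by
  have : NeZero n := NonlocalABP.neZero_of_dim hn
  have hσ1 := NonlocalABP.one_lt_of_sqrt_lt hn hσ
  have ht := NonlocalABP.half_lt_tau hn hσ
  have ht1 := NonlocalABP.tau_lt_one hn hσ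
  have hp := NonlocalABP.one_lt_pZero hn hσ
  have hst := NonlocalABP.two_sub_lt hn hσ
  have hs : 0 < 2 - σ := by linarith
  have hs1 : 2 - σ < 1 := by linarith
  have hadm := fun N => NonlocalABP.admissible_exampleFn (N := N) hn hσ hσ2 hlam hLam
  have hLlim := NonlocalABP.tendsto_logN ht1
  have hNlim : Tendsto (fun N : ℕ => (1 - NonlocalABP.tau n σ) * (N : ℝ)) atTop atTop :=
    (tendsto_natCast_atTop_atTop (R := ℝ)).const_mul_atTop (by linarith)
  have hpinv : 1 / NonlocalABP.pZero n σ < 1 := by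
    rw [div_lt_one (by linarith)]
    exact hp
  have hpinv0 : 0 < 1 / NonlocalABP.pZero n σ := by positivity
  obtain ⟨C, hC, hpucci⟩ := NonlocalABP.exists_lpNormOn_pucciMinus_bounds hn hσ hσ2 hlam hLam
  obtain ⟨c₁, hc₁, hdrop⟩ :=
    NonlocalABP.exists_le_infDrop_fracLap_profile (n := n) ht ht1 hs hs1 hst
  obtain ⟨C₁, hC₁, hlinf⟩ :=
    NonlocalABP.exists_linftyNorm_fracLap_profile_le (n := n) ht ht1 hs hs1 hst
  obtain ⟨c₂, hc₂, hhess⟩ := NonlocalABP.exists_le_lpNormOn_matNorm hn hσ hσ2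
  have hrate₁ : ∃ c : ℝ, 0 < c ∧ ∀ᶠ N : ℕ in atTop,
      c * NonlocalABP.logN (NonlocalABP.tau n σ) N ^ (1 - 1 / NonlocalABP.pZero n σ) ≤
        NonlocalABP.infDrop (NonlocalABP.exampleFn n σ N) /
          NonlocalABP.lpNormOn (NonlocalABP.pZero n σ) (Metric.ball 0 1)
            (fun x => max (NonlocalABP.pucciMinus σ lam Lam (NonlocalABP.exampleFn n σ N) x) 0) := by
    refine ⟨c₁ / C, by positivity, ?_⟩
    filter_upwards [hNlim.eventually_gt_atTop 1] with N hN
    have hL := NonlocalABP.logN_pos hN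
    obtain ⟨h1, h2, -⟩ := hpucci N hN
    rw [le_div_iff₀ h1, Real.rpow_sub hL, Real.rpow_one]
    refine le_trans ?_ (hdrop N hN)
    refine (mul_le_mul_of_nonneg_left h2 (by positivity)).trans (le_of_eq ?_)
    field_simp
  have hrate₂ : ∃ c : ℝ, 0 < c ∧ ∀ᶠ N : ℕ in atTop,
      c * NonlocalABP.logN (NonlocalABP.tau n σ) N ^ (1 / NonlocalABP.pZero n σ) ≤
        NonlocalABP.lpNormOn (NonlocalABP.pZero n σ) (Metric.ball 0 (1 / 2))
            (fun x => NonlocalABP.matNorm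
              (NonlocalABP.fracHessian σ (NonlocalABP.exampleFn n σ N) x)) /
          (NonlocalABP.lpNormOn (NonlocalABP.pZero n σ) (Metric.ball 0 1)
              (NonlocalABP.pucciMinus σ lam Lam (NonlocalABP.exampleFn n σ N)) +
            NonlocalABP.linftyNorm (NonlocalABP.exampleFn n σ N)) := by
    refine ⟨c₂ / (2 * C + C₁), by positivity, ?_⟩
    filter_upwards [hNlim.eventually_gt_atTop 1, hLlim.eventually_ge_atTop 1, hhess]
      with N hN hL1 hh
    obtain ⟨h1, h2, h3⟩ := hpucci N hN
    have h4 : NonlocalABP.linftyNorm (NonlocalABP.exampleFn n σ N) ≤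
        C₁ * NonlocalABP.logN (NonlocalABP.tau n σ) N := hlinf N hN
    set L := NonlocalABP.logN (NonlocalABP.tau n σ) N
    set d := NonlocalABP.lpNormOn (NonlocalABP.pZero n σ) (Metric.ball 0 1)
      (NonlocalABP.pucciMinus σ lam Lam (NonlocalABP.exampleFn n σ N)) +
        NonlocalABP.linftyNorm (NonlocalABP.exampleFn n σ N)
    have h5 : L ^ (1 / NonlocalABP.pZero n σ) ≤ L := by
      simpa using Real.rpow_le_rpow_of_exponent_le hL1 hpinv.le
    -- For `L ≥ 1` the term `L^(1/p₀)` is absorbed by `L`, so the whole denominator is linear in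
    -- `L`, against a numerator of order `L^(1+1/p₀)`.
    have h6 : d ≤ (2 * C + C₁) * L := by nlinarith
    have h7 : 0 < d := by
      refine lt_of_lt_of_le h1 (le_trans (NonlocalABP.lpNormOn_le_mul zero_le_one
        (hadm N hN).2.2.2 (ae_of_all _ fun x => ?_)) ?_)
      · rw [one_mul]
        exact abs_max_le_max_abs_abs.trans (by rw [abs_zero, max_eq_left (abs_nonneg _)])
      · rw [one_mul]
        exact le_add_of_nonneg_right ENNReal.toReal_nonneg
    rw [le_div_iff₀ h7]
    refine le_trans ?_ hh
    calc _ ≤ c₂ / (2 * C + C₁) * L ^ (1 / NonlocalABP.pZero n σ) * ((2 * C + C₁) * L) := by gcongr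
      _ = _ := by
        field_simp
  have htend₁ := NonlocalABP.tendsto_atTop_of_rpow_le (by linarith) hLlim hrate₁
  have htend₂ := NonlocalABP.tendsto_atTop_of_rpow_le hpinv0 hLlim hrate₂
  refine ⟨NonlocalABP.div_lt_pZero hn hσ, fun N hN => ?_, hrate₁, htend₁, hrate₂, htend₂, ?_, ?_⟩
  · obtain ⟨K, hK⟩ := NonlocalABP.exists_isC11Bump_profile (n := n) ht ht1 hN
    refine ⟨NonlocalABP.monotoneOn_profile ht ht1 hN, ?_, ⟨K.toNNReal, ?_⟩, hK.eq_zero,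
      hK.integrable_fracLapIntegrand hs hs1, fun x y h => NonlocalABP.fracLap_radial h,
      fun x hx => NonlocalABP.fracLap_profile_nonneg ht ht1 hs (by linarith) hN hx, hadm N hN⟩
    · exact contDiff_one_iff_fderiv.2 ⟨hK.differentiable, hK.continuous_fderiv⟩
    · exact LipschitzWith.of_dist_le_mul fun x y => by
        rw [dist_eq_norm, dist_eq_norm, Real.coe_toNNReal _ hK.nonneg]
        exact hK.norm_fderiv_sub_le x y
  · rintro ⟨B, hB⟩
    refine NonlocalABP.not_eventually_le_mul (fun N => NonlocalABP.lpNormOn_nonneg _ _ _) htend₁ B ?_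
    filter_upwards [hNlim.eventually_gt_atTop 1] with N hN
    have h1 := hB _ (hadm N hN)
    rw [NonlocalABP.infDrop]
    linarith
  · rintro ⟨B, hB⟩
    refine NonlocalABP.not_eventually_le_mul
      (fun N => add_nonneg (NonlocalABP.lpNormOn_nonneg _ _ _) ENNReal.toReal_nonneg) htend₂ B ?_
    filter_upwards [hNlim.eventually_gt_atTop 1] with N hN
    exact hB _ (hadm N hN)
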